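/- **Setting.** Let $M$, $M'$ be (Hausdorff) smooth manifolds of dimension $m$, let $I\subset M$ and $I'\subset M'$ be closed embedded submanifolds, and let $s\in\mathbb R$. For $U$ open, $\mathcal D'(U)$ is the space of complex distributions on $U$ (families of distributions in the charts, transforming like functions), so that the pullback $\Phi^*$ by a diffeomorphism extends the pullback of functions. A vector field $\rho$ on an open set $\Omega\subset M$ is *Euler* if $\rho f-f\in\mathcal I(\Omega)^2$ for every $f\in\mathcal I(\Omega)$, where $\mathcal I(\Omega)$ is the ideal of smooth functions on $\Omega$ vanishing on $I\cap\Omega$ and $\mathcal I(\Omega)^2$ is its square. Write $S(\lambda)=e^{(\log\lambda)\rho}$, $\lambda\in(0,1]$. An open set $V\subset\Omega$ is *$\rho$-convex* if these flow maps are defined on $V$ and map $V$ into itself, and then $E^\rho_s(V)$ is the set of $t\in\mathcal D'(V)$ such that $\sup_{\lambda\in(0,1]}|\lambda^{-s}\langle S(\lambda)^*t,\varphi\rangle|<\infty$ for every smooth test density $\varphi$ with compact support in $V$. For $U$ open, $p\in I$, and $\rho$ an Euler vector field defined near $p$, a distribution $t\in\mathcal D'(U)$ belongs to $E^\rho_{s,p}(U)$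 if there is a $\rho$-convex open set $V\subset U$, contained in the domain of $\rho$, such that $\overline V$ is a neighbourhood of $p$ and $t|_V\in E^\rho_s(V)$. Finally $E_{s,I}(U)$ is the set of $t\in\mathcal D'(U)$ such that for every $p\in I\cap\operatorname{int}(\overline U)$ one has $t\in E^\rho_{s,p}(U)$ for some Euler vector field $\rho$ near $p$. The spaces $E_{s,I'}(U')$ are defined in the same way on $M'$. **Theorem.** 1. Let $\Phi:W\to W'$ be a diffeomorphism between open sets $W\subset M$ and $W'\subset M'$ such that $\Phi(I\cap W)=I'\cap W'$. Let $U\subset W$ be open and $U'=\Phi(U)$, and suppose that $I\cap\operatorname{int}(\overline U)\subset W$ and $I'\cap\operatorname{int}(\overline{U'})\subset W'$. Then $$\Phi^*E_{s,I'}(U')=E_{s,I}(U).$$ (In particular this applies with $W=U$ and $W'=U'$ whenever $I\cap\operatorname{int}(\overline U)\subset U$ and $I'\cap\operatorname{int}(\overline{U'})\subset U'$.) 2. Suppose that $\dim I<m$. The spaces do not depend on the choice of Euler vector fields: if $U\subset M$ is open and $p\in I$ is such that $U\cup I$ is a neighbourhood of $p$ (for example $p\in U$, or $U=\Omega\setminus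 I$ with $\Omega$ an open neighbourhood of $p$), then $E^{\rho_1}_{s,p}(U)=E^{\rho_2}_{s,p}(U)$ for all Euler vector fields $\rho_1,\rho_2$ near $p$. Consequently, if $U\cup I$ is a neighbourhood of every $p\in I\cap\operatorname{int}(\overline U)$, then for every choice of Euler vector fields $\rho_p$ near $p$ $(p\in I)$, $$E_{s,I}(U)=\{t\in\mathcal D'(U):\ t\in E^{\rho_p}_{s,p}(U)\ \text{ for all } p\in I\cap\operatorname{int}(\overline U)\}.$$ -/

import Mathlib

open Set Filter Topology TopologicalSpace
open scoped Manifold ContDiff Distributions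

noncomputable section

namespace WeakHomogeneity

/-! ### Distributions on open subsets of a manifold

A distribution on a manifold is a family of distributions, one in each chart of the maximal
atlas, that agree on overlaps under the usual change of variables. -/

/-- The image of the open set `U` in the chart `κ`, i.e. `κ (U ∩ κ.source)`. -/
def chartImage {m : ℕ} {M : Type*} [TopologicalSpace M]
    (κ : OpenPartialHomeomorph M (EuclideanSpace ℝ (Fin m))) (U : Opens M) :
    Opens (EuclideanSpace ℝ (Fin m)) :=
  ⟨κ.target ∩ κ.symm ⁻¹' (U : Set M), κ.isOpen_inter_preimage_symm U.isOpen⟩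

/-- `f₁ |dy|` in the chart `κ₁` and `f₂ |dy|` in the chart `κ₂` represent the same compactly
supported density, supported in the common domain of the two charts: the functions are
compactly supported in the overlap, where
`f₁ y = |det D(κ₂ ∘ κ₁⁻¹)(y)| f₂ (κ₂ (κ₁⁻¹ y))`. -/
structure SameDensity {m : ℕ} {M : Type*} [TopologicalSpace M]
    (κ₁ κ₂ : OpenPartialHomeomorph M (EuclideanSpace ℝ (Fin m)))
    (f₁ f₂ : EuclideanSpace ℝ (Fin m) → ℝ) : Prop where
  supp_left : tsupport f₁ ⊆ κ₁.target ∩ κ₁.symm ⁻¹' κ₂.source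
  supp_right : tsupport f₂ ⊆ κ₂.target ∩ κ₂.symm ⁻¹' κ₁.source
  eq_on : ∀ y ∈ κ₁.target ∩ κ₁.symm ⁻¹' κ₂.source,
    f₁ y = |(fderiv ℝ (κ₂ ∘ κ₁.symm) y).det| * f₂ (κ₂ (κ₁.symm y))

/-- The charts of the maximal smooth atlas of `M`. -/
abbrev Chart (m : ℕ) (M : Type*) [TopologicalSpace M]
    [ChartedSpace (EuclideanSpace ℝ (Fin m)) M] : Type _ :=
  {κ : OpenPartialHomeomorph M (EuclideanSpace ℝ (Fin m)) //
    κ ∈ IsManifold.maximalAtlas (𝓡 m) ∞ M}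

/-- The space `𝓓'(U)` of complex distributions on the open subset `U` of the manifold `M`: in every
chart `κ` a distribution `t_κ ∈ 𝓓'(κ(U))`, with `t_{κ₁} = (κ₂ ∘ κ₁⁻¹)^* t_{κ₂}` on overlaps.
A locally integrable function `u` on `U` gives `t_κ(f) = ∫ u (κ⁻¹ y) f y dy`. -/
@[ext]
structure ManifoldDistribution (m : ℕ) (M : Type*) [TopologicalSpace M]
    [ChartedSpace (EuclideanSpace ℝ (Fin m)) M] (U : Opens M) where
  inChart : (κ : Chart m M) → 𝓓'(chartImage κ.1 U, ℂ)
  compat : ∀ (κ₁ κ₂ : Chart m M) (f₁ : 𝓓(chartImage κ₁.1 U, ℝ)) (f₂ : 𝓓(chartImage κ₂.1 U, ℝ)),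
    SameDensity κ₁.1 κ₂.1 f₁ f₂ → inChart κ₁ f₁ = inChart κ₂ f₂

/-- Restriction of a distribution on `U` to a smaller open set `V`. -/
def ManifoldDistribution.restrict {m : ℕ} {M : Type*} [TopologicalSpace M]
    [ChartedSpace (EuclideanSpace ℝ (Fin m)) M] {U V : Opens M} (hVU : V ≤ U)
    (t : ManifoldDistribution m M U) : ManifoldDistribution m M V where
  inChart κ := (TestFunction.monoCLM ℝ).precompCompactConvergenceCLM ℂ (t.inChart κ)
  compat κ₁ κ₂ f₁ f₂ h := by
    have hle : ∀ κ : Chart m M, chartImage κ.1 V ≤ chartImage κ.1 U :=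
      fun κ y hy => ⟨hy.1, hVU hy.2⟩
    refine t.compat κ₁ κ₂ _ _ ?_
    simpa [hle] using h

/-- The chart `κ ∘ Φ⁻¹` of `M'`, for a chart `κ` of `M` and a diffeomorphism `Φ` from an open
subset of `M` onto an open subset of `M'`. -/
def transportChart {m : ℕ} {M M' : Type*}
    [TopologicalSpace M] [ChartedSpace (EuclideanSpace ℝ (Fin m)) M] [IsManifold (𝓡 m) ∞ M]
    [TopologicalSpace M'] [ChartedSpace (EuclideanSpace ℝ (Fin m)) M'] [IsManifold (𝓡 m) ∞ M']
    (Φ : PartialDiffeomorph (𝓡 m) (𝓡 m) M M' ∞) (κ : Chart m M) : Chart m M' :=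
  ⟨Φ.symm.toOpenPartialHomeomorph.trans κ.1, by
    apply OpenPartialHomeomorph.mem_maximalAtlas_of_contMDiffOn
    · exact (contMDiffOn_of_mem_maximalAtlas κ.2).comp
        (Φ.symm.contMDiffOn.mono inter_subset_left) inter_subset_right
    · exact Φ.contMDiffOn.comp
        ((contMDiffOn_symm_of_mem_maximalAtlas κ.2).mono inter_subset_left) inter_subset_right⟩

theorem SameDensity.transport {m : ℕ} {M M' : Type*}
    [TopologicalSpace M] [ChartedSpace (EuclideanSpace ℝ (Fin m)) M] [IsManifold (𝓡 m) ∞ M]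
    [TopologicalSpace M'] [ChartedSpace (EuclideanSpace ℝ (Fin m)) M'] [IsManifold (𝓡 m) ∞ M']
    (Φ : PartialDiffeomorph (𝓡 m) (𝓡 m) M M' ∞) {κ₁ κ₂ : Chart m M}
    {f₁ f₂ : EuclideanSpace ℝ (Fin m) → ℝ} (h : SameDensity κ₁.1 κ₂.1 f₁ f₂)
    (h₁ : ∀ y ∈ tsupport f₁, κ₁.1.symm y ∈ Φ.source)
    (h₂ : ∀ y ∈ tsupport f₂, κ₂.1.symm y ∈ Φ.source) :
    SameDensity (transportChart Φ κ₁).1 (transportChart Φ κ₂).1 f₁ f₂ := by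
  have hleft : ∀ x ∈ Φ.source, Φ.invFun (Φ x) = x := fun x hx => Φ.left_inv' hx
  have hmap : ∀ x ∈ Φ.source, Φ x ∈ Φ.target := fun x hx => Φ.map_source' hx
  refine ⟨fun y hy => ?_, fun y hy => ?_, fun y hy => ?_⟩
  · have hx := h₁ y hy
    have hy' := h.supp_left hy
    refine ⟨⟨hy'.1, hx⟩, hmap _ hx, ?_⟩
    change Φ.invFun (Φ (κ₁.1.symm y)) ∈ κ₂.1.source
    rw [hleft _ hx]; exact hy'.2
  · have hx := h₂ y hy
    have hy' := h.supp_right hy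
    refine ⟨⟨hy'.1, hx⟩, hmap _ hx, ?_⟩
    change Φ.invFun (Φ (κ₂.1.symm y)) ∈ κ₁.1.source
    rw [hleft _ hx]; exact hy'.2
  · obtain ⟨⟨hy1, hx⟩, -, hy2⟩ := hy
    change κ₁.1.symm y ∈ Φ.source at hx
    change Φ.invFun (Φ (κ₁.1.symm y)) ∈ κ₂.1.source at hy2
    rw [hleft _ hx] at hy2
    have hEq : ((transportChart Φ κ₂).1 ∘ (transportChart Φ κ₁).1.symm)
        =ᶠ[𝓝 y] (κ₂.1 ∘ κ₁.1.symm) := by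
      have hopen := κ₁.1.isOpen_inter_preimage_symm Φ.open_source
      filter_upwards [hopen.mem_nhds ⟨hy1, hx⟩] with z hz
      change κ₂.1 (Φ.invFun (Φ (κ₁.1.symm z))) = κ₂.1 (κ₁.1.symm z)
      rw [hleft _ hz.2]
    rw [hEq.fderiv_eq]
    change f₁ y = _ * f₂ (κ₂.1 (Φ.invFun (Φ (κ₁.1.symm y))))
    rw [hleft _ hx]
    exact h.eq_on y ⟨hy1, hy2⟩

/-- The pullback `Φ^* : 𝓓'(U') → 𝓓'(U)` under a diffeomorphism `Φ` between open sets, where `U`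
lies in the domain of `Φ` and `Φ(U) ⊆ U'`. In charts, `(Φ^* t)_κ = t_{κ ∘ Φ⁻¹}`; for a function `t`
this is `t ∘ Φ`. -/
def ManifoldDistribution.pullback {m : ℕ} {M M' : Type*}
    [TopologicalSpace M] [ChartedSpace (EuclideanSpace ℝ (Fin m)) M] [IsManifold (𝓡 m) ∞ M]
    [TopologicalSpace M'] [ChartedSpace (EuclideanSpace ℝ (Fin m)) M'] [IsManifold (𝓡 m) ∞ M']
    (Φ : PartialDiffeomorph (𝓡 m) (𝓡 m) M M' ∞) {U : Opens M} {U' : Opens M'}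
    (hΦ : ∀ x ∈ U, x ∈ Φ.source ∧ Φ x ∈ U')
    (t : ManifoldDistribution m M' U') : ManifoldDistribution m M U where
  inChart κ :=
    (TestFunction.monoCLM ℝ).precompCompactConvergenceCLM ℂ (t.inChart (transportChart Φ κ))
  compat κ₁ κ₂ f₁ f₂ h := by
    have hle : ∀ κ : Chart m M,
        chartImage κ.1 U ≤ chartImage (transportChart Φ κ).1 U' :=
      fun κ y hy => ⟨⟨hy.1, (hΦ _ hy.2).1⟩, (hΦ _ hy.2).2⟩
    refine t.compat _ _ _ _ ?_
    have key := h.transport Φ (fun y hy => (hΦ _ (f₁.tsupport_subset hy).2).1)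
      (fun y hy => (hΦ _ (f₂.tsupport_subset hy).2).1)
    simpa [hle] using key

/-! ### Submanifolds and Euler vector fields -/

/-- `I` is an `n`-dimensional embedded submanifold of the `m`-dimensional manifold `M`: near each of
its points there is a smooth chart `(x, h)`, with `x` the first `n` and `h` the last `m - n`
coordinates, in which `I = {h = 0}`. -/
def IsEmbeddedSubmanifold {m : ℕ} {M : Type*} [TopologicalSpace M]
    [ChartedSpace (EuclideanSpace ℝ (Fin m)) M] (n : ℕ) (I : Set M) : Prop :=
  n ≤ m ∧ ∀ p ∈ I, ∃ κ ∈ IsManifold.maximalAtlas (𝓡 m) ∞ M, p ∈ κ.source ∧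
    ∀ q ∈ κ.source, q ∈ I ↔ ∀ j : Fin m, n ≤ j.val → κ q j = 0

/-- The ideal of smooth functions on the open set `Ω` that vanish on `I` (the functions are
total, only their values on `Ω` matter). -/
def vanishingIdeal {m : ℕ} {M : Type*} [TopologicalSpace M]
    [ChartedSpace (EuclideanSpace ℝ (Fin m)) M] (I : Set M) (Ω : Opens M) : Set (M → ℝ) :=
  {f | ContMDiffOn (𝓡 m) 𝓘(ℝ, ℝ) ∞ f Ω ∧ ∀ x ∈ I ∩ (Ω : Set M), f x = 0}

/-- The square of the ideal `vanishingIdeal I Ω`: finite sums of products of two elements. -/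
def vanishingIdealSq {m : ℕ} {M : Type*} [TopologicalSpace M]
    [ChartedSpace (EuclideanSpace ℝ (Fin m)) M] (I : Set M) (Ω : Opens M) : Set (M → ℝ) :=
  {g | ∃ (k : ℕ) (a b : Fin k → M → ℝ),
    (∀ i, a i ∈ vanishingIdeal (m := m) I Ω ∧ b i ∈ vanishingIdeal (m := m) I Ω) ∧
      ∀ x ∈ Ω, g x = ∑ i, a i x * b i x}

/-- The derivative `ρ f` of the function `f` along the vector field `ρ`. -/
def lieDeriv {m : ℕ} {M : Type*} [TopologicalSpace M]
    [ChartedSpace (EuclideanSpace ℝ (Fin m)) M]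
    (ρ : (x : M) → TangentSpace (𝓡 m) x) (f : M → ℝ) (x : M) : ℝ :=
  mfderiv (𝓡 m) 𝓘(ℝ, ℝ) f x (ρ x)

/-- The vector field `ρ` is smooth on `Ω` and Euler there: `ρ f - f` belongs to the square of the
ideal of functions vanishing on `I`, for every `f` in that ideal. -/
structure IsEuler {m : ℕ} {M : Type*} [TopologicalSpace M]
    [ChartedSpace (EuclideanSpace ℝ (Fin m)) M] [IsManifold (𝓡 m) ∞ M]
    (I : Set M) (Ω : Opens M) (ρ : (x : M) → TangentSpace (𝓡 m) x) : Prop where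
  smooth : ContMDiffOn (𝓡 m) (𝓡 m).tangent ∞
    (fun x => (⟨x, ρ x⟩ : TangentBundle (𝓡 m) M)) Ω
  euler : ∀ f ∈ vanishingIdeal (m := m) I Ω,
    (fun x => lieDeriv ρ f x - f x) ∈ vanishingIdealSq (m := m) I Ω

/-- An Euler vector field for `I` defined on some open neighbourhood of the point `p`. -/
structure EulerFieldNear (m : ℕ) {M : Type*} [TopologicalSpace M]
    [ChartedSpace (EuclideanSpace ℝ (Fin m)) M] [IsManifold (𝓡 m) ∞ M]
    (I : Set M) (p : M) where
  domain : Opens M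
  mem_domain : p ∈ domain
  field : (x : M) → TangentSpace (𝓡 m) x
  isEuler : IsEuler I domain field

/-! ### Weakly homogeneous distributions -/

/-- `V` is `ρ`-convex, i.e. stable under the flow `exp (log λ • ρ)`, `λ ∈ (0, 1]`, and `S λ` is this
flow on `V`. -/
structure IsScalingFlow {m : ℕ} {M : Type*} [TopologicalSpace M]
    [ChartedSpace (EuclideanSpace ℝ (Fin m)) M] [IsManifold (𝓡 m) ∞ M]
    (ρ : (x : M) → TangentSpace (𝓡 m) x) (V : Opens M)
    (S : ℝ → PartialDiffeomorph (𝓡 m) (𝓡 m) M M ∞) : Prop where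
  source_eq : ∀ l ∈ Ioc (0 : ℝ) 1, (S l).source = V
  stable : ∀ l ∈ Ioc (0 : ℝ) 1, ∀ q ∈ V, S l q ∈ V
  flow : ∀ q ∈ V, ∃ γ : ℝ → M, γ 0 = q ∧ IsMIntegralCurveOn γ ρ (Iic 0) ∧
    ∀ l ∈ Ioc (0 : ℝ) 1, S l q = γ (Real.log l)

theorem IsScalingFlow.maps {m : ℕ} {M : Type*} [TopologicalSpace M]
    [ChartedSpace (EuclideanSpace ℝ (Fin m)) M] [IsManifold (𝓡 m) ∞ M]
    {ρ : (x : M) → TangentSpace (𝓡 m) x} {V : Opens M}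
    {S : ℝ → PartialDiffeomorph (𝓡 m) (𝓡 m) M M ∞} (hS : IsScalingFlow ρ V S)
    {l : ℝ} (hl : l ∈ Ioc (0 : ℝ) 1) : ∀ x ∈ V, x ∈ (S l).source ∧ S l x ∈ V :=
  fun x hx => ⟨by rw [hS.source_eq l hl]; exact hx, hS.stable l hl x hx⟩

/-- The space `E_s^ρ(V)`: `V` is `ρ`-convex and `λ^{-s} ⟨S(λ)^* t, φ⟩` is bounded in `λ ∈ (0, 1]`
for every test density `φ` on `V` supported in a chart. -/
def scaleSpace {m : ℕ} {M : Type*} [TopologicalSpace M]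
    [ChartedSpace (EuclideanSpace ℝ (Fin m)) M] [IsManifold (𝓡 m) ∞ M]
    (ρ : (x : M) → TangentSpace (𝓡 m) x) (s : ℝ) (V : Opens M) :
    Set (ManifoldDistribution m M V) :=
  {t | ∃ (S : ℝ → PartialDiffeomorph (𝓡 m) (𝓡 m) M M ∞) (hS : IsScalingFlow ρ V S),
    ∀ (κ : Chart m M) (φ : 𝓓(chartImage κ.1 V, ℝ)), ∃ C : ℝ,
      ∀ (l : ℝ) (hl : l ∈ Ioc (0 : ℝ) 1),
        ‖((l ^ (-s) : ℝ) : ℂ) * (t.pullback (S l) (hS.maps hl)).inChart κ φ‖ ≤ C}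

/-- `t ∈ 𝓓'(U)` belongs to `E_{s,p}^ρ`: there is a `ρ`-convex open set `V`, contained in `U` and in
the domain of `ρ`, whose closure is a neighbourhood of `p`, with `t|_V ∈ E_s^ρ(V)`. -/
def localScaleSpace {m : ℕ} {M : Type*} [TopologicalSpace M]
    [ChartedSpace (EuclideanSpace ℝ (Fin m)) M] [IsManifold (𝓡 m) ∞ M]
    {I : Set M} {p : M} (ρ : EulerFieldNear m I p) (s : ℝ) (U : Opens M) :
    Set (ManifoldDistribution m M U) :=
  {t | ∃ (V : Opens M) (hVU : V ≤ U), V ≤ ρ.domain ∧ closure (V : Set M) ∈ 𝓝 p ∧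
    t.restrict hVU ∈ scaleSpace ρ.field s V}

/-- The space `E_{s,I}(U)`: the distributions `t ∈ 𝓓'(U)` such that for every point `p` of
`I ∩ int (closure U)` one has `t ∈ E_{s,p}^ρ` for some Euler vector field `ρ` near `p`. -/
def weaklyHomogeneous {m : ℕ} {M : Type*} [TopologicalSpace M]
    [ChartedSpace (EuclideanSpace ℝ (Fin m)) M] [IsManifold (𝓡 m) ∞ M]
    (I : Set M) (s : ℝ) (U : Opens M) : Set (ManifoldDistribution m M U) :=
  {t | ∀ p ∈ I ∩ interior (closure (U : Set M)),
    ∃ ρ : EulerFieldNear m I p, t ∈ localScaleSpace ρ s U}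

end WeakHomogeneity
end

noncomputable section

namespace WeakHomogeneity

/-! ### Smoothness of superposition operators on spaces of continuous functions -/

section Superposition

universe u
variable {T : Type*} [TopologicalSpace T] [CompactSpace T]

/-! Everything is reduced to linear scalings. In coordinates adapted to I let P be the projection
onto the normal coordinates, and let S_l be the map `scaling P l`, which multiplies the normal part
by l. If dim I < m, an Euler field v vanishes on I, and there its derivative satisfies P Dv = P
(`IsEuler.coordField_eq_zero`).

Such a field is conjugate to the linear field P by a local diffeomorphism Ξ that fixes I pointwise
(`exists_linearization_of_contDiff`). Writing Ξ(S_l y) = S_l u_l(y) along rays turns the conjugacy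
equation into an initial value problem u' = X(l, u), u_0 = y, and the two conditions on v make X
smooth up to l = 0 (`exists_rescaled_field`). It is solved, smoothly in y, by the inverse function
theorem in the Banach space C([0,1], E), whose input is the smoothness of superposition operators u
↦ g ∘ u. A homogeneity of X identifies the time-one map with Ξ.

Independence (`localScaleSpace_subset`): two Euler fields have linearizing charts whose transition
map f fixes I and satisfies P Df = P along I. Hence S_l⁻¹ f S_l extends smoothly to l = 0, where it
is the identity. Testing the second scaled distribution against φ amounts to testing the first
against a family of densities that stays bounded, with supports in one compact set, as l → 0.
Boundedness against each fixed density implies boundedness along such a family by Banach–Steinhaus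
(`bounded_apply_of_pointwise_bounded`). Parameters l away from 0 are controlled by compactness.

Invariance (`pullback_mem_weaklyHomogeneous`): in positive codimension a linearizing chart on M' is
transported to M, and the linear field in the transported chart, which is Euler by Hadamard's lemma,
has a flow that Φ intertwines with the given one. In codimension zero I' is open and closed, every
smooth field is Euler, and the field itself can be pulled back. -/

/-- Pointwise application `(h, w) ↦ (t ↦ h t (w t))` as a continuous bilinear map. -/
def pointwiseApply (T : Type*) [TopologicalSpace T] [CompactSpace T] (G F : Type*)
    [NormedAddCommGroup G] [NormedSpace ℝ G] [NormedAddCommGroup F] [NormedSpace ℝ F] :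
    C(T, G →L[ℝ] F) →L[ℝ] C(T, G) →L[ℝ] C(T, F) :=
  LinearMap.mkContinuous₂
    (LinearMap.mk₂ ℝ (fun (h : C(T, G →L[ℝ] F)) (w : C(T, G)) =>
      (⟨fun t => h t (w t), h.continuous.clm_apply w.continuous⟩ : C(T, F)))
      (fun _ _ _ => by ext; simp) (fun _ _ _ => by ext; simp)
      (fun _ _ _ => by ext; simp) (fun _ _ _ => by ext; simp)) 1 (fun h w => by
        rw [one_mul]
        refine (ContinuousMap.norm_le _ (by positivity)).2 fun t => ?_
        exact ((h t).le_opNorm (w t)).trans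
          (mul_le_mul (h.norm_coe_le_norm t) (w.norm_coe_le_norm t) (norm_nonneg _)
            (norm_nonneg h)))

@[simp] theorem pointwiseApply_apply {G F : Type*}
    [NormedAddCommGroup G] [NormedSpace ℝ G] [NormedAddCommGroup F] [NormedSpace ℝ F]
    (h : C(T, G →L[ℝ] F)) (w : C(T, G)) (t : T) : pointwiseApply T G F h w t = h t (w t) := rfl

/-- The mean value inequality is applied at each t to g compared with its linearization. The
estimate is uniform in t because postcomposition with g' is continuous for the sup norm. -/
theorem hasFDerivAt_comp_left {G F : Type*}
    [NormedAddCommGroup G] [NormedSpace ℝ G] [NormedAddCommGroup F] [NormedSpace ℝ F]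
    (g : C(G, F)) (g' : C(G, G →L[ℝ] F)) (hg : ∀ x, HasFDerivAt g (g' x) x) (u : C(T, G)) :
    HasFDerivAt (fun u : C(T, G) => g.comp u) (pointwiseApply T G F (g'.comp u)) u := by
  rw [hasFDerivAt_iff_isLittleO_nhds_zero, Asymptotics.isLittleO_iff]
  intro ε hε
  have hc : ContinuousAt (fun v : C(T, G) => g'.comp v) u :=
    (ContinuousMap.continuous_postcomp g').continuousAt
  obtain ⟨δ, hδ, hδu⟩ := Metric.continuousAt_iff (α := C(T, G)) (β := C(T, G →L[ℝ] F)).1 hc ε hε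
  filter_upwards [Metric.ball_mem_nhds (0 : C(T, G)) hδ] with w hw
  rw [mem_ball_zero_iff] at hw
  refine (ContinuousMap.norm_le _ (by positivity)).2 fun t => ?_
  have key := (convex_ball (u t) δ).norm_image_sub_le_of_norm_hasFDerivWithin_le' (f := g)
    (f' := fun x => g' x) (φ := g' (u t)) (C := ε) (x := u t) (y := u t + w t)
    (fun x _ => (hg x).hasFDerivWithinAt) (fun x hx => ?_) (Metric.mem_ball_self hδ) ?_
  · refine le_trans (by simpa using key) ?_
    gcongr
    exact w.norm_coe_le_norm t
  -- A point x within δ of u t is the value at t of a continuous function within δ of u, namely u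
  -- shifted by a constant. So sup-norm continuity of v ↦ g' ∘ v bounds g' x - g' (u t).
  · have h1 : dist (u + ContinuousMap.const T (x - u t)) u < δ := by
      rw [dist_eq_norm, add_sub_cancel_left]
      refine (ContinuousMap.norm_lt_iff _ hδ).2 fun _ => ?_
      simpa [dist_eq_norm] using hx
    have h2 := (ContinuousMap.norm_coe_le_norm
      (g'.comp (u + ContinuousMap.const T (x - u t)) - g'.comp u) t).trans
      ((dist_eq_norm _ _).symm.le.trans (hδu h1).le)
    simpa using h2
  · simpa [dist_eq_norm] using (w.norm_coe_le_norm t).trans_lt hw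

theorem contDiff_pointwiseApply {G F : Type*} [NormedAddCommGroup G] [NormedSpace ℝ G]
    [NormedAddCommGroup F] [NormedSpace ℝ F] (n : WithTop ℕ∞) :
    ContDiff ℝ n (fun h : C(T, G →L[ℝ] F) => pointwiseApply T G F h) := by
  have := ContinuousLinearMap.contDiff (𝕜 := ℝ) (n := n) (E := C(T, G →L[ℝ] F))
    (F := C(T, G) →L[ℝ] C(T, F)) (pointwiseApply T G F)
  exact this

/-- The derivative is the superposition operator of g' followed by a bounded linear map, so each
induction step gains one order. F is quantified inside the induction because it gets replaced by `G
→L[ℝ] F`, which is also why G and F share a universe. -/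
theorem contDiff_comp_left_nat (n : ℕ) {G : Type u} [NormedAddCommGroup G] [NormedSpace ℝ G] :
    ∀ {F : Type u} [NormedAddCommGroup F] [NormedSpace ℝ F] (g : C(G, F)), ContDiff ℝ n g →
      ContDiff ℝ n (fun u : C(T, G) => g.comp u) := by
  induction n with
  | zero =>
    intro F _ _ g _
    exact contDiff_zero.2 (ContinuousMap.continuous_postcomp g)
  | succ n ih =>
    intro F _ _ g hg
    have hg' : ContDiff ℝ (n + 1) g := by exact_mod_cast hg
    obtain ⟨g', hg'n, hgd⟩ := contDiff_succ_iff_hasFDerivAt.1 hg'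
    have : ContDiff ℝ (n + 1) (fun u : C(T, G) => g.comp u) :=
      contDiff_succ_iff_hasFDerivAt.2
        ⟨fun u => pointwiseApply T G F ((⟨g', hg'n.continuous⟩ : C(G, G →L[ℝ] F)).comp u),
          (contDiff_pointwiseApply n).comp (ih ⟨g', hg'n.continuous⟩ hg'n),
          fun u => hasFDerivAt_comp_left g ⟨g', hg'n.continuous⟩ hgd u⟩
    exact_mod_cast this

/-- The superposition operator `u ↦ g ∘ u` of a smooth function `g` is smooth. -/
theorem contDiff_comp_left {G F : Type u} [NormedAddCommGroup G] [NormedSpace ℝ G]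
    [NormedAddCommGroup F] [NormedSpace ℝ F] (g : C(G, F)) (hg : ContDiff ℝ ∞ g) :
    ContDiff ℝ ∞ (fun u : C(T, G) => g.comp u) :=
  contDiff_infty.2 fun n => contDiff_comp_left_nat n g (contDiff_infty.1 hg n)

end Superposition

/-! ### Primitives and Hadamard's lemma -/

section Hadamard

variable {F : Type*} [NormedAddCommGroup F] [NormedSpace ℝ F]

/-- The primitive `t ↦ ∫ τ in 0..t, f τ` of a continuous function on the unit interval. -/
def primitive (F : Type*) [NormedAddCommGroup F] [NormedSpace ℝ F] :
    C(unitInterval, F) →L[ℝ] C(unitInterval, F) :=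
  LinearMap.mkContinuous
    { toFun := fun f => ⟨fun t => ∫ τ in (0 : ℝ)..t, f (projIcc 0 1 zero_le_one τ), by
        have hf : Continuous fun τ : ℝ => f (projIcc 0 1 zero_le_one τ) :=
          f.continuous.comp continuous_projIcc
        exact (intervalIntegral.continuous_primitive (fun a b => hf.intervalIntegrable a b) 0).comp
          continuous_subtype_val⟩
      map_add' := fun f g => by
        ext t
        have hf : ∀ f : C(unitInterval, F), Continuous fun τ : ℝ => f (projIcc 0 1 zero_le_one τ) :=
          fun f => f.continuous.comp continuous_projIcc
        exact intervalIntegral.integral_add ((hf f).intervalIntegrable _ _)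
          ((hf g).intervalIntegrable _ _)
      map_smul' := fun c f => by
        ext t
        exact intervalIntegral.integral_smul c _ } 1 (fun f => by
      rw [one_mul]
      refine (ContinuousMap.norm_le _ (norm_nonneg _)).2 fun t => ?_
      have := intervalIntegral.norm_integral_le_of_norm_le_const (a := 0) (b := (t : ℝ))
        (f := fun τ => f (projIcc 0 1 zero_le_one τ)) (C := ‖f‖)
        (fun τ _ => f.norm_coe_le_norm _)
      refine this.trans ?_
      rw [sub_zero, abs_of_nonneg t.2.1]
      exact mul_le_of_le_one_right (norm_nonneg _) t.2.2)

theorem primitive_apply (f : C(unitInterval, F)) (t : unitInterval) :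
    primitive F f t = ∫ τ in (0 : ℝ)..t, f (projIcc 0 1 zero_le_one τ) := rfl

universe u

/-- Hadamard's lemma: the quotient of `g (l, y) - g (0, y)` by `l` is smooth. -/
theorem exists_smooth_quotient {E F : Type u} [NormedAddCommGroup E] [NormedSpace ℝ E]
    [NormedAddCommGroup F] [NormedSpace ℝ F] [CompleteSpace F] (g : ℝ × E → F)
    (hg : ContDiff ℝ ∞ g) :
    ∃ q : ℝ × E → F, ContDiff ℝ ∞ q ∧ (∀ l y, g (l, y) - g (0, y) = l • q (l, y)) ∧
      ∀ y, q (0, y) = fderiv ℝ g (0, y) (1, 0) := by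
  have hdg : ContDiff ℝ ∞ (fun z => fderiv ℝ g z (1, 0)) :=
    (hg.fderiv_right (m := ∞) le_rfl).clm_apply contDiff_const
  let d : C(ℝ × E, F) := ⟨fun z => fderiv ℝ g z (1, 0), hdg.continuous⟩
  let line : (ℝ × E) →L[ℝ] C(unitInterval, ℝ × E) := LinearMap.mkContinuous
    { toFun := fun z => ⟨fun θ => ((θ : ℝ) * z.1, z.2), by fun_prop⟩
      map_add' := fun z w => by ext θ <;> simp [mul_add]
      map_smul' := fun c z => by ext θ <;> simp [mul_left_comm] } 1 (fun z => by
        rw [one_mul]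
        refine (ContinuousMap.norm_le _ (norm_nonneg _)).2 fun θ => ?_
        refine max_le ((norm_mul_le _ _).trans ?_) (norm_snd_le z)
        rw [Real.norm_of_nonneg θ.2.1]
        exact (mul_le_of_le_one_left (norm_nonneg _) θ.2.2).trans (norm_fst_le z))
  have hline : ∀ (z : ℝ × E) (τ : ℝ), τ ∈ Icc (0 : ℝ) 1 →
      (d.comp (line z)) (projIcc 0 1 zero_le_one τ) = fderiv ℝ g (τ * z.1, z.2) (1, 0) := by
    intro z τ hτ
    rw [projIcc_of_mem zero_le_one hτ]; rfl
  have hq : ∀ z : ℝ × E, primitive F (d.comp (line z)) 1 =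
      ∫ τ in (0 : ℝ)..1, fderiv ℝ g (τ * z.1, z.2) (1, 0) := by
    intro z
    rw [primitive_apply]
    refine intervalIntegral.integral_congr fun τ hτ => ?_
    exact hline z τ (by simpa using hτ)
  refine ⟨fun z => primitive F (d.comp (line z)) 1, ?_, fun l y => ?_, fun y => ?_⟩
  · exact ((ContinuousMap.evalCLM ℝ (1 : unitInterval)).comp (primitive F)).contDiff.comp
      ((contDiff_comp_left d hdg).comp line.contDiff)
  · simp only [hq]
    have hd : ∀ τ : ℝ, HasDerivAt (fun τ : ℝ => g (τ * l, y))
        (l • fderiv ℝ g (τ * l, y) (1, 0)) τ := by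
      intro τ
      have h1 : HasDerivAt (fun τ : ℝ => (τ * l, y)) (l, 0) τ := by
        simpa using ((hasDerivAt_id τ).mul_const l).prodMk (hasDerivAt_const τ y)
      have h2 := ((hg.differentiable (by simp)) (τ * l, y)).hasFDerivAt.comp_hasDerivAt τ h1
      have h3 : ((l, 0) : ℝ × E) = l • ((1, 0) : ℝ × E) := by simp
      rw [h3, map_smul] at h2
      exact h2
    have hcont : Continuous fun τ : ℝ => l • fderiv ℝ g (τ * l, y) (1, 0) := by
      have := hdg.continuous.comp
        (f := fun τ : ℝ => (τ * l, y)) (by fun_prop)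
      exact this.const_smul l
    have := intervalIntegral.integral_eq_sub_of_hasDerivAt (a := 0) (b := 1) (fun τ _ => hd τ)
      (hcont.intervalIntegrable _ _)
    rw [intervalIntegral.integral_smul] at this
    rw [this]; simp
  · simp [hq]

end Hadamard

/-! ### Scaling along a projection -/

section Scaling

universe u
variable {E : Type u} [NormedAddCommGroup E] [NormedSpace ℝ E]

/-- The map `x + h ↦ x + l h`, where `h = P y` is the component of `y` along the projection `P`. -/
def scaling (P : E →L[ℝ] E) (l : ℝ) : E →L[ℝ] E := ContinuousLinearMap.id ℝ E - P + l • P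

theorem scaling_apply (P : E →L[ℝ] E) (l : ℝ) (y : E) : scaling P l y = y - P y + l • P y := rfl

@[simp] theorem scaling_one (P : E →L[ℝ] E) (y : E) : scaling P 1 y = y := by
  simp [scaling_apply]

theorem scaling_of_apply_eq_zero {P : E →L[ℝ] E} {y : E} (hy : P y = 0) (l : ℝ) :
    scaling P l y = y := by simp [scaling_apply, hy]

theorem contDiff_scaling (P : E →L[ℝ] E) {n : WithTop ℕ∞} :
    ContDiff ℝ n (fun z : ℝ × E => scaling P z.1 z.2) := by
  simp only [scaling_apply]
  exact (contDiff_snd.sub (P.contDiff.comp contDiff_snd)).add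
    (contDiff_fst.smul (P.contDiff.comp contDiff_snd))

variable {P : E →L[ℝ] E} (hP : ∀ y, P (P y) = P y)
include hP

theorem apply_scaling (l : ℝ) (y : E) : P (scaling P l y) = l • P y := by
  simp [scaling_apply, hP]

theorem scaling_scaling (l k : ℝ) (y : E) : scaling P l (scaling P k y) = scaling P (l * k) y := by
  rw [scaling_apply P l, apply_scaling hP, scaling_apply, scaling_apply, smul_smul]
  abel

theorem scaling_inv_scaling {l : ℝ} (hl : l ≠ 0) (y : E) :
    scaling P l⁻¹ (scaling P l y) = y := by
  rw [scaling_scaling hP, inv_mul_cancel₀ hl, scaling_one]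

theorem scaling_scaling_inv {l : ℝ} (hl : l ≠ 0) (y : E) :
    scaling P l (scaling P l⁻¹ y) = y := by
  rw [scaling_scaling hP, mul_inv_cancel₀ hl, scaling_one]

theorem scaling_injective {l : ℝ} (hl : l ≠ 0) : Function.Injective (scaling P l) :=
  Function.LeftInverse.injective (scaling_inv_scaling hP hl)

omit hP

theorem scaling_mem_ball {y₀ : E} (hy₀ : P y₀ = 0)
    (hS : ∀ l ∈ Icc (0 : ℝ) 1, ∀ y, ‖scaling P l y‖ ≤ ‖y‖) {r l : ℝ} (hl : l ∈ Icc (0 : ℝ) 1)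
    {y : E} (hy : y ∈ Metric.ball y₀ r) : scaling P l y ∈ Metric.ball y₀ r := by
  rw [mem_ball_iff_norm] at hy ⊢
  rw [← scaling_of_apply_eq_zero hy₀ l, ← map_sub]
  exact (hS l hl _).trans_lt hy

/-- The vector field `v`, rescaled by `scaling P l` and compared with the linear field `P`,
extends smoothly to `l = 0`. -/
theorem exists_rescaled_field [CompleteSpace E] {v : E → E} (hv : ContDiff ℝ ∞ v) {y₀ : E} {r : ℝ}
    (hP : ∀ y, P (P y) = P y) (hy₀ : P y₀ = 0)
    (hS : ∀ l ∈ Icc (0 : ℝ) 1, ∀ y, ‖scaling P l y‖ ≤ ‖y‖)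
    (hv0 : ∀ y ∈ Metric.ball y₀ r, P y = 0 → v y = 0)
    (hv1 : ∀ y ∈ Metric.ball y₀ r, P y = 0 → ∀ w, P (fderiv ℝ v y w) = P w) :
    ∃ X : ℝ × E → E, ContDiff ℝ ∞ X ∧ ∀ l, ∀ y ∈ Metric.ball y₀ r,
      l • (scaling P l (X (l, y)) + P y) = v (scaling P l y) := by
  have hsm : ContDiff ℝ ∞ (fun z : ℝ × E => scaling P z.1 z.2) := contDiff_scaling P
  obtain ⟨q, hq, hq1, hq0⟩ := exists_smooth_quotient (fun z : ℝ × E => v (scaling P z.1 z.2))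
    (hv.comp hsm)
  obtain ⟨k, hk, hk1, -⟩ := exists_smooth_quotient (fun z : ℝ × E => P (q z) - P z.2)
    ((P.contDiff.comp hq).sub (P.contDiff.comp contDiff_snd))
  have h0 : ∀ y ∈ Metric.ball y₀ r, scaling P 0 y ∈ Metric.ball y₀ r ∧ P (scaling P 0 y) = 0 :=
    fun y hy => ⟨scaling_mem_ball hy₀ hS ⟨le_rfl, zero_le_one⟩ hy, by simp [apply_scaling hP]⟩
  -- The quotient q at l = 0 is Dv(S_0 y)(P y), and P Dv = P on the kernel. Hence P q - P vanishes
  -- at l = 0 and can be divided by l a second time.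
  have hq0' : ∀ y ∈ Metric.ball y₀ r, P (q (0, y)) = P y := by
    intro y hy
    have hd : HasFDerivAt (fun z : ℝ × E => v (scaling P z.1 z.2))
        ((fderiv ℝ v (scaling P 0 y)).comp
          (fderiv ℝ (fun z : ℝ × E => scaling P z.1 z.2) (0, y))) (0, y) :=
      ((hv.differentiable (by simp)) (scaling P 0 y)).hasFDerivAt.comp ((0 : ℝ), y)
        ((hsm.differentiable (by simp)) (0, y)).hasFDerivAt
    have hd2 : HasDerivAt (fun l : ℝ => scaling P l y) (P y) 0 := by
      simp only [scaling_apply]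
      simpa using ((hasDerivAt_id (0 : ℝ)).smul_const (P y)).const_add (y - P y)
    have hd3 := ((hsm.differentiable (by simp)) ((0 : ℝ), y)).hasFDerivAt.comp_hasDerivAt (0 : ℝ)
      ((hasDerivAt_id (0 : ℝ)).prodMk (hasDerivAt_const 0 y))
    have hd4 : fderiv ℝ (fun z : ℝ × E => scaling P z.1 z.2) (0, y) (1, 0) = P y :=
      hd3.unique hd2
    rw [hq0, hd.fderiv, ContinuousLinearMap.comp_apply, hd4, hv1 _ (h0 y hy).1 (h0 y hy).2, hP]
  -- The tangential part of v ∘ S_l is divided by l once; its normal part, after subtraction of the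
  -- linear field, is divided by l twice.
  refine ⟨fun z => q z - P (q z) + P (k z),
    (hq.sub (P.contDiff.comp hq)).add (P.contDiff.comp hk), fun l y hy => ?_⟩
  have e1 : v (scaling P l y) = l • q (l, y) := by
    have := hq1 l y
    simp only [hv0 _ (h0 y hy).1 (h0 y hy).2, sub_zero] at this
    exact this
  have e2 : l • k (l, y) = P (q (l, y)) - P y := by
    have := hk1 l y
    simp only [hq0' y hy, sub_self, sub_zero] at this
    exact this.symm
  have e3 : l • P (k (l, y)) = P (q (l, y)) - P y := by
    rw [← map_smul, e2, map_sub, hP, hP]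
  rw [e1]
  congr 1
  rw [scaling_apply]
  simp only [map_add, map_sub, hP, sub_self, zero_add]
  rw [e3]
  abel

end Scaling

/-! ### A smooth inverse function theorem -/

/-- The inverse function theorem on an open set: the local inverse is smooth on an open set. -/
theorem exists_openPartialHomeomorph_contDiffOn {E F : Type*} [NormedAddCommGroup E]
    [NormedSpace ℝ E] [CompleteSpace E] [NormedAddCommGroup F] [NormedSpace ℝ F]
    {f : E → F} {O : Set E} (hO : IsOpen O) (hf : ContDiffOn ℝ ∞ f O) {a : E} (ha : a ∈ O)
    (f' : E ≃L[ℝ] F) (hf' : HasFDerivAt f (f' : E →L[ℝ] F) a) :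
    ∃ e : OpenPartialHomeomorph E F, a ∈ e.source ∧ e.source ⊆ O ∧ ⇑e = f ∧
      ContDiffOn ℝ ∞ e.symm e.target := by
  have hat : ContDiffAt ℝ ∞ f a := hf.contDiffAt (hO.mem_nhds ha)
  let e₀ := hat.toOpenPartialHomeomorph f hf' (by simp)
  have hc : ContinuousOn (fderiv ℝ f) O := hf.continuousOn_fderiv_of_isOpen hO (by simp)
  have hopen : IsOpen (O ∩ fderiv ℝ f ⁻¹' range ((↑) : (E ≃L[ℝ] F) → E →L[ℝ] F)) :=
    hc.isOpen_inter_preimage hO ContinuousLinearEquiv.isOpen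
  refine ⟨e₀.restrOpen _ hopen, ?_, ?_, ?_, ?_⟩
  · refine ⟨hat.mem_toOpenPartialHomeomorph_source hf' (by simp), ha, f', hf'.fderiv.symm⟩
  · exact fun x hx => hx.2.1
  · rfl
  · intro z hz
    have hz' := (e₀.restrOpen _ hopen).map_target hz
    obtain ⟨A, hA⟩ := hz'.2.2
    have hd : HasFDerivAt (e₀.restrOpen _ hopen) (A : E →L[ℝ] F)
        ((e₀.restrOpen _ hopen).symm z) := by
      rw [hA]
      exact ((hf.contDiffAt (hO.mem_nhds hz'.2.1)).differentiableAt (by simp)).hasFDerivAt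
    exact ((e₀.restrOpen _ hopen).contDiffAt_symm hz hd
      (hf.contDiffAt (hO.mem_nhds hz'.2.1))).contDiffWithinAt

/-! ### Identities for the rescaled vector field. -/

section RescaledField

universe u
variable {E : Type u} [NormedAddCommGroup E] [NormedSpace ℝ E]
  {P : E →L[ℝ] E} {v : E → E} {y₀ : E} {r : ℝ} {X : ℝ × E → E}

/-- The identities below come from cancelling a factor l, hence hold first for l > 0; density of (0,
1] in [0, 1] carries them to l = 0. -/
theorem eq_at_zero_of_eqOn_Ioc {F : Type*} [TopologicalSpace F] [T2Space F] {f g : ℝ → F}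
    (hf : Continuous f) (hg : Continuous g) (h : ∀ l ∈ Ioc (0 : ℝ) 1, f l = g l) : f 0 = g 0 := by
  have hcl : (0 : ℝ) ∈ closure (Ioc (0 : ℝ) 1) := by
    rw [closure_Ioc zero_ne_one]; exact ⟨le_rfl, zero_le_one⟩
  exact (show EqOn f g (Ioc 0 1) from h).closure hf hg hcl

/-- On the kernel of P both v and P vanish, so the defining relation `key` reads l S_l X = 0, and
S_l is injective for l > 0. -/
theorem rescaled_field_eq_zero (hP : ∀ y, P (P y) = P y) (hX : Continuous X)
    (hv0 : ∀ y ∈ Metric.ball y₀ r, P y = 0 → v y = 0)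
    (key : ∀ l, ∀ y ∈ Metric.ball y₀ r,
      l • (scaling P l (X (l, y)) + P y) = v (scaling P l y))
    {l : ℝ} (hl : l ∈ Icc (0 : ℝ) 1) {y : E} (hy : y ∈ Metric.ball y₀ r) (hPy : P y = 0) :
    X (l, y) = 0 := by
  have h1 : ∀ l ∈ Ioc (0 : ℝ) 1, X (l, y) = 0 := by
    intro l hl
    have := key l y hy
    rw [scaling_of_apply_eq_zero hPy, hv0 y hy hPy, hPy, add_zero] at this
    have h2 := (smul_eq_zero.1 this).resolve_left hl.1.ne'
    exact scaling_injective hP hl.1.ne' (by rw [h2, map_zero])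
  rcases hl.1.eq_or_lt with h | h
  · subst h
    exact eq_at_zero_of_eqOn_Ioc (f := fun l => X (l, y)) (by fun_prop) continuous_const h1
  · exact h1 l ⟨h, hl.2⟩

/-- Evaluate `key` at S_k y with parameter l and at y with parameter l k: the right-hand sides
agree, and l and S_l cancel. This homogeneity links the solution of u' = X(l, u) started at S_k y
with the one started at y. -/
theorem rescaled_field_scaling (hP : ∀ y, P (P y) = P y) (hX : Continuous X) (hy₀ : P y₀ = 0)
    (hS : ∀ l ∈ Icc (0 : ℝ) 1, ∀ y, ‖scaling P l y‖ ≤ ‖y‖)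
    (hv0 : ∀ y ∈ Metric.ball y₀ r, P y = 0 → v y = 0)
    (key : ∀ l, ∀ y ∈ Metric.ball y₀ r,
      l • (scaling P l (X (l, y)) + P y) = v (scaling P l y))
    {l k : ℝ} (hl : l ∈ Icc (0 : ℝ) 1) (hk : k ∈ Icc (0 : ℝ) 1) {y : E}
    (hy : y ∈ Metric.ball y₀ r) :
    X (l, scaling P k y) = k • scaling P k (X (k * l, y)) := by
  have hy' := scaling_mem_ball hy₀ hS hk hy
  rcases hk.1.eq_or_lt with h | hk0
  · subst h
    rw [zero_smul]
    exact rescaled_field_eq_zero hP hX hv0 key hl hy' (by simp [apply_scaling hP])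
  have h1 : ∀ l ∈ Ioc (0 : ℝ) 1, X (l, scaling P k y) = k • scaling P k (X (k * l, y)) := by
    intro l hl
    have e1 := key l _ hy'
    have e2 := key (l * k) y hy
    rw [scaling_scaling hP, ← e2, mul_smul] at e1
    have e3 := smul_right_injective E hl.1.ne' e1
    apply scaling_injective hP hl.1.ne'
    rw [map_smul, scaling_scaling hP, mul_comm k l]
    rw [apply_scaling hP, smul_add] at e3
    exact add_right_cancel e3
  rcases hl.1.eq_or_lt with h | h
  · subst h
    exact eq_at_zero_of_eqOn_Ioc (f := fun l => X (l, scaling P k y))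
      (g := fun l => k • scaling P k (X (k * l, y))) (by fun_prop) (by fun_prop) h1
  · exact h1 l ⟨h, hl.2⟩

/-- Differentiate `key` at y₀. As Dv kills the kernel of P, one has Dv(S_l w) = l Dv(P w), and l
cancels. The remaining vector Dv(P w) - P w lies in the kernel, where S_l is the identity, so the
answer does not depend on l. -/
theorem rescaled_field_fderiv (hP : ∀ y, P (P y) = P y) (hX : ContDiff ℝ ∞ X) (hy₀ : P y₀ = 0)
    (hr : 0 < r) (hv : ContDiff ℝ ∞ v)
    (hv0 : ∀ y ∈ Metric.ball y₀ r, P y = 0 → v y = 0)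
    (hv1 : ∀ y ∈ Metric.ball y₀ r, P y = 0 → ∀ w, P (fderiv ℝ v y w) = P w)
    (key : ∀ l, ∀ y ∈ Metric.ball y₀ r,
      l • (scaling P l (X (l, y)) + P y) = v (scaling P l y))
    {l : ℝ} (hl : l ∈ Icc (0 : ℝ) 1) (w : E) :
    fderiv ℝ X (l, y₀) (0, w) = fderiv ℝ v y₀ (P w) - P w := by
  have hy₀r := Metric.mem_ball_self (x := y₀) hr
  -- v vanishes along the line y₀ + t w, which stays in the kernel of P.
  have hA0 : ∀ w, P w = 0 → fderiv ℝ v y₀ w = 0 := by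
    intro w hw
    have h1 : HasDerivAt (fun t : ℝ => v (y₀ + t • w)) (fderiv ℝ v y₀ w) 0 := by
      have h2 : HasDerivAt (fun t : ℝ => y₀ + t • w) w 0 := by
        simpa using ((hasDerivAt_id (0 : ℝ)).smul_const w).const_add y₀
      have h3 : HasFDerivAt v (fderiv ℝ v y₀) (y₀ + (0 : ℝ) • w) := by
        rw [zero_smul, add_zero]; exact ((hv.differentiable (by simp)) y₀).hasFDerivAt
      exact h3.comp_hasDerivAt (0 : ℝ) h2
    refine h1.unique ((hasDerivAt_const (0 : ℝ) (0 : E)).congr_of_eventuallyEq ?_)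
    have hc : ContinuousAt (fun t : ℝ => y₀ + t • w) 0 := by fun_prop
    have : ∀ᶠ t : ℝ in 𝓝 0, y₀ + t • w ∈ Metric.ball y₀ r :=
      hc.eventually_mem (by simpa using Metric.ball_mem_nhds y₀ hr)
    filter_upwards [this] with t ht
    exact hv0 _ ht (by simp [hy₀, hw])
  have h1 : ∀ l ∈ Ioc (0 : ℝ) 1, fderiv ℝ X (l, y₀) (0, w) = fderiv ℝ v y₀ (P w) - P w := by
    intro l hl
    have hX1 : HasFDerivAt (fun y => X (l, y))
        ((fderiv ℝ X (l, y₀)).comp (ContinuousLinearMap.inr ℝ ℝ E)) y₀ :=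
      HasFDerivAt.comp y₀ ((hX.differentiable (by simp)) (l, y₀)).hasFDerivAt
        (hasFDerivAt_prodMk_right l y₀)
    have hL : HasFDerivAt (fun y => l • (scaling P l (X (l, y)) + P y))
        (l • ((scaling P l).comp ((fderiv ℝ X (l, y₀)).comp (ContinuousLinearMap.inr ℝ ℝ E)) + P))
        y₀ := (((scaling P l).hasFDerivAt.comp y₀ hX1).add P.hasFDerivAt).const_smul l
    have hR : HasFDerivAt (fun y => v (scaling P l y)) ((fderiv ℝ v y₀).comp (scaling P l)) y₀ := by
      have h3 : HasFDerivAt v (fderiv ℝ v y₀) (scaling P l y₀) := by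
        rw [scaling_of_apply_eq_zero hy₀]; exact ((hv.differentiable (by simp)) y₀).hasFDerivAt
      exact h3.comp y₀ (scaling P l).hasFDerivAt
    have heq := hL.unique (hR.congr_of_eventuallyEq
      (by filter_upwards [Metric.ball_mem_nhds y₀ hr] with y hy using key l y hy))
    have hw := congrArg (fun A : E →L[ℝ] E => A w) heq
    simp only [smul_apply, add_apply,
      ContinuousLinearMap.comp_apply, ContinuousLinearMap.inr_apply] at hw
    rw [scaling_apply P l w, map_add, hA0 (w - P w) (by simp [hP]), zero_add, map_smul] at hw
    have hw2 := eq_sub_of_add_eq (smul_right_injective E hl.1.ne' hw)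
    apply scaling_injective hP hl.1.ne'
    rw [hw2, scaling_of_apply_eq_zero]
    rw [map_sub, hv1 _ hy₀r hy₀, hP, sub_self]
  rcases hl.1.eq_or_lt with h | h
  · subst h
    have hc : Continuous fun l : ℝ => fderiv ℝ X (l, y₀) (0, w) :=
      ((hX.continuous_fderiv (by simp)).comp (by fun_prop : Continuous fun l : ℝ => (l, y₀))).clm_apply
        continuous_const
    exact eq_at_zero_of_eqOn_Ioc hc continuous_const h1
  · exact h1 l ⟨h, hl.2⟩

end RescaledField

/-! ### The initial value problem as an equation in C([0,1], E). -/

section SolutionOperator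

universe u
variable {E : Type u} [NormedAddCommGroup E] [NormedSpace ℝ E]

theorem primitive_comp_left [CompleteSpace E] (N : E →L[ℝ] E) (f : C(unitInterval, E)) (t : unitInterval) :
    N (primitive E f t) = primitive E (N.compLeftContinuous ℝ unitInterval f) t := by
  rw [primitive_apply, primitive_apply]
  exact (N.intervalIntegral_comp_comm ((f.continuous.comp continuous_projIcc).intervalIntegrable
    _ _)).symm

/-- The graph `t ↦ (t, u t)` of a function on the unit interval. -/
def timeGraph (u : C(unitInterval, E)) : C(unitInterval, ℝ × E) :=
  ⟨fun t => ((t : ℝ), u t), by fun_prop⟩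

omit [NormedSpace ℝ E] in
@[simp] theorem timeGraph_apply (u : C(unitInterval, E)) (t : unitInterval) :
    timeGraph u t = ((t : ℝ), u t) := rfl

theorem timeGraph_eq (u : C(unitInterval, E)) : timeGraph u = timeGraph 0 +
    (ContinuousLinearMap.inr ℝ ℝ E).compLeftContinuous ℝ unitInterval u := by
  ext t <;> simp

/-- The defect `u - ∫ X (τ, u τ)` of the initial value problem `u' = X (t, u)`. -/
def odeDefect (X : C(ℝ × E, E)) (u : C(unitInterval, E)) : C(unitInterval, E) :=
  u - primitive E (X.comp (timeGraph u))

theorem contDiff_timeGraph : ContDiff ℝ ∞ (timeGraph (E := E)) := by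
  have h : timeGraph (E := E) = fun u => timeGraph 0 +
    (ContinuousLinearMap.inr ℝ ℝ E).compLeftContinuous ℝ unitInterval u := funext timeGraph_eq
  rw [h]
  exact contDiff_const.add (ContinuousLinearMap.contDiff _)

theorem contDiff_odeDefect (X : C(ℝ × E, E)) (hX : ContDiff ℝ ∞ X) :
    ContDiff ℝ ∞ (odeDefect X) :=
  contDiff_id.sub ((primitive E).contDiff.comp
    ((contDiff_comp_left X hX).comp contDiff_timeGraph))

/-- Chain rule at the constant function: the spatial derivative of X at y₀ is the same N at every
time, so the linearization is the identity minus a Volterra operator with constant coefficient. -/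
theorem hasFDerivAt_odeDefect (X : C(ℝ × E, E)) (hX : ContDiff ℝ ∞ X) {y₀ : E} {N : E →L[ℝ] E}
    (hN : ∀ l ∈ Icc (0 : ℝ) 1, ∀ w, fderiv ℝ X (l, y₀) (0, w) = N w) :
    HasFDerivAt (odeDefect X) (ContinuousLinearMap.id ℝ C(unitInterval, E) -
      (primitive E).comp (N.compLeftContinuous ℝ unitInterval))
      (ContinuousMap.const unitInterval y₀) := by
  have h0 : HasFDerivAt (timeGraph (E := E))
      ((ContinuousLinearMap.inr ℝ ℝ E).compLeftContinuous ℝ unitInterval)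
      (ContinuousMap.const unitInterval y₀) := by
    have h : timeGraph (E := E) = fun u => timeGraph 0 +
      (ContinuousLinearMap.inr ℝ ℝ E).compLeftContinuous ℝ unitInterval u := funext timeGraph_eq
    rw [h]
    exact (ContinuousLinearMap.hasFDerivAt _).const_add _
  have h1 := hasFDerivAt_comp_left (T := unitInterval) X
    ⟨fderiv ℝ X, hX.continuous_fderiv (by simp)⟩
    (fun z => ((hX.differentiable (by simp)) z).hasFDerivAt)
    (timeGraph (ContinuousMap.const unitInterval y₀))
  have h2 := (hasFDerivAt_id (𝕜 := ℝ) (ContinuousMap.const unitInterval y₀)).sub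
    ((primitive E).hasFDerivAt.comp _ (h1.comp _ h0))
  refine h2.congr_fderiv (ContinuousLinearMap.ext fun w => ?_)
  change w - primitive E _ = w - primitive E _
  congr 2
  ext s
  exact hN s s.2 (w s)

/-- Smooth dependence of the solutions of `u' = X (t, u)`, `u 0 = y` on `y` near a constant
solution, together with local uniqueness. -/
theorem exists_solution_operator [CompleteSpace E] (X : C(ℝ × E, E)) (hX : ContDiff ℝ ∞ X) {y₀ : E}
    (hX0 : ∀ l ∈ Icc (0 : ℝ) 1, X (l, y₀) = 0) {N : E →L[ℝ] E} (hNN : ∀ w, N (N w) = 0)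
    (hN : ∀ l ∈ Icc (0 : ℝ) 1, ∀ w, fderiv ℝ X (l, y₀) (0, w) = N w) {ρ : ℝ} (hρ : 0 < ρ) :
    ∃ (O : Set E) (U : E → C(unitInterval, E)), IsOpen O ∧ y₀ ∈ O ∧ ContDiffOn ℝ ∞ U O ∧
      (∀ y ∈ O, odeDefect X (U y) = ContinuousMap.const unitInterval y) ∧
      (∀ y ∈ O, ∀ t, U y t ∈ Metric.ball y₀ ρ) ∧
      ∀ y ∈ O, ∀ w : C(unitInterval, E),
        ‖w - ContinuousMap.const unitInterval y₀‖ ≤ ‖U y - ContinuousMap.const unitInterval y₀‖ →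
        ∀ z ∈ O, odeDefect X w = ContinuousMap.const unitInterval z → w = U z := by
  set c₀ := ContinuousMap.const unitInterval y₀ with hc₀
  -- N commutes with taking primitives and N² = 0, so L² = 0 and 1 - L has the explicit inverse 1 +
  -- L.
  let L := (primitive E).comp (N.compLeftContinuous ℝ unitInterval)
  have hLL : ∀ w, L (L w) = 0 := by
    intro w
    have : N.compLeftContinuous ℝ unitInterval (L w) = 0 := by
      ext t
      change N (primitive E (N.compLeftContinuous ℝ unitInterval w) t) = 0
      rw [primitive_comp_left]
      have : N.compLeftContinuous ℝ unitInterval (N.compLeftContinuous ℝ unitInterval w) = 0 := by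
        ext s; exact hNN (w s)
      rw [this, map_zero]; rfl
    change primitive E (N.compLeftContinuous ℝ unitInterval (L w)) = 0
    rw [this, map_zero]
  let A : C(unitInterval, E) ≃L[ℝ] C(unitInterval, E) :=
    ContinuousLinearEquiv.equivOfInverse (ContinuousLinearMap.id ℝ _ - L)
      (ContinuousLinearMap.id ℝ _ + L) (fun w => by simp [hLL]) (fun w => by simp [hLL])
  have hA : HasFDerivAt (odeDefect X) (A : C(unitInterval, E) →L[ℝ] C(unitInterval, E)) c₀ :=
    hasFDerivAt_odeDefect X hX hN
  obtain ⟨e, he0, -, heX, hes⟩ := exists_openPartialHomeomorph_contDiffOn isOpen_univ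
    (contDiff_odeDefect X hX).contDiffOn (mem_univ c₀) A hA
  have hG0 : odeDefect X c₀ = c₀ := by
    have : X.comp (timeGraph c₀) = 0 := by ext t; exact hX0 t t.2
    rw [odeDefect, this, map_zero, sub_zero]
  obtain ⟨δ, hδ, hδe⟩ := Metric.isOpen_iff.1 e.open_source c₀ he0
  have hcsm : ContDiff ℝ ∞ (fun y : E => ContinuousMap.const unitInterval y) :=
    (ContinuousLinearMap.const ℝ unitInterval : E →L[ℝ] C(unitInterval, E)).contDiff
  -- The radius δ keeps the solutions inside the domain where `e` is injective, which gives
  -- uniqueness; ρ confines their values.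
  have hO1 : IsOpen ((fun y : E => ContinuousMap.const unitInterval y) ⁻¹'
      (e.target ∩ e.symm ⁻¹' Metric.ball c₀ (min δ ρ))) :=
    (e.symm.isOpen_inter_preimage Metric.isOpen_ball).preimage hcsm.continuous
  have hc₀t : c₀ ∈ e.target := by
    have := e.map_source he0
    rwa [heX, hG0] at this
  have hsymm : e.symm c₀ = c₀ := by
    have := e.left_inv he0
    rwa [heX, hG0] at this
  refine ⟨_, fun y => e.symm (ContinuousMap.const unitInterval y), hO1, ⟨hc₀t, ?_⟩, ?_, ?_, ?_, ?_⟩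
  · change e.symm c₀ ∈ Metric.ball c₀ (min δ ρ)
    rw [hsymm]
    exact Metric.mem_ball_self (lt_min hδ hρ)
  · exact hes.comp hcsm.contDiffOn fun y hy => hy.1
  · intro y hy
    rw [← heX, e.right_inv hy.1]
  · intro y hy t
    have h1 : ‖e.symm (ContinuousMap.const unitInterval y) - c₀‖ < min δ ρ := mem_ball_iff_norm.1 hy.2
    rw [mem_ball_iff_norm]
    exact (ContinuousMap.norm_coe_le_norm
      (e.symm (ContinuousMap.const unitInterval y) - c₀) t).trans_lt
      (h1.trans_le (min_le_right _ _))
  · intro y hy w hw z hz hwz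
    have h1 : ‖e.symm (ContinuousMap.const unitInterval y) - c₀‖ < min δ ρ := mem_ball_iff_norm.1 hy.2
    have hws : w ∈ e.source := hδe (mem_ball_iff_norm.2 (hw.trans_lt (h1.trans_le (min_le_left _ _))))
    change w = e.symm (ContinuousMap.const unitInterval z)
    rw [← hwz, ← heX, e.left_inv hws]

end SolutionOperator

/-! ### Linearization of a vector field that is Euler for a linear subspace. -/

section Linearization

universe u
variable {E : Type u} [NormedAddCommGroup E] [NormedSpace ℝ E]

theorem solution_zero {X : C(ℝ × E, E)} {u : C(unitInterval, E)} {y : E}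
    (hu : odeDefect X u = ContinuousMap.const unitInterval y) : u 0 = y := by
  have := congrArg (fun f : C(unitInterval, E) => f 0) hu
  simpa [odeDefect, primitive_apply] using this

theorem solution_eq {X : C(ℝ × E, E)} {u : C(unitInterval, E)} {y : E}
    (hu : odeDefect X u = ContinuousMap.const unitInterval y) (t : unitInterval) :
    u t = y + ∫ τ in (0 : ℝ)..t, X (projIcc 0 1 zero_le_one τ, u (projIcc 0 1 zero_le_one τ)) := by
  have := congrArg (fun f : C(unitInterval, E) => f t) hu
  exact sub_eq_iff_eq_add.1 this

theorem solution_hasDerivWithinAt [CompleteSpace E] {X : C(ℝ × E, E)} {u : C(unitInterval, E)} {y : E}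
    (hu : odeDefect X u = ContinuousMap.const unitInterval y) {t : ℝ} (ht : t ∈ Icc (0 : ℝ) 1) :
    HasDerivWithinAt (fun s => u (projIcc 0 1 zero_le_one s)) (X (t, u ⟨t, ht⟩)) (Icc 0 1) t := by
  have hc : Continuous fun τ : ℝ =>
      X (projIcc 0 1 zero_le_one τ, u (projIcc 0 1 zero_le_one τ)) := by
    have := continuous_projIcc (a := (0 : ℝ)) (b := 1) (h := zero_le_one)
    fun_prop
  have h1 := (intervalIntegral.integral_hasDerivAt_right (hc.intervalIntegrable 0 t)
    (hc.stronglyMeasurableAtFilter _ _) hc.continuousAt).const_add y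
  rw [projIcc_of_mem zero_le_one ht] at h1
  refine h1.hasDerivWithinAt.congr (fun s hs => ?_) ?_
  · rw [projIcc_of_mem zero_le_one hs, solution_eq hu ⟨s, hs⟩]
  · rw [projIcc_of_mem zero_le_one ht, solution_eq hu ⟨t, ht⟩]

/-- The substitution τ ↦ k τ in the integral equation absorbs the factor k from the homogeneity of
X. Thus applying S_k to a solution and slowing time by k yields a solution again. -/
theorem odeDefect_scaling [CompleteSpace E] {P : E →L[ℝ] E} {X : C(ℝ × E, E)} {y₀ : E} {r : ℝ}
    (hXs : ∀ l ∈ Icc (0 : ℝ) 1, ∀ k ∈ Icc (0 : ℝ) 1, ∀ y ∈ Metric.ball y₀ r,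
      X (l, scaling P k y) = k • scaling P k (X (k * l, y)))
    {u : C(unitInterval, E)} {y : E} (hu : odeDefect X u = ContinuousMap.const unitInterval y)
    (hur : ∀ t, u t ∈ Metric.ball y₀ r) (k : unitInterval) :
    odeDefect X ⟨fun t => scaling P k (u (k * t)), by fun_prop⟩ =
      ContinuousMap.const unitInterval (scaling P k y) := by
  ext t
  change scaling P k (u (k * t)) - primitive E _ t = scaling P k y
  rw [primitive_apply]
  have hc : Continuous fun τ : ℝ =>
      X (projIcc 0 1 zero_le_one τ, u (projIcc 0 1 zero_le_one τ)) := by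
    have := continuous_projIcc (a := (0 : ℝ)) (b := 1) (h := zero_le_one)
    fun_prop
  have h1 : ∫ τ in (0 : ℝ)..t, (X.comp (timeGraph (⟨fun t => scaling P k (u (k * t)), by fun_prop⟩ :
      C(unitInterval, E)))) (projIcc 0 1 zero_le_one τ) =
      ∫ τ in (0 : ℝ)..t, (k : ℝ) • scaling P k ((fun τ : ℝ =>
      X (projIcc 0 1 zero_le_one τ, u (projIcc 0 1 zero_le_one τ))) (k * τ)) := by
    refine intervalIntegral.integral_congr fun τ hτ => ?_
    rw [uIcc_of_le t.2.1] at hτ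
    have hτ' : τ ∈ Icc (0 : ℝ) 1 := ⟨hτ.1, hτ.2.trans t.2.2⟩
    have hkτ : (k : ℝ) * τ ∈ Icc (0 : ℝ) 1 := (k * ⟨τ, hτ'⟩ : unitInterval).2
    simp only [projIcc_of_mem zero_le_one hτ', projIcc_of_mem zero_le_one hkτ]
    exact hXs τ hτ' k k.2 _ (hur (k * ⟨τ, hτ'⟩))
  rw [h1, intervalIntegral.integral_smul, ContinuousLinearMap.intervalIntegral_comp_comm,
    ← map_smul, intervalIntegral.smul_integral_comp_mul_left (fun τ : ℝ =>
      X (projIcc 0 1 zero_le_one τ, u (projIcc 0 1 zero_le_one τ))), mul_zero, ← map_sub,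
    solution_eq hu (k * t)]
  · simp
  · exact (hc.comp (continuous_const.mul continuous_id)).intervalIntegrable _ _

/-- The factor k vanishes at 0, so the difference quotient there is f itself and continuity of f
suffices. -/
theorem hasDerivWithinAt_id_smul {f : ℝ → E} {s : Set ℝ} (hf : ContinuousWithinAt f s 0) :
    HasDerivWithinAt (fun k : ℝ => k • f k) (f 0) s 0 := by
  rw [hasDerivWithinAt_iff_tendsto_slope]
  refine (hf.mono sdiff_subset).congr' ?_
  filter_upwards [self_mem_nhdsWithin] with k hk
  have hk0 : k ≠ 0 := hk.2
  simp [slope, smul_smul, hk0]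

/-- Local linearization of a vector field which is Euler for the linear subspace `ker P`. -/
theorem exists_linearization_of_contDiff [CompleteSpace E] {P : E →L[ℝ] E} {y₀ : E}
    (hP : ∀ y, P (P y) = P y) (hy₀ : P y₀ = 0)
    (hS : ∀ l ∈ Icc (0 : ℝ) 1, ∀ y, ‖scaling P l y‖ ≤ ‖y‖)
    {v : E → E} (hv : ContDiff ℝ ∞ v) {r : ℝ} (hr : 0 < r)
    (hv0 : ∀ y ∈ Metric.ball y₀ r, P y = 0 → v y = 0)
    (hv1 : ∀ y ∈ Metric.ball y₀ r, P y = 0 → ∀ w, P (fderiv ℝ v y w) = P w) :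
    ∃ Ξ : OpenPartialHomeomorph E E, y₀ ∈ Ξ.source ∧ Ξ.target ⊆ Metric.ball y₀ r ∧
      ContDiffOn ℝ ∞ Ξ Ξ.source ∧ ContDiffOn ℝ ∞ Ξ.symm Ξ.target ∧
      (∀ y ∈ Ξ.source, fderiv ℝ Ξ y (P y) = v (Ξ y)) ∧
      (∀ y ∈ Ξ.source, P y = 0 → Ξ y = y) ∧
      (∀ y ∈ Ξ.source, P (Ξ y) = 0 → Ξ y = y) ∧
      (∀ y ∈ Ξ.source, P y = 0 → ∀ w, P (fderiv ℝ Ξ y w) = P w) := by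
  obtain ⟨X₀, hX, key⟩ := exists_rescaled_field hv hP hy₀ hS hv0 hv1
  let X : C(ℝ × E, E) := ⟨X₀, hX.continuous⟩
  have hy₀r := Metric.mem_ball_self (x := y₀) hr
  obtain ⟨O, U, hO, hy₀O, hU, hUsol, hUr, huniq⟩ := exists_solution_operator X hX (y₀ := y₀)
    (N := (fderiv ℝ v y₀).comp P - P)
    (fun l hl => rescaled_field_eq_zero hP hX.continuous hv0 key hl hy₀r hy₀)
    (fun w => by simp [hP, hv1 y₀ hy₀r hy₀])
    (fun l hl w => rescaled_field_fderiv hP hX hy₀ hr hv hv0 hv1 key hl w) hr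
  obtain ⟨r₁, hr₁, hr₁O⟩ := Metric.isOpen_iff.1 hO y₀ hy₀O
  -- The rescaled curve solves the problem with initial value S_k y. It is no farther from the
  -- constant y₀ than U y is, because S_k is a contraction fixing y₀; local uniqueness therefore
  -- identifies it with U (S_k y), and time one is read off.
  have hscale : ∀ y ∈ Metric.ball y₀ r₁, ∀ k : unitInterval,
      U (scaling P k y) 1 = scaling P k (U y k) := by
    intro y hy k
    have := huniq y (hr₁O hy) ⟨fun t => scaling P k (U y (k * t)), by fun_prop⟩ ?_ _
      (hr₁O (scaling_mem_ball hy₀ hS k.2 hy))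
      (odeDefect_scaling (fun l hl k hk y hy => rescaled_field_scaling hP hX.continuous hy₀ hS hv0
        key hl hk hy) (hUsol y (hr₁O hy)) (hUr y (hr₁O hy)) k)
    · rw [← this]
      simp
    · refine (ContinuousMap.norm_le _ (norm_nonneg _)).2 fun t => ?_
      have h1 : scaling P k (U y (k * t)) - y₀ = scaling P k (U y (k * t) - y₀) := by
        rw [map_sub, scaling_of_apply_eq_zero hy₀]
      change ‖scaling P k (U y (k * t)) - y₀‖ ≤ _
      rw [h1]
      exact (hS k k.2 _).trans
        ((U y - ContinuousMap.const unitInterval y₀).norm_coe_le_norm (k * t))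
  set f : E → E := fun y => U y 1 with hf_def
  have heval : ContDiff ℝ ∞ (fun u : C(unitInterval, E) => u 1) := by
    have := ContinuousLinearMap.contDiff (𝕜 := ℝ) (n := ∞) (E := C(unitInterval, E)) (F := E)
      (ContinuousMap.evalCLM ℝ (1 : unitInterval))
    exact this
  have hf : ContDiffOn ℝ ∞ f (Metric.ball y₀ r₁) := (heval.comp_contDiffOn hU).mono hr₁O
  have hfd : ∀ y ∈ Metric.ball y₀ r₁, HasFDerivAt f (fderiv ℝ f y) y := fun y hy =>
    ((hf.contDiffAt (Metric.isOpen_ball.mem_nhds hy)).differentiableAt (by simp)).hasFDerivAt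
  have hf0 : ∀ y ∈ Metric.ball y₀ r₁, P y = 0 → f y = y := by
    intro y hy hPy
    have := hscale y hy 0
    rw [solution_zero (hUsol y (hr₁O hy))] at this
    simpa [scaling_of_apply_eq_zero hPy] using this
  have hray : ∀ y ∈ Metric.ball y₀ r₁, ∀ k ∈ Icc (0 : ℝ) 1,
      f (scaling P k y) = scaling P k (U y (projIcc 0 1 zero_le_one k)) := by
    intro y hy k hk
    rw [projIcc_of_mem zero_le_one hk]
    exact hscale y hy ⟨k, hk⟩
  have hrayd : ∀ (y : E) (k : ℝ), HasDerivAt (fun k : ℝ => scaling P k y) (P y) k := by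
    intro y k
    simp only [scaling_apply]
    simpa using ((hasDerivAt_id k).smul_const (P y)).const_add (y - P y)
  have hUcont : ∀ y, Continuous fun k : ℝ => U y (projIcc 0 1 zero_le_one k) := fun y =>
    (U y).continuous.comp continuous_projIcc
  have hfker : ∀ x ∈ Metric.ball y₀ r₁, P x = 0 → ∀ w, P w = 0 → fderiv ℝ f x w = w := by
    intro x hx hPx w hPw
    have h2 : HasDerivAt (fun t : ℝ => x + t • w) w 0 := by
      simpa using ((hasDerivAt_id (0 : ℝ)).smul_const w).const_add x
    have h3 : HasFDerivAt f (fderiv ℝ f x) (x + (0 : ℝ) • w) := by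
      rw [zero_smul, add_zero]; exact hfd x hx
    have h1 := h3.comp_hasDerivAt (0 : ℝ) h2
    refine h1.unique (h2.congr_of_eventuallyEq ?_)
    have hc : ContinuousAt (fun t : ℝ => x + t • w) 0 := by fun_prop
    have : ∀ᶠ t : ℝ in 𝓝 0, x + t • w ∈ Metric.ball y₀ r₁ :=
      hc.eventually_mem (by simpa using Metric.isOpen_ball.mem_nhds hx)
    filter_upwards [this] with t ht
    exact hf0 _ ht (by simp [hPx, hPw])
  -- Applying P to f(S_k y) = S_k u_k(y) gives P f(S_k y) = k P u_k(y), whose derivative at k = 0 is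
  -- P u_0 = P y.
  have hfP : ∀ x ∈ Metric.ball y₀ r₁, P x = 0 → ∀ w, P (fderiv ℝ f x w) = P w := by
    intro x hx hPx w
    have hsub : P (fderiv ℝ f x (P w)) = P w := by
      have hc : ContinuousAt (fun t : ℝ => x + t • P w) 0 := by fun_prop
      have : ∀ᶠ t : ℝ in 𝓝 0, x + t • P w ∈ Metric.ball y₀ r₁ :=
        hc.eventually_mem (by simpa using Metric.isOpen_ball.mem_nhds hx)
      -- A small positive multiple of P w keeps x + η P w in the ball; linearity allows η to be
      -- cancelled at the end.
      obtain ⟨η, hη, hη0⟩ := ((this.filter_mono nhdsWithin_le_nhds).and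
        (self_mem_nhdsWithin : Ioi (0 : ℝ) ∈ 𝓝[>] 0)).exists
      set y := x + η • P w with hy
      have hPy : P y = η • P w := by simp [hy, hPx, hP]
      have hy0 : scaling P 0 y = x := by rw [scaling_apply, hPy]; simp [hy]
      have h3 : HasFDerivAt f (fderiv ℝ f x) (scaling P 0 y) := by rw [hy0]; exact hfd x hx
      have h4 := (P.hasFDerivAt.comp_hasDerivAt (0 : ℝ)
        (h3.comp_hasDerivAt (0 : ℝ) (hrayd y 0))).hasDerivWithinAt (s := Icc 0 1)
      have h5 := hasDerivWithinAt_id_smul (s := Icc 0 1)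
        (f := fun k => P (U y (projIcc 0 1 zero_le_one k)))
        (P.continuous.comp (hUcont y)).continuousWithinAt
      have h6 := h4.congr (f₁ := fun k : ℝ => k • P (U y (projIcc 0 1 zero_le_one k)))
        (fun k hk => by simp [hray y hη k hk, apply_scaling hP])
        (by simp [hray y hη 0 ⟨le_rfl, zero_le_one⟩, apply_scaling hP])
      have h7 := (uniqueDiffOn_Icc zero_lt_one 0 ⟨le_rfl, zero_le_one⟩).eq_deriv _ h5 h6
      simp only [projIcc_left] at h7
      have h8 : U y ⟨0, left_mem_Icc.2 zero_le_one⟩ = y := solution_zero (hUsol y (hr₁O hη))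
      rw [h8, hPy, map_smul, map_smul] at h7
      exact (smul_right_injective E (ne_of_gt hη0) h7).symm
    have : w = (w - P w) + P w := by abel
    conv_lhs => rw [this]
    rw [map_add, map_add, hfker x hx hPx _ (by simp [hP]), hsub]
    simp [hP]
  -- Differentiate f(S_k y) = S_k u_k(y) at k = 1. The right side gives X(1, u_1) + P u_1, which is
  -- v(u_1) by the defining relation of X at l = 1.
  have hfv : ∀ y ∈ Metric.ball y₀ r₁, fderiv ℝ f y (P y) = v (f y) := by
    intro y hy
    have h1m : (1 : ℝ) ∈ Icc (0 : ℝ) 1 := ⟨zero_le_one, le_rfl⟩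
    have h3 : HasFDerivAt f (fderiv ℝ f y) (scaling P 1 y) := by rw [scaling_one]; exact hfd y hy
    have h4 := (h3.comp_hasDerivAt (1 : ℝ) (hrayd y 1)).hasDerivWithinAt (s := Icc 0 1)
    have hu := solution_hasDerivWithinAt (hUsol y (hr₁O hy)) h1m
    have hPu := P.hasFDerivAt.comp_hasDerivWithinAt (1 : ℝ) hu
    have h5 := (hu.sub hPu).add ((hasDerivWithinAt_id (1 : ℝ) (Icc 0 1)).smul hPu)
    have h6 := h4.congr (f₁ := fun k : ℝ => scaling P k (U y (projIcc 0 1 zero_le_one k)))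
      (fun k hk => (hray y hy k hk).symm) (hray y hy 1 h1m).symm
    have h7 := (uniqueDiffOn_Icc zero_lt_one 1 h1m).eq_deriv _ h6 h5
    have h8 := key 1 (U y 1) (hUr y (hr₁O hy) 1)
    rw [scaling_one, scaling_one, one_smul] at h8
    rw [h7, ← h8]
    change X (1, U y 1) - P (X (1, U y 1)) + ((1 : ℝ) • P (X (1, U y 1)) +
      (1 : ℝ) • P (U y (projIcc 0 1 zero_le_one 1))) = X (1, U y 1) + P (U y 1)
    rw [projIcc_right]
    change X (1, U y 1) - P (X (1, U y 1)) + ((1 : ℝ) • P (X (1, U y 1)) +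
      (1 : ℝ) • P (U y 1)) = X (1, U y 1) + P (U y 1)
    rw [one_smul, one_smul]
    abel
  have hy₀r₁ := Metric.mem_ball_self (x := y₀) hr₁
  -- Df(y₀) is the identity on the kernel of P and preserves normal components, so it is 1 + M with
  -- M² = 0, and 1 - M is its inverse.
  let M : E →L[ℝ] E := (fderiv ℝ f y₀).comp P - P
  have hM : ∀ w, M (M w) = 0 := fun w => by simp [M, hP, hfP y₀ hy₀r₁ hy₀]
  let A : E ≃L[ℝ] E := ContinuousLinearEquiv.equivOfInverse (ContinuousLinearMap.id ℝ E + M)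
    (ContinuousLinearMap.id ℝ E - M) (fun w => by simp [hM]) (fun w => by simp [hM])
  have hA : fderiv ℝ f y₀ = (A : E →L[ℝ] E) := by
    ext w
    have : w = (w - P w) + P w := by abel
    conv_lhs => rw [this]
    rw [map_add, hfker y₀ hy₀r₁ hy₀ _ (by simp [hP])]
    change _ = w + (fderiv ℝ f y₀ (P w) - P w)
    abel
  obtain ⟨e, he0, hes, hef, hesm⟩ := exists_openPartialHomeomorph_contDiffOn
    (Metric.isOpen_ball.inter Metric.isOpen_ball) (hf.mono inter_subset_left)
    (⟨hy₀r₁, hy₀r⟩ : y₀ ∈ Metric.ball y₀ r₁ ∩ Metric.ball y₀ r) A (hA ▸ hfd y₀ hy₀r₁)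
  have hfy₀ : f y₀ = y₀ := hf0 y₀ hy₀r₁ hy₀
  -- Both y and e y should lie where e is injective: if P (e y) = 0, then e fixes e y, and
  -- injectivity forces e y = y.
  have hopen : IsOpen (e.source ∩ e ⁻¹' e.source) := e.isOpen_inter_preimage e.open_source
  refine ⟨e.restrOpen _ hopen, ⟨he0, he0, ?_⟩, ?_, ?_, ?_, ?_, ?_, ?_, ?_⟩
  · change e y₀ ∈ e.source
    rw [hef, hfy₀]; exact he0
  · intro z hz
    have hz' := (e.restrOpen _ hopen).map_target hz
    have h1 : e ((e.restrOpen _ hopen).symm z) ∈ e.source := hz'.2.2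
    have h2 : e ((e.restrOpen _ hopen).symm z) = z := (e.restrOpen _ hopen).right_inv hz
    rw [h2] at h1
    exact (hes h1).2
  · exact (hef ▸ hf : ContDiffOn ℝ ∞ e _).mono fun y hy => (hes hy.1).1
  · exact hesm.mono fun z hz => hz.1
  · intro y hy
    change fderiv ℝ e y (P y) = v (e y)
    rw [hef]; exact hfv y (hes hy.1).1
  · intro y hy hPy
    change e y = y
    rw [hef]; exact hf0 y (hes hy.1).1 hPy
  · intro y hy hPy
    change P (e y) = 0 at hPy
    change e y = y
    refine e.injOn hy.2.2 hy.1 ?_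
    have := hf0 (e y) (hes hy.2.2).1 hPy
    rwa [← hef] at this
  · intro y hy hPy w
    change P (fderiv ℝ e y w) = P w
    rw [hef]; exact hfP y (hes hy.1).1 hPy w

end Linearization

/-! ### Bounded families of test functions -/

section BoundedFamilies

variable {E : Type*} [NormedAddCommGroup E] [NormedSpace ℝ E]

/-- The superposition `∑ a i • F i` of a bounded family of test functions supported in `K`, with
summable coefficients, as a continuous linear map on `ℓ¹`. -/
theorem exists_superposition {ι : Type*} (K : Compacts E) (F : ι → E → ℝ)
    (hF : ∀ i, ContDiff ℝ ∞ (F i)) (hK : ∀ i, tsupport (F i) ⊆ K)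
    (hb : ∀ k : ℕ, ∃ C : ℝ, ∀ i x, ‖iteratedFDeriv ℝ k (F i) x‖ ≤ C) :
    ∃ Θ : lp (fun _ : ι => ℝ) 1 →L[ℝ] 𝓓_{K}(E, ℝ), ∀ a x, Θ a x = ∑' i, a i * F i x := by
  choose C hC using hb
  have hsum : ∀ a : lp (fun _ : ι => ℝ) 1, Summable fun i => |a i| := by
    intro a
    simpa using (lp.memℓp a).summable (by simp)
  have hnorm : ∀ a : lp (fun _ : ι => ℝ) 1, ‖a‖ = ∑' i, |a i| := by
    intro a
    simpa using lp.norm_eq_tsum_rpow (by simp) a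
  have hterm : ∀ a : lp (fun _ : ι => ℝ) 1, ∀ i, ContDiff ℝ ∞ fun x => a i * F i x :=
    fun a i => contDiff_const.mul (hF i)
  have hbound : ∀ (a : lp (fun _ : ι => ℝ) 1) (k : ℕ) (i : ι) (x : E),
      ‖iteratedFDeriv ℝ k (fun x => a i * F i x) x‖ ≤ |a i| * C k := by
    intro a k i x
    have : iteratedFDeriv ℝ k (fun x => a i * F i x) x = a i • iteratedFDeriv ℝ k (F i) x :=
      iteratedFDeriv_const_smul_apply (a := (a i : ℝ)) (f := F i) (x := x)
        (contDiff_infty.1 (hF i) k).contDiffAt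
    rw [this, norm_smul]
    exact mul_le_mul_of_nonneg_left (hC k i x) (norm_nonneg _)
  have hsumC : ∀ (a : lp (fun _ : ι => ℝ) 1) (k : ℕ), Summable fun i => |a i| * C k :=
    fun a k => (hsum a).mul_right _
  have hsupp : ∀ i, ∀ x ∉ K, F i x = 0 := fun i x hx =>
    image_eq_zero_of_notMem_tsupport fun h => hx (hK i h)
  have hpt : ∀ (a : lp (fun _ : ι => ℝ) 1) (x : E), Summable fun i => a i * F i x := by
    intro a x
    refine Summable.of_norm_bounded (hsumC a 0) fun i => ?_
    simpa using hbound a 0 i x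
  let Θ₀ : lp (fun _ : ι => ℝ) 1 →ₗ[ℝ] 𝓓_{K}(E, ℝ) :=
    { toFun := fun a => ⟨fun x => ∑' i, a i * F i x,
        contDiff_tsum (N := ⊤) (hterm a) (fun k _ => hsumC a k) (fun k i x _ => hbound a k i x),
        fun x hx => by simp [hsupp _ x hx]⟩
      map_add' := fun a b => by
        ext x
        change ∑' i, (a + b) i * F i x = ∑' i, a i * F i x + ∑' i, b i * F i x
        rw [← (hpt a x).tsum_add (hpt b x)]
        exact tsum_congr fun i => by rw [lp.coeFn_add, Pi.add_apply, add_mul]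
      map_smul' := fun c a => by
        ext x
        change ∑' i, (c • a) i * F i x = c * ∑' i, a i * F i x
        rw [← tsum_mul_left]
        exact tsum_congr fun i => by rw [lp.coeFn_smul, Pi.smul_apply, smul_eq_mul, mul_assoc] }
  have hcont : Continuous Θ₀ := by
    refine (ContDiffMapSupportedIn.continuous_iff_comp _).2 fun k => ?_
    refine AddMonoidHomClass.continuous_of_bound
      ((ContDiffMapSupportedIn.structureMapLM ℝ ⊤ k).comp Θ₀) |C k| fun a => ?_
    refine (BoundedContinuousFunction.norm_le (by positivity)).2 fun x => ?_
    change ‖ContDiffMapSupportedIn.structureMapLM ℝ ⊤ k (Θ₀ a) x‖ ≤ _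
    rw [ContDiffMapSupportedIn.structureMapLM_top_apply]
    change ‖iteratedFDeriv ℝ k (fun x => ∑' i, a i * F i x) x‖ ≤ _
    rw [iteratedFDeriv_tsum_apply (N := ⊤) (hterm a) (fun k _ => hsumC a k)
      (fun k i x _ => hbound a k i x) le_top]
    have h1 : Summable fun i => ‖iteratedFDeriv ℝ k (fun x => a i * F i x) x‖ :=
      Summable.of_nonneg_of_le (fun _ => norm_nonneg _) (fun i => hbound a k i x) (hsumC a k)
    refine (norm_tsum_le_tsum_norm h1).trans ?_
    refine (h1.tsum_le_tsum (fun i => hbound a k i x) (hsumC a k)).trans ?_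
    rw [tsum_mul_right, hnorm, mul_comm]
    exact mul_le_mul_of_nonneg_right (le_abs_self _) (tsum_nonneg fun i => abs_nonneg _)
  exact ⟨⟨Θ₀, hcont⟩, fun a x => rfl⟩

/-- The uniform boundedness principle for distributions: a pointwise bounded family of
distributions is bounded along a bounded family of test functions. -/
theorem bounded_apply_of_pointwise_bounded {ι : Type*} {Ω : Opens E} (T : ι → 𝓓'(Ω, ℂ)) (c : ι → ℂ)
    (hT : ∀ f : 𝓓(Ω, ℝ), ∃ C : ℝ, ∀ i, ‖c i * T i f‖ ≤ C)
    {K : Set E} (hK : IsCompact K) (hKΩ : K ⊆ Ω) (F : ι → 𝓓(Ω, ℝ)) (hF : ∀ i, tsupport (F i) ⊆ K)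
    (hb : ∀ k : ℕ, ∃ C : ℝ, ∀ i x, ‖iteratedFDeriv ℝ k (F i) x‖ ≤ C) :
    ∃ C : ℝ, ∀ i, ‖c i * T i (F i)‖ ≤ C := by
  classical
  obtain ⟨Θ, hΘ⟩ := exists_superposition ⟨K, hK⟩ (fun i => F i) (fun i => (F i).contDiff) hF hb
  -- Banach–Steinhaus is applied on ℓ¹ instead of the space of test functions: the functionals a ↦ c
  -- i T i (∑ a j F j) are pointwise bounded, hence uniformly bounded, and the unit vector at i
  -- recovers F i.
  let Λ : lp (fun _ : ι => ℝ) 1 →L[ℝ] 𝓓(Ω, ℝ) :=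
    (TestFunction.ofSupportedInCLM ℝ (K := ⟨K, hK⟩) hKΩ).comp Θ
  let g : ι → lp (fun _ : ι => ℝ) 1 →L[ℝ] ℂ := fun i =>
    c i • ((show 𝓓(Ω, ℝ) →L[ℝ] ℂ from T i).comp Λ)
  have hg : ∀ i a, g i a = c i * T i (Λ a) := fun i a => rfl
  obtain ⟨C, hC⟩ := banach_steinhaus (g := g) (fun a => (hT (Λ a)).imp fun C hC i => hC i)
  refine ⟨C, fun i => ?_⟩
  have h1 : Λ (lp.single 1 i 1) = F i := by
    ext x
    change Θ (lp.single 1 i 1) x = F i x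
    rw [hΘ, tsum_eq_single i]
    · simp
    · intro j hj
      simp [hj]
  have h2 := (g i).le_of_opNorm_le (hC i) (lp.single 1 i 1)
  rw [hg, h1, lp.norm_single (by simp)] at h2
  simpa using h2

/-- The members `F (l, ·)` of a smooth family of functions supported in a compact set have
derivatives which are bounded locally uniformly in `l`. -/
theorem bounded_iteratedFDeriv_of_contDiff {F : ℝ × E → ℝ} (hF : ContDiff ℝ ∞ F) {K : Set E}
    (hK : IsCompact K) (hsupp : ∀ l, tsupport (fun x => F (l, x)) ⊆ K) {A : Set ℝ}
    (hA : IsCompact A) (k : ℕ) :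
    ∃ C : ℝ, ∀ l ∈ A, ∀ x, ‖iteratedFDeriv ℝ k (fun x => F (l, x)) x‖ ≤ C := by
  have hc : Continuous (iteratedFDeriv ℝ k F) :=
    hF.continuous_iteratedFDeriv (by exact_mod_cast le_top)
  obtain ⟨C, hC⟩ := (hA.prod hK).exists_bound_of_continuousOn hc.continuousOn
  refine ⟨|C| * ∏ _i : Fin k, ‖ContinuousLinearMap.inr ℝ ℝ E‖, fun l hl x => ?_⟩
  by_cases hx : x ∈ K
  · have h1 : (fun x => F (l, x)) = (fun z : ℝ × E => F ((l, 0) + z)) ∘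
        ContinuousLinearMap.inr ℝ ℝ E := by ext x; simp
    have h2 : ContDiff ℝ ∞ (fun z : ℝ × E => F ((l, 0) + z)) :=
      hF.comp (contDiff_const.add contDiff_id)
    rw [h1, ContinuousLinearMap.iteratedFDeriv_comp_right (n := ∞) _
      h2 x (by exact_mod_cast le_top),
      iteratedFDeriv_comp_add_left]
    refine (ContinuousMultilinearMap.norm_compContinuousLinearMap_le _ _).trans ?_
    gcongr
    have := hC (l, x) ⟨hl, hx⟩
    simpa using this.trans (le_abs_self C)
  · have h0 : iteratedFDeriv ℝ k (fun x => F (l, x)) x = 0 := by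
      by_contra h
      exact hx (hsupp l (support_iteratedFDeriv_subset k h))
    rw [h0, norm_zero]
    positivity

end BoundedFamilies

/-! ### Rescaling of local diffeomorphisms -/

section Transition

theorem contDiff_det {E : Type*} [NormedAddCommGroup E] [NormedSpace ℝ E] [FiniteDimensional ℝ E]
    {n : WithTop ℕ∞} : ContDiff ℝ n (fun A : E →L[ℝ] E => A.det) := by
  let b := Module.finBasis ℝ E
  have h : (fun A : E →L[ℝ] E => A.det) = fun A : E →L[ℝ] E =>
      ∑ σ : Equiv.Perm (Fin (Module.finrank ℝ E)), (Equiv.Perm.sign σ : ℝ) *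
        ∏ i, LinearMap.toContinuousLinearMap (b.coord (σ i)) (A (b i)) := by
    ext A
    change LinearMap.det (A : E →ₗ[ℝ] E) = _
    rw [← LinearMap.det_toMatrix b, Matrix.det_apply']
    simp [LinearMap.toMatrix_apply]
  rw [h]
  refine ContDiff.sum fun σ _ => contDiff_const.mul (contDiff_prod fun i _ => ?_)
  exact (ContinuousLinearMap.contDiff _).comp (contDiff_id.clm_apply contDiff_const)

universe u
variable {E : Type u} [NormedAddCommGroup E] [NormedSpace ℝ E]

/-- A smooth function on an open set agrees near any point with a globally smooth function. -/
theorem exists_contDiff_eqOn_ball [FiniteDimensional ℝ E] {F : Type*} [NormedAddCommGroup F]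
    [NormedSpace ℝ F] {f : E → F} {O : Set E} (hO : IsOpen O) (hf : ContDiffOn ℝ ∞ f O) {a : E}
    (ha : a ∈ O) : ∃ g : E → F, ContDiff ℝ ∞ g ∧ ∃ r > 0, Metric.ball a r ⊆ O ∧
      EqOn f g (Metric.ball a r) := by
  obtain ⟨R, hR, hRO⟩ := Metric.isOpen_iff.1 hO a ha
  let b : ContDiffBump a := ⟨R / 3, R / 2, by positivity, by linarith⟩
  refine ⟨fun x => b x • f x, ?_, R / 3, by positivity,
    (Metric.ball_subset_ball (by linarith)).trans hRO, fun x hx => ?_⟩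
  · rw [contDiff_iff_contDiffAt]
    intro x
    by_cases hx : x ∈ Metric.closedBall a (R / 2)
    · exact b.contDiff.contDiffAt.smul (hf.contDiffAt (hO.mem_nhds
        (hRO (Metric.closedBall_subset_ball (by linarith) hx))))
    · refine (contDiffAt_const (c := (0 : F))).congr_of_eventuallyEq ?_
      filter_upwards [Metric.isClosed_closedBall.isOpen_compl.mem_nhds hx] with z hz
      have hz' : ¬ dist z a ≤ R / 2 := hz
      have : b z = 0 := b.zero_of_le_dist (not_le.1 hz').le
      simp [this]
  · change f x = b x • f x
    rw [b.one_of_mem_closedBall (Metric.ball_subset_closedBall hx), one_smul]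

/-- Local linearization of a vector field which is Euler for the linear subspace `ker P`. -/
theorem exists_linearization [FiniteDimensional ℝ E] {P : E →L[ℝ] E} {y₀ : E}
    (hP : ∀ y, P (P y) = P y) (hy₀ : P y₀ = 0)
    (hS : ∀ l ∈ Icc (0 : ℝ) 1, ∀ y, ‖scaling P l y‖ ≤ ‖y‖)
    {v : E → E} {O : Set E} (hO : IsOpen O) (hyO : y₀ ∈ O) (hv : ContDiffOn ℝ ∞ v O)
    (hv0 : ∀ y ∈ O, P y = 0 → v y = 0)
    (hv1 : ∀ y ∈ O, P y = 0 → ∀ w, P (fderiv ℝ v y w) = P w) :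
    ∃ Ξ : OpenPartialHomeomorph E E, y₀ ∈ Ξ.source ∧ Ξ.target ⊆ O ∧
      ContDiffOn ℝ ∞ Ξ Ξ.source ∧ ContDiffOn ℝ ∞ Ξ.symm Ξ.target ∧
      (∀ y ∈ Ξ.source, fderiv ℝ Ξ y (P y) = v (Ξ y)) ∧
      (∀ y ∈ Ξ.source, P y = 0 → Ξ y = y) ∧
      (∀ y ∈ Ξ.source, P (Ξ y) = 0 → Ξ y = y) ∧
      (∀ y ∈ Ξ.source, P y = 0 → ∀ w, P (fderiv ℝ Ξ y w) = P w) := by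
  have : CompleteSpace E := FiniteDimensional.complete ℝ E
  obtain ⟨g, hg, r, hr, hrO, hfg⟩ := exists_contDiff_eqOn_ball hO hv hyO
  obtain ⟨Ξ, h1, h2, h3, h4, h5, h6⟩ := exists_linearization_of_contDiff hP hy₀ hS hg hr
    (fun y hy hPy => by rw [← hfg hy]; exact hv0 y (hrO hy) hPy)
    (fun y hy hPy w => by
      rw [← (hfg.eventuallyEq_of_mem (Metric.isOpen_ball.mem_nhds hy)).fderiv_eq]
      exact hv1 y (hrO hy) hPy w)
  refine ⟨Ξ, h1, h2.trans hrO, h3, h4, fun y hy => ?_, h6⟩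
  rw [h5 y hy, hfg (h2 (Ξ.map_source hy))]

/-- The conjugates of `f` by the scalings extend smoothly to `l = 0`, where they are the identity,
if `f` is the identity on `ker P` and tangent to it in the directions of the range of `P`. -/
theorem exists_rescaled_map [CompleteSpace E] {P : E →L[ℝ] E} {y₀ : E} {r : ℝ}
    (hP : ∀ y, P (P y) = P y) (hy₀ : P y₀ = 0)
    (hS : ∀ l ∈ Icc (0 : ℝ) 1, ∀ y, ‖scaling P l y‖ ≤ ‖y‖) {f : E → E} (hf : ContDiff ℝ ∞ f)
    (hf0 : ∀ y ∈ Metric.ball y₀ r, P y = 0 → f y = y)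
    (hf1 : ∀ y ∈ Metric.ball y₀ r, P y = 0 → ∀ w, P (fderiv ℝ f y w) = P w) :
    ∃ R : ℝ × E → E, ContDiff ℝ ∞ R ∧ (∀ y ∈ Metric.ball y₀ r, R (0, y) = y) ∧
      ∀ l, l ≠ 0 → ∀ y ∈ Metric.ball y₀ r, R (l, y) = scaling P l⁻¹ (f (scaling P l y)) := by
  have hsm : ContDiff ℝ ∞ (fun z : ℝ × E => scaling P z.1 z.2) := contDiff_scaling P
  have hfs : ContDiff ℝ ∞ (fun z : ℝ × E => f (scaling P z.1 z.2)) := hf.comp hsm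
  obtain ⟨q, hq, hq1, hq0⟩ := exists_smooth_quotient (fun z : ℝ × E => f (scaling P z.1 z.2)) hfs
  have h0 : ∀ y ∈ Metric.ball y₀ r, scaling P 0 y ∈ Metric.ball y₀ r ∧ P (scaling P 0 y) = 0 :=
    fun y hy => ⟨scaling_mem_ball hy₀ hS ⟨le_rfl, zero_le_one⟩ hy, by simp [apply_scaling hP]⟩
  have hq0' : ∀ y ∈ Metric.ball y₀ r, P (q (0, y)) = P y := by
    intro y hy
    have hd2 : HasDerivAt (fun l : ℝ => scaling P l y) (P y) 0 := by
      simp only [scaling_apply]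
      simpa using ((hasDerivAt_id (0 : ℝ)).smul_const (P y)).const_add (y - P y)
    have hd3 := ((hfs.differentiable (by simp)) ((0 : ℝ), y)).hasFDerivAt.comp_hasDerivAt (0 : ℝ)
      ((hasDerivAt_id (0 : ℝ)).prodMk (hasDerivAt_const 0 y))
    have hd4 := ((hf.differentiable (by simp)) (scaling P 0 y)).hasFDerivAt.comp_hasDerivAt
      (0 : ℝ) hd2
    rw [hq0, show fderiv ℝ (fun z : ℝ × E => f (scaling P z.1 z.2)) (0, y) (1, 0) =
      fderiv ℝ f (scaling P 0 y) (P y) from hd3.unique hd4, hf1 _ (h0 y hy).1 (h0 y hy).2, hP]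
  -- S_l⁻¹ leaves the tangential part of f(S_l y) alone and divides the normal part by l; since f
  -- preserves the kernel of P, that part is l P q with q smooth.
  refine ⟨fun z => f (scaling P z.1 z.2) - P (f (scaling P z.1 z.2)) + P (q z),
    (hfs.sub (P.contDiff.comp hfs)).add (P.contDiff.comp hq), fun y hy => ?_, fun l hl y hy => ?_⟩
  · simp only [hq0' y hy, hf0 _ (h0 y hy).1 (h0 y hy).2, (h0 y hy).2]
    simp [scaling_apply]
  · have e1 := congrArg P (hq1 l y)
    simp only [hf0 _ (h0 y hy).1 (h0 y hy).2, map_sub, (h0 y hy).2, sub_zero, map_smul] at e1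
    simp only [scaling_apply P l⁻¹]
    rw [e1, smul_smul, inv_mul_cancel₀ hl, one_smul]

/-- Let `f` and `g` be mutually inverse local diffeomorphisms as in `exists_rescaled_map`. The
densities `φ (f_l w) |det D f_l (w)|`, where `f_l` is `f` conjugated by the scaling, form for small
`l` a smooth family with supports in a fixed compact set. -/
theorem exists_density_family [FiniteDimensional ℝ E] {P : E →L[ℝ] E} {y₀ : E}
    (hP : ∀ y, P (P y) = P y) (hy₀ : P y₀ = 0)
    (hS : ∀ l ∈ Icc (0 : ℝ) 1, ∀ y, ‖scaling P l y‖ ≤ ‖y‖) {f g : E → E} {O : Set E}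
    (hO : IsOpen O) (hyO : y₀ ∈ O) (hf : ContDiffOn ℝ ∞ f O) (hg : ContDiffOn ℝ ∞ g O)
    (hf0 : ∀ y ∈ O, P y = 0 → f y = y) (hg0 : ∀ y ∈ O, P y = 0 → g y = y)
    (hf1 : ∀ y ∈ O, P y = 0 → ∀ w, P (fderiv ℝ f y w) = P w)
    (hg1 : ∀ y ∈ O, P y = 0 → ∀ w, P (fderiv ℝ g y w) = P w)
    (hgf : ∀ y ∈ O, g (f y) = y) :
    ∃ r > 0, Metric.ball y₀ r ⊆ O ∧ ∀ B : Set E, IsOpen B → B ⊆ Metric.ball y₀ r →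
      ∀ φ : E → ℝ, ContDiff ℝ ∞ φ → HasCompactSupport φ → tsupport φ ⊆ B →
      ∃ l₀ ∈ Ioc (0 : ℝ) 1, ∃ K : Set E, IsCompact K ∧ K ⊆ B ∧ ∃ F : ℝ × E → ℝ, ContDiff ℝ ∞ F ∧
        (∀ l, tsupport (fun w => F (l, w)) ⊆ K) ∧
        (∀ l ∈ Ioc 0 l₀, ∀ w ∈ B, F (l, w) = |(fderiv ℝ f (scaling P l w)).det| *
          φ (scaling P l⁻¹ (f (scaling P l w)))) ∧
        ∀ l ∈ Ioc 0 l₀, ∀ z ∈ tsupport φ, scaling P l⁻¹ (g (scaling P l z)) ∈ B := by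
  have : CompleteSpace E := FiniteDimensional.complete ℝ E
  obtain ⟨f', hf', r₁, hr₁, hr₁O, hff'⟩ := exists_contDiff_eqOn_ball hO hf hyO
  obtain ⟨g', hg', r₂, hr₂, hr₂O, hgg'⟩ := exists_contDiff_eqOn_ball hO hg hyO
  have hfd : ∀ y ∈ Metric.ball y₀ r₁, fderiv ℝ f y = fderiv ℝ f' y := fun y hy =>
    (hff'.eventuallyEq_of_mem (Metric.isOpen_ball.mem_nhds hy)).fderiv_eq
  have hgd : ∀ y ∈ Metric.ball y₀ r₂, fderiv ℝ g y = fderiv ℝ g' y := fun y hy =>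
    (hgg'.eventuallyEq_of_mem (Metric.isOpen_ball.mem_nhds hy)).fderiv_eq
  obtain ⟨Rf, hRf, hRf0, hRfl⟩ := exists_rescaled_map hP hy₀ hS hf'
    (fun y hy hPy => by rw [← hff' hy]; exact hf0 y (hr₁O hy) hPy)
    (fun y hy hPy => by rw [← hfd y hy]; exact hf1 y (hr₁O hy) hPy)
  obtain ⟨Rg, hRg, hRg0, hRgl⟩ := exists_rescaled_map hP hy₀ hS hg'
    (fun y hy hPy => by rw [← hgg' hy]; exact hg0 y (hr₂O hy) hPy)
    (fun y hy hPy => by rw [← hgd y hy]; exact hg1 y (hr₂O hy) hPy)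
  have hdet0 : (fderiv ℝ f' y₀).det ≠ 0 := by
    have hfy : HasFDerivAt f (fderiv ℝ f y₀) y₀ :=
      ((hf.contDiffAt (hO.mem_nhds hyO)).differentiableAt (by simp)).hasFDerivAt
    have hgy : HasFDerivAt g (fderiv ℝ g y₀) (f y₀) := by
      rw [hf0 y₀ hyO hy₀]
      exact ((hg.contDiffAt (hO.mem_nhds hyO)).differentiableAt (by simp)).hasFDerivAt
    have h1 : HasFDerivAt id ((fderiv ℝ g y₀).comp (fderiv ℝ f y₀)) y₀ := by
      refine (hgy.comp y₀ hfy).congr_of_eventuallyEq ?_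
      filter_upwards [hO.mem_nhds hyO] with y hy using (hgf y hy).symm
    have h2 := h1.unique (hasFDerivAt_id y₀)
    rw [← hfd y₀ (Metric.mem_ball_self hr₁)]
    intro h3
    have h4 := congrArg (fun A : E →L[ℝ] E => A.det) h2
    have h5 : ((fderiv ℝ g y₀).comp (fderiv ℝ f y₀)).det =
        (fderiv ℝ g y₀).det * (fderiv ℝ f y₀).det := LinearMap.det_comp _ _
    have h6 : (ContinuousLinearMap.id ℝ E).det = 1 := LinearMap.det_id
    simp only [h5, h6, h3, mul_zero] at h4
    exact zero_ne_one h4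
  have hdetc : ContDiff ℝ ∞ fun y => (fderiv ℝ f' y).det :=
    contDiff_det.comp (hf'.fderiv_right (m := ∞) le_rfl)
  -- Near y₀ the Jacobian has constant sign ε, so its absolute value may be replaced by the smooth
  -- function ε det.
  obtain ⟨ε, hε⟩ : ∃ ε : ℝ, ∀ᶠ y in 𝓝 y₀, |(fderiv ℝ f' y).det| = ε * (fderiv ℝ f' y).det := by
    rcases lt_or_gt_of_ne hdet0 with h | h
    · refine ⟨-1, ?_⟩
      filter_upwards [hdetc.continuous.continuousAt.eventually_lt_const h] with y hy
      rw [abs_of_neg hy, neg_one_mul]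
    · refine ⟨1, ?_⟩
      filter_upwards [hdetc.continuous.continuousAt.eventually_const_lt h] with y hy
      rw [abs_of_pos hy, one_mul]
  obtain ⟨r₃, hr₃, hr₃ε⟩ := Metric.eventually_nhds_iff_ball.1 hε
  set r := min r₁ (min r₂ r₃) with hr_def
  have hrr₁ : Metric.ball y₀ r ⊆ Metric.ball y₀ r₁ := Metric.ball_subset_ball (min_le_left _ _)
  have hrr₂ : Metric.ball y₀ r ⊆ Metric.ball y₀ r₂ :=
    Metric.ball_subset_ball ((min_le_right _ _).trans (min_le_left _ _))
  have hrr₃ : Metric.ball y₀ r ⊆ Metric.ball y₀ r₃ :=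
    Metric.ball_subset_ball ((min_le_right _ _).trans (min_le_right _ _))
  refine ⟨r, by positivity, hrr₁.trans hr₁O, fun B hB hBr φ hφ hφc hφB => ?_⟩
  obtain ⟨K, hK, hφK, hKB⟩ := exists_compact_between hφc hB hφB
  obtain ⟨K₁, hK₁, hφK₁, hK₁K⟩ := exists_compact_between hφc isOpen_interior hφK
  obtain ⟨χ, hχ1, hχ0, -⟩ := exists_contMDiffMap_one_nhds_of_subset_interior (n := ⊤) 𝓘(ℝ, E)
    hK₁.isClosed hK₁K
  have hχ : ContDiff ℝ ∞ χ := χ.contMDiff.contDiff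
  -- At l = 0 the conjugated inverse map is the identity on the support of φ. By the tube lemma it
  -- still maps this support into K₁ for small l, so φ ∘ f_l vanishes on B outside K₁ and the cutoff
  -- χ changes nothing there.
  have htube : ({0} : Set ℝ) ×ˢ tsupport φ ⊆ Rg ⁻¹' interior K₁ := by
    rintro ⟨l, z⟩ ⟨hl, hz⟩
    rw [mem_singleton_iff] at hl
    subst hl
    change Rg (0, z) ∈ interior K₁
    rw [hRg0 z (hrr₂ (hBr (hφB hz)))]
    exact hφK₁ hz
  obtain ⟨u, w, hu, -, h0u, hφw, huw⟩ := generalized_tube_lemma isCompact_singleton hφc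
    (isOpen_interior.preimage hRg.continuous) htube
  obtain ⟨δ, hδ, hδu⟩ := Metric.isOpen_iff.1 hu 0 (h0u rfl)
  have hRgK : ∀ l ∈ Ioc 0 (min 1 (δ / 2)), ∀ z ∈ tsupport φ,
      scaling P l⁻¹ (g (scaling P l z)) ∈ K₁ := by
    intro l hl z hz
    have hlu : l ∈ u := hδu (by
      rw [mem_ball_zero_iff, Real.norm_of_nonneg hl.1.le]
      exact hl.2.trans_lt ((min_le_right _ _).trans_lt (by linarith)))
    have h1 : Rg (l, z) ∈ interior K₁ := huw ⟨hlu, hφw hz⟩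
    have hl1 : l ∈ Icc (0 : ℝ) 1 := ⟨hl.1.le, hl.2.trans (min_le_left _ _)⟩
    rw [hRgl l hl.1.ne' z (hrr₂ (hBr (hφB hz))),
      ← hgg' (scaling_mem_ball hy₀ hS hl1 (hrr₂ (hBr (hφB hz))))] at h1
    exact interior_subset h1
  refine ⟨min 1 (δ / 2), ⟨by positivity, min_le_left _ _⟩, K, hK, hKB,
    fun z => χ z.2 * (ε * (fderiv ℝ f' (scaling P z.1 z.2)).det * φ (Rf z)), ?_, ?_, ?_, ?_⟩
  · exact (hχ.comp contDiff_snd).mul ((contDiff_const.mul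
      (hdetc.comp (contDiff_scaling P))).mul (hφ.comp hRf))
  · intro l
    refine closure_minimal (fun w hw => ?_) hK.isClosed
    by_contra hwK
    exact hw (by simp [hχ0 w hwK])
  · intro l hl w hw
    have hl1 : l ∈ Icc (0 : ℝ) 1 := ⟨hl.1.le, hl.2.trans (min_le_left _ _)⟩
    have hlw := scaling_mem_ball hy₀ hS hl1 (hBr hw)
    have hRw : Rf (l, w) = scaling P l⁻¹ (f (scaling P l w)) := by
      rw [hRfl l hl.1.ne' w (hrr₁ (hBr hw)), ← hff' (hrr₁ hlw)]
    simp only [hRw, hfd _ (hrr₁ hlw), hr₃ε _ (hrr₃ hlw)]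
    by_cases hwK : w ∈ K₁
    · rw [hχ1.self_of_nhdsSet w hwK, one_mul]
    · have hz : φ (scaling P l⁻¹ (f (scaling P l w))) = 0 := by
        by_contra h
        have hz := hRgK l hl _ (subset_tsupport φ h)
        rw [scaling_scaling_inv hP hl.1.ne', hgf _ (hr₁O (hrr₁ hlw)),
          scaling_inv_scaling hP hl.1.ne'] at hz
        exact hwK hz
      rw [hz, mul_zero, mul_zero]
  · exact fun l hl z hz => hKB (interior_subset (hK₁K (hRgK l hl z hz)))

end Transition

/-! ### Test densities in different charts -/

section Densities

theorem tsupport_eq_zero {E : Type*} [TopologicalSpace E] {f : E → ℝ} {y : E}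
    (hy : y ∉ tsupport f) : f y = 0 := image_eq_zero_of_notMem_tsupport hy

theorem det_fderiv_mul_det_fderiv_symm {E : Type*} [NormedAddCommGroup E] [NormedSpace ℝ E]
    {T : OpenPartialHomeomorph E E} (hT : ContDiffOn ℝ ∞ T T.source)
    (hT' : ContDiffOn ℝ ∞ T.symm T.target) {y : E} (hy : y ∈ T.source) :
    (fderiv ℝ T.symm (T y)).det * (fderiv ℝ T y).det = 1 := by
  have h1 : HasFDerivAt T (fderiv ℝ T y) y :=
    ((hT.contDiffAt (T.open_source.mem_nhds hy)).differentiableAt (by simp)).hasFDerivAt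
  have h2 : HasFDerivAt T.symm (fderiv ℝ T.symm (T y)) (T y) :=
    ((hT'.contDiffAt (T.open_target.mem_nhds (T.map_source hy))).differentiableAt
      (by simp)).hasFDerivAt
  have h3 : HasFDerivAt id ((fderiv ℝ T.symm (T y)).comp (fderiv ℝ T y)) y := by
    refine (h2.comp y h1).congr_of_eventuallyEq ?_
    filter_upwards [T.open_source.mem_nhds hy] with z hz using (T.left_inv hz).symm
  have h4 := congrArg (fun A : E →L[ℝ] E => A.det) (h3.unique (hasFDerivAt_id y))
  have h5 : ((fderiv ℝ T.symm (T y)).comp (fderiv ℝ T y)).det =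
      (fderiv ℝ T.symm (T y)).det * (fderiv ℝ T y).det := LinearMap.det_comp _ _
  have h6 : (ContinuousLinearMap.id ℝ E).det = 1 := LinearMap.det_id
  rw [← h5, ← h6]
  exact h4

/-- The push-forward of a smooth density supported in the domain of a diffeomorphism. -/
theorem exists_density_pushforward {E : Type*} [NormedAddCommGroup E] [NormedSpace ℝ E]
    [FiniteDimensional ℝ E] {T : OpenPartialHomeomorph E E} (hT : ContDiffOn ℝ ∞ T T.source)
    (hT' : ContDiffOn ℝ ∞ T.symm T.target) {f : E → ℝ} (hf : ContDiff ℝ ∞ f)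
    (hfc : HasCompactSupport f) (hfT : tsupport f ⊆ T.source) :
    ∃ g : E → ℝ, ContDiff ℝ ∞ g ∧ HasCompactSupport g ∧ tsupport g ⊆ T '' tsupport f ∧
      ∀ y ∈ T.source, f y = |(fderiv ℝ T y).det| * g (T y) := by
  classical
  set g : E → ℝ := fun z => if z ∈ T.target then
    |(fderiv ℝ T.symm z).det| * f (T.symm z) else 0 with hg
  have hK : IsCompact (T '' tsupport f) := hfc.image_of_continuousOn (T.continuousOn.mono hfT)
  have hg0 : ∀ z ∉ T '' tsupport f, g z = 0 := by
    intro z hz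
    by_cases hzT : z ∈ T.target
    · have : f (T.symm z) = 0 := tsupport_eq_zero fun h => hz ⟨_, h, T.right_inv hzT⟩
      simp [hg, this]
    · simp [hg, hzT]
  have hsupp : tsupport g ⊆ T '' tsupport f :=
    closure_minimal (fun z hz => by_contra fun h => hz (hg0 z h)) hK.isClosed
  refine ⟨g, ?_, hK.of_isClosed_subset (isClosed_tsupport g) hsupp, hsupp, fun y hy => ?_⟩
  · rw [contDiff_iff_contDiffAt]
    intro z
    by_cases hz : z ∈ T '' tsupport f
    · have hzT : z ∈ T.target := by
        obtain ⟨y, hy, rfl⟩ := hz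
        exact T.map_source (hfT hy)
      have hsm : ContDiffAt ℝ ∞ T.symm z := hT'.contDiffAt (T.open_target.mem_nhds hzT)
      have hdet : ContDiffAt ℝ ∞ (fun z => (fderiv ℝ T.symm z).det) z :=
        contDiff_det.contDiffAt.comp z (hsm.fderiv_right (m := ∞) le_rfl)
      have hne : (fderiv ℝ T.symm z).det ≠ 0 := by
        have := det_fderiv_mul_det_fderiv_symm hT hT' (T.map_target hzT)
        rw [T.right_inv hzT] at this
        exact left_ne_zero_of_mul_eq_one this
      have habs : ContDiffAt ℝ ∞ (fun z => |(fderiv ℝ T.symm z).det|) z :=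
        ContDiffAt.comp (g := abs) z (contDiffAt_abs hne) hdet
      refine (habs.mul (hf.contDiffAt.comp z hsm)).congr_of_eventuallyEq ?_
      filter_upwards [T.open_target.mem_nhds hzT] with w hw
      simp [hg, hw]
    · refine (contDiffAt_const (c := (0 : ℝ))).congr_of_eventuallyEq ?_
      filter_upwards [hK.isClosed.isOpen_compl.mem_nhds hz] with w hw using hg0 w hw
  · have h1 := det_fderiv_mul_det_fderiv_symm hT hT' hy
    simp only [hg, T.map_source hy, if_true, T.left_inv hy]
    rw [← mul_assoc, ← abs_mul, mul_comm (fderiv ℝ T y).det, h1, abs_one, one_mul]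

variable {m : ℕ} {M M' : Type*} [TopologicalSpace M] [ChartedSpace (EuclideanSpace ℝ (Fin m)) M]
  [TopologicalSpace M'] [ChartedSpace (EuclideanSpace ℝ (Fin m)) M']

theorem contDiffOn_transition (κ₁ κ₂ : Chart m M) :
    ContDiffOn ℝ ∞ (κ₁.1.symm.trans κ₂.1) (κ₁.1.symm.trans κ₂.1).source := by
  rw [← contMDiffOn_iff_contDiffOn]
  exact (contMDiffOn_of_mem_maximalAtlas κ₂.2).comp
    ((contMDiffOn_symm_of_mem_maximalAtlas κ₁.2).mono inter_subset_left) inter_subset_right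

/-- A test density supported in a common open subset of two charts, written in the other chart. -/
theorem exists_sameDensity (κ₁ κ₂ : Chart m M) {V : Opens M} (f : 𝓓(chartImage κ₁.1 V, ℝ))
    (hf : ∀ y ∈ tsupport f, κ₁.1.symm y ∈ κ₂.1.source) :
    ∃ g : 𝓓(chartImage κ₂.1 V, ℝ), SameDensity κ₁.1 κ₂.1 f g := by
  have hfT : tsupport f ⊆ (κ₁.1.symm.trans κ₂.1).source := fun y hy =>
    ⟨(f.tsupport_subset hy).1, hf y hy⟩
  obtain ⟨g, hg, hgc, hgs, hfg⟩ := exists_density_pushforward (contDiffOn_transition κ₁ κ₂)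
    (by simpa using contDiffOn_transition κ₂ κ₁) f.contDiff f.hasCompactSupport hfT
  have hsupp : ∀ z ∈ tsupport g, ∃ y ∈ tsupport f, κ₂.1 (κ₁.1.symm y) = z := fun z hz => hgs hz
  refine ⟨⟨g, hg, hgc, fun z hz => ?_⟩, hfT, fun z hz => ?_, fun y hy => hfg y hy⟩
  · obtain ⟨y, hy, rfl⟩ := hsupp z hz
    refine ⟨κ₂.1.map_source (hf y hy), ?_⟩
    change κ₂.1.symm (κ₂.1 (κ₁.1.symm y)) ∈ V
    rw [κ₂.1.left_inv (hf y hy)]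
    exact (f.tsupport_subset hy).2
  · obtain ⟨y, hy, rfl⟩ := hsupp z hz
    refine ⟨κ₂.1.map_source (hf y hy), ?_⟩
    change κ₂.1.symm (κ₂.1 (κ₁.1.symm y)) ∈ κ₁.1.source
    rw [κ₂.1.left_inv (hf y hy)]
    exact κ₁.1.map_target (f.tsupport_subset hy).1

omit [ChartedSpace (EuclideanSpace ℝ (Fin m)) M] in
-- Near the support the transition map is the identity, with Jacobian one; away from N both sides
-- vanish, by injectivity of `α.symm`. This is how composed pullbacks are compared: only the inverse
-- charts need to agree.
theorem sameDensity_self_of_eqOn {α β : OpenPartialHomeomorph M (EuclideanSpace ℝ (Fin m))}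
    {f : EuclideanSpace ℝ (Fin m) → ℝ} {N : Set (EuclideanSpace ℝ (Fin m))} (hN : IsOpen N)
    (hf : tsupport f ⊆ N) (hα : N ⊆ α.target) (hβ : N ⊆ β.target)
    (h : ∀ y ∈ N, α.symm y = β.symm y) : SameDensity α β f f := by
  refine ⟨fun y hy => ⟨hα (hf hy), ?_⟩, fun y hy => ⟨hβ (hf hy), ?_⟩, fun y hy => ?_⟩
  · change α.symm y ∈ β.source
    rw [h y (hf hy)]
    exact β.map_target (hβ (hf hy))
  · change β.symm y ∈ α.source
    rw [← h y (hf hy)]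
    exact α.map_target (hα (hf hy))
  · by_cases hyN : y ∈ N
    · have hE : β ∘ α.symm =ᶠ[𝓝 y] id := by
        filter_upwards [hN.mem_nhds hyN] with z hz
        simp [h z hz, β.right_inv (hβ hz)]
      rw [hE.fderiv_eq, fderiv_id, h y hyN, β.right_inv (hβ hyN)]
      have h6 : (ContinuousLinearMap.id ℝ (EuclideanSpace ℝ (Fin m))).det = 1 := LinearMap.det_id
      rw [h6, abs_one, one_mul]
    · have h0 : f y = 0 := tsupport_eq_zero fun h' => hyN (hf h')
      have h1 : f (β (α.symm y)) = 0 := by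
        refine tsupport_eq_zero fun h' => hyN ?_
        have h2 : α.symm (β (α.symm y)) = α.symm y := by
          rw [h _ (hf h'), β.left_inv hy.2]
        rw [← α.symm.injOn (hα (hf h')) hy.1 h2]
        exact hf h'
      rw [h0, h1, mul_zero]

end Densities

/-! ### Vector fields and diffeomorphisms -/

section Fields

variable {m : ℕ} {M M' : Type*} [TopologicalSpace M] [ChartedSpace (EuclideanSpace ℝ (Fin m)) M]
  [IsManifold (𝓡 m) ∞ M]
  [TopologicalSpace M'] [ChartedSpace (EuclideanSpace ℝ (Fin m)) M'] [IsManifold (𝓡 m) ∞ M']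

/-- A chart as a diffeomorphism from an open subset of `M` onto an open subset of `ℝ^m`. -/
def chartDiffeo {m : ℕ} {M : Type*} [TopologicalSpace M]
    [ChartedSpace (EuclideanSpace ℝ (Fin m)) M] (κ : Chart m M) :
    PartialDiffeomorph (𝓡 m) (𝓡 m) M (EuclideanSpace ℝ (Fin m)) ∞ where
  toPartialEquiv := κ.1.toPartialEquiv
  open_source := κ.1.open_source
  open_target := κ.1.open_target
  contMDiffOn_toFun := contMDiffOn_of_mem_maximalAtlas κ.2
  contMDiffOn_invFun := contMDiffOn_symm_of_mem_maximalAtlas κ.2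

/-- The pullback of a vector field under a diffeomorphism. -/
def pullField {m : ℕ} {M M' : Type*} [TopologicalSpace M]
    [ChartedSpace (EuclideanSpace ℝ (Fin m)) M]
    [TopologicalSpace M'] [ChartedSpace (EuclideanSpace ℝ (Fin m)) M']
    (Φ : PartialDiffeomorph (𝓡 m) (𝓡 m) M M' ∞)
    (ρ : (x : M') → TangentSpace (𝓡 m) x) : (x : M) → TangentSpace (𝓡 m) x :=
  VectorField.mpullback (𝓡 m) (𝓡 m) Φ ρ

omit [IsManifold (𝓡 m) ∞ M] [IsManifold (𝓡 m) ∞ M'] in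
theorem isInvertible_mfderiv (Φ : PartialDiffeomorph (𝓡 m) (𝓡 m) M M' ∞) {x : M}
    (hx : x ∈ Φ.source) : (mfderiv (𝓡 m) (𝓡 m) Φ x).IsInvertible := by
  have he : Φ.toOpenPartialHomeomorph.MDifferentiable (𝓡 m) (𝓡 m) :=
    ⟨Φ.contMDiffOn.mdifferentiableOn (by simp), Φ.symm.contMDiffOn.mdifferentiableOn (by simp)⟩
  exact ⟨he.mfderiv hx, rfl⟩

omit [IsManifold (𝓡 m) ∞ M] [IsManifold (𝓡 m) ∞ M'] in
theorem mfderiv_pullField (Φ : PartialDiffeomorph (𝓡 m) (𝓡 m) M M' ∞)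
    (ρ : (x : M') → TangentSpace (𝓡 m) x) {x : M} (hx : x ∈ Φ.source) :
    mfderiv (𝓡 m) (𝓡 m) Φ x (pullField Φ ρ x) = ρ (Φ x) :=
  (isInvertible_mfderiv Φ hx).self_apply_inverse _

theorem contMDiffOn_pullField (Φ : PartialDiffeomorph (𝓡 m) (𝓡 m) M M' ∞)
    {ρ : (x : M') → TangentSpace (𝓡 m) x} {O : Set M'} (hO : IsOpen O)
    (hρ : ContMDiffOn (𝓡 m) (𝓡 m).tangent ∞
      (fun x => (⟨x, ρ x⟩ : TangentBundle (𝓡 m) M')) O) :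
    ContMDiffOn (𝓡 m) (𝓡 m).tangent ∞
      (fun x => (⟨x, pullField Φ ρ x⟩ : TangentBundle (𝓡 m) M)) (Φ.source ∩ Φ ⁻¹' O) := by
  intro x hx
  refine ContMDiffAt.contMDiffWithinAt ?_
  exact ContMDiffAt.mpullback_vectorField_preimage (n := ∞)
    ((hρ _ hx.2).contMDiffAt (hO.mem_nhds hx.2))
    ((Φ.contMDiffOn x hx.1).contMDiffAt (Φ.open_source.mem_nhds hx.1))
    (isInvertible_mfderiv Φ hx.1) le_rfl

omit [IsManifold (𝓡 m) ∞ M] [IsManifold (𝓡 m) ∞ M'] in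
theorem lieDeriv_pullField (Φ : PartialDiffeomorph (𝓡 m) (𝓡 m) M M' ∞)
    (ρ : (x : M') → TangentSpace (𝓡 m) x) {x : M} (hx : x ∈ Φ.source) {f : M' → ℝ}
    (hf : MDifferentiableAt (𝓡 m) 𝓘(ℝ, ℝ) f (Φ x)) :
    lieDeriv (pullField Φ ρ) (f ∘ Φ) x = lieDeriv ρ f (Φ x) := by
  have h := mfderiv_comp x hf (Φ.mdifferentiableAt (by simp) hx)
  unfold lieDeriv
  rw [h]
  change mfderiv (𝓡 m) 𝓘(ℝ, ℝ) f (Φ x) (mfderiv (𝓡 m) (𝓡 m) Φ x (pullField Φ ρ x)) = _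
  rw [mfderiv_pullField Φ ρ hx]

/-- The expression of a vector field in a chart. -/
def coordField {m : ℕ} {M : Type*} [TopologicalSpace M]
    [ChartedSpace (EuclideanSpace ℝ (Fin m)) M] (κ : Chart m M)
    (ρ : (x : M) → TangentSpace (𝓡 m) x) (y : EuclideanSpace ℝ (Fin m)) :
    EuclideanSpace ℝ (Fin m) :=
  pullField (chartDiffeo κ).symm ρ y

omit [IsManifold (𝓡 m) ∞ M] in
theorem mfderiv_symm_coordField (κ : Chart m M) (ρ : (x : M) → TangentSpace (𝓡 m) x)
    {y : EuclideanSpace ℝ (Fin m)} (hy : y ∈ κ.1.target) :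
    mfderiv (𝓡 m) (𝓡 m) κ.1.symm y (coordField κ ρ y) = ρ (κ.1.symm y) :=
  mfderiv_pullField (chartDiffeo κ).symm ρ hy

theorem contDiffOn_coordField (κ : Chart m M) {ρ : (x : M) → TangentSpace (𝓡 m) x} {Ω : Opens M}
    (hρ : ContMDiffOn (𝓡 m) (𝓡 m).tangent ∞
      (fun x => (⟨x, ρ x⟩ : TangentBundle (𝓡 m) M)) Ω) :
    ContDiffOn ℝ ∞ (coordField κ ρ) (chartImage κ.1 Ω) :=
  contMDiffOn_vectorSpace_iff_contDiffOn.1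
    (contMDiffOn_pullField (chartDiffeo κ).symm Ω.isOpen hρ)

omit [IsManifold (𝓡 m) ∞ M] in
theorem lieDeriv_symm_apply (κ : Chart m M) (ρ : (x : M) → TangentSpace (𝓡 m) x)
    {y : EuclideanSpace ℝ (Fin m)} (hy : y ∈ κ.1.target) {f : M → ℝ}
    (hf : MDifferentiableAt (𝓡 m) 𝓘(ℝ, ℝ) f (κ.1.symm y)) :
    lieDeriv ρ f (κ.1.symm y) = fderiv ℝ (f ∘ κ.1.symm) y (coordField κ ρ y) := by
  have h := lieDeriv_pullField (chartDiffeo κ).symm ρ hy hf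
  rw [← mfderiv_eq_fderiv]
  exact h.symm

omit [IsManifold (𝓡 m) ∞ M] in
theorem contDiffOn_comp_symm (κ : Chart m M) {Ω : Opens M} {f : M → ℝ}
    (hf : ContMDiffOn (𝓡 m) 𝓘(ℝ, ℝ) ∞ f Ω) :
    ContDiffOn ℝ ∞ (f ∘ κ.1.symm) (chartImage κ.1 Ω) := by
  rw [← contMDiffOn_iff_contDiffOn]
  exact hf.comp ((contMDiffOn_symm_of_mem_maximalAtlas κ.2).mono inter_subset_left)
    inter_subset_right

theorem contMDiffOn_lieDeriv {ρ : (x : M) → TangentSpace (𝓡 m) x} {Ω : Opens M}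
    (hρ : ContMDiffOn (𝓡 m) (𝓡 m).tangent ∞
      (fun x => (⟨x, ρ x⟩ : TangentBundle (𝓡 m) M)) Ω) {f : M → ℝ}
    (hf : ContMDiffOn (𝓡 m) 𝓘(ℝ, ℝ) ∞ f Ω) :
    ContMDiffOn (𝓡 m) 𝓘(ℝ, ℝ) ∞ (lieDeriv ρ f) Ω := by
  intro x hx
  refine ContMDiffAt.contMDiffWithinAt ?_
  let κ : Chart m M := ⟨chartAt _ x, IsManifold.chart_mem_maximalAtlas x⟩
  have hxκ : x ∈ κ.1.source := mem_chart_source _ x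
  have hO : IsOpen ((chartImage κ.1 Ω : Opens _) : Set (EuclideanSpace ℝ (Fin m))) :=
    (chartImage κ.1 Ω).isOpen
  have hxO : κ.1 x ∈ (chartImage κ.1 Ω : Set (EuclideanSpace ℝ (Fin m))) :=
    ⟨κ.1.map_source hxκ, by rw [mem_preimage, κ.1.left_inv hxκ]; exact hx⟩
  have h1 : ContDiffAt ℝ ∞ (fun y => fderiv ℝ (f ∘ κ.1.symm) y (coordField κ ρ y)) (κ.1 x) :=
    (((contDiffOn_comp_symm κ hf).contDiffAt (hO.mem_nhds hxO)).fderiv_right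
      (m := ∞) le_rfl).clm_apply ((contDiffOn_coordField κ hρ).contDiffAt (hO.mem_nhds hxO))
  refine (h1.contMDiffAt.comp x (contMDiffAt_of_mem_maximalAtlas κ.2 hxκ)).congr_of_eventuallyEq ?_
  filter_upwards [κ.1.open_source.mem_nhds hxκ, Ω.isOpen.mem_nhds hx] with z hz hzΩ
  have h2 := lieDeriv_symm_apply κ ρ (κ.1.map_source hz) (f := f) (by
    rw [κ.1.left_inv hz]
    exact (hf.contMDiffAt (Ω.isOpen.mem_nhds hzΩ)).mdifferentiableAt (by simp))
  rw [κ.1.left_inv hz] at h2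
  exact h2

end Fields

/-! ### Euler vector fields in adapted charts -/

section NormalProjection

/-- The projection of `ℝ^m` onto the last `m - n` coordinates. -/
def normalProj (m n : ℕ) : EuclideanSpace ℝ (Fin m) →L[ℝ] EuclideanSpace ℝ (Fin m) :=
  LinearMap.toContinuousLinearMap
    { toFun := fun y => WithLp.toLp 2 fun j => if n ≤ j.val then y j else 0
      map_add' := fun y z => by ext j; by_cases h : n ≤ j.val <;> simp [h]
      map_smul' := fun c y => by ext j; by_cases h : n ≤ j.val <;> simp [h] }

theorem normalProj_apply {m n : ℕ} (y : EuclideanSpace ℝ (Fin m)) (j : Fin m) :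
    normalProj m n y j = if n ≤ j.val then y j else 0 := rfl

theorem normalProj_normalProj {m n : ℕ} (y : EuclideanSpace ℝ (Fin m)) :
    normalProj m n (normalProj m n y) = normalProj m n y := by
  ext j
  by_cases h : n ≤ j.val <;> simp [normalProj_apply, h]

theorem normalProj_eq_zero_iff {m n : ℕ} {y : EuclideanSpace ℝ (Fin m)} :
    normalProj m n y = 0 ↔ ∀ j : Fin m, n ≤ j.val → y j = 0 := by
  constructor
  · intro h j hj
    have := congrArg (fun z : EuclideanSpace ℝ (Fin m) => z j) h
    simpa [normalProj_apply, hj] using this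
  · intro h
    ext j
    by_cases hj : n ≤ j.val <;> simp [normalProj_apply, hj]
    exact h j hj

/-- Each coordinate is kept or shrunk. Consequently balls about points with vanishing normal part
are stable under scaling. -/
theorem norm_scaling_normalProj_le {m n : ℕ} {l : ℝ} (hl : l ∈ Icc (0 : ℝ) 1)
    (y : EuclideanSpace ℝ (Fin m)) : ‖scaling (normalProj m n) l y‖ ≤ ‖y‖ := by
  rw [EuclideanSpace.norm_eq, EuclideanSpace.norm_eq]
  refine Real.sqrt_le_sqrt (Finset.sum_le_sum fun j _ => ?_)
  refine pow_le_pow_left₀ (norm_nonneg _) ?_ 2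
  by_cases hj : n ≤ j.val
  · have : scaling (normalProj m n) l y j = l * y j := by
      simp [scaling_apply, normalProj_apply, hj]
    rw [this, norm_mul, Real.norm_of_nonneg hl.1]
    exact mul_le_of_le_one_left (norm_nonneg _) hl.2
  · have : scaling (normalProj m n) l y j = y j := by
      simp [scaling_apply, normalProj_apply, hj]
    rw [this]

end NormalProjection

/-! ### Hadamard's lemma relative to a linear subspace. -/

section Hadamard

universe u
variable {E : Type u} [NormedAddCommGroup E] [NormedSpace ℝ E]

/-- The segment τ ↦ S_τ y depends linearly on y, so the integral is a linear map after a
superposition operator after a linear map; no differentiation under the integral sign occurs. -/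
theorem contDiff_integral_fderiv_scaling (P : E →L[ℝ] E) {f : E → ℝ} (hf : ContDiff ℝ ∞ f) :
    ContDiff ℝ ∞ fun y => ∫ τ in (0 : ℝ)..1, fderiv ℝ f (scaling P τ y) := by
  have hdf : ContDiff ℝ ∞ (fderiv ℝ f) := hf.fderiv_right (m := ∞) le_rfl
  let d : C(E, E →L[ℝ] ℝ) := ⟨fderiv ℝ f, hdf.continuous⟩
  let line : E →L[ℝ] C(unitInterval, E) := LinearMap.mkContinuous
    { toFun := fun y => ⟨fun θ => scaling P θ y, by simp only [scaling_apply]; fun_prop⟩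
      map_add' := fun y z => by ext θ; simp
      map_smul' := fun c y => by ext θ; simp } (1 + ‖P‖ + ‖P‖) (fun y => by
        refine (ContinuousMap.norm_le _ (by positivity)).2 fun θ => ?_
        change ‖scaling P θ y‖ ≤ _
        rw [scaling_apply]
        have h1 : ‖(θ : ℝ) • P y‖ ≤ ‖P‖ * ‖y‖ := by
          rw [norm_smul, Real.norm_of_nonneg θ.2.1]
          exact (mul_le_of_le_one_left (norm_nonneg _) θ.2.2).trans (P.le_opNorm y)
        calc ‖y - P y + (θ : ℝ) • P y‖ ≤ ‖y‖ + ‖P y‖ + ‖(θ : ℝ) • P y‖ :=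
              (norm_add_le _ _).trans (by gcongr; exact norm_sub_le _ _)
          _ ≤ ‖y‖ + ‖P‖ * ‖y‖ + ‖P‖ * ‖y‖ := by gcongr; exact P.le_opNorm y
          _ = _ := by ring)
  have hq : ∀ y : E, primitive (E →L[ℝ] ℝ) (d.comp (line y)) 1 =
      ∫ τ in (0 : ℝ)..1, fderiv ℝ f (scaling P τ y) := by
    intro y
    rw [primitive_apply]
    refine intervalIntegral.integral_congr fun τ hτ => ?_
    have hτ' : τ ∈ Icc (0 : ℝ) 1 := by simpa using hτ
    change (d.comp (line y)) (projIcc 0 1 zero_le_one τ) = _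
    rw [projIcc_of_mem zero_le_one hτ']; rfl
  simp only [← hq]
  exact ((ContinuousMap.evalCLM ℝ (1 : unitInterval)).comp (primitive _)).contDiff.comp
      ((contDiff_comp_left d hdf).comp line.contDiff)

/-- Hadamard's lemma on a ball centred at a point of `ker P`. -/
theorem exists_hadamard_quotient [FiniteDimensional ℝ E] {P : E →L[ℝ] E} {y₀ : E}
    (hy₀ : P y₀ = 0)
    (hS : ∀ l ∈ Icc (0 : ℝ) 1, ∀ y, ‖scaling P l y‖ ≤ ‖y‖) {r : ℝ} {f : E → ℝ}
    (hf : ContDiffOn ℝ ∞ f (Metric.ball y₀ r)) :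
    ∃ g : E → E →L[ℝ] ℝ, ContDiffOn ℝ ∞ g (Metric.ball y₀ r) ∧
      ∀ y ∈ Metric.ball y₀ r, f y = f (scaling P 0 y) + g y (P y) := by
  refine ⟨fun y => ∫ τ in (0 : ℝ)..1, fderiv ℝ f (scaling P τ y), fun y hy => ?_, fun y hy => ?_⟩
  · refine ContDiffAt.contDiffWithinAt ?_
    have hd : dist y y₀ < r := hy
    have hd0 : 0 ≤ dist y y₀ := dist_nonneg
    -- Smoothness is checked at one point y. The two radii lie between dist y y₀ and r; scalings
    -- preserve balls about y₀, so cutting f off does not change the integral near y.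
    let b : ContDiffBump y₀ := ⟨(2 * dist y y₀ + r) / 3, (dist y y₀ + 2 * r) / 3,
      by linarith, by linarith⟩
    have hg : ContDiff ℝ ∞ fun x => b x * f x := by
      rw [contDiff_iff_contDiffAt]
      intro x
      by_cases hx : x ∈ Metric.closedBall y₀ ((dist y y₀ + 2 * r) / 3)
      · exact b.contDiff.contDiffAt.mul (hf.contDiffAt (Metric.isOpen_ball.mem_nhds
          (Metric.closedBall_subset_ball (by linarith) hx)))
      · refine (contDiffAt_const (c := (0 : ℝ))).congr_of_eventuallyEq ?_
        filter_upwards [Metric.isClosed_closedBall.isOpen_compl.mem_nhds hx] with z hz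
        have hz' : ¬ dist z y₀ ≤ (dist y y₀ + 2 * r) / 3 := hz
        have : b z = 0 := b.zero_of_le_dist (not_le.1 hz').le
        simp [this]
    refine (contDiff_integral_fderiv_scaling P hg).contDiffAt.congr_of_eventuallyEq ?_
    have hyb : y ∈ Metric.ball y₀ ((2 * dist y y₀ + r) / 3) := by
      rw [Metric.mem_ball]; linarith
    filter_upwards [Metric.isOpen_ball.mem_nhds hyb] with z hz
    refine intervalIntegral.integral_congr fun τ hτ => ?_
    have hτ' : τ ∈ Icc (0 : ℝ) 1 := by simpa using hτ
    refine Filter.EventuallyEq.fderiv_eq ?_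
    filter_upwards [Metric.isOpen_ball.mem_nhds (scaling_mem_ball hy₀ hS hτ' hz)] with w hw
    rw [b.one_of_mem_closedBall (Metric.ball_subset_closedBall hw), one_mul]
  · have hm : ∀ τ ∈ Icc (0 : ℝ) 1, scaling P τ y ∈ Metric.ball y₀ r := fun τ hτ =>
      scaling_mem_ball hy₀ hS hτ hy
    have hcs : Continuous fun τ : ℝ => scaling P τ y := by
      simp only [scaling_apply]; fun_prop
    have hc : ContinuousOn (fun τ : ℝ => fderiv ℝ f (scaling P τ y)) (Icc 0 1) :=
      (hf.continuousOn_fderiv_of_isOpen Metric.isOpen_ball (by simp)).comp hcs.continuousOn hm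
    have hd : ∀ τ ∈ uIcc (0 : ℝ) 1, HasDerivAt (fun τ : ℝ => f (scaling P τ y))
        (fderiv ℝ f (scaling P τ y) (P y)) τ := by
      intro τ hτ
      have hd2 : HasDerivAt (fun l : ℝ => scaling P l y) (P y) τ := by
        simp only [scaling_apply]
        simpa using ((hasDerivAt_id τ).smul_const (P y)).const_add (y - P y)
      exact ((hf.contDiffAt (Metric.isOpen_ball.mem_nhds (hm τ (by simpa using hτ)))).differentiableAt
        (by simp)).hasFDerivAt.comp_hasDerivAt τ hd2
    have hI : IntervalIntegrable (fun τ : ℝ => fderiv ℝ f (scaling P τ y)) MeasureTheory.volume 0 1 :=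
      ContinuousOn.intervalIntegrable (by simpa using hc)
    have h1 := intervalIntegral.integral_eq_sub_of_hasDerivAt hd
      (((ContinuousLinearMap.apply ℝ ℝ (P y)).continuous.comp_continuousOn
        (by simpa using hc)).intervalIntegrable)
    rw [ContinuousLinearMap.intervalIntegral_apply hI, h1, scaling_one]
    simp

end Hadamard

/-! ### The linear Euler field of an adapted chart. -/

section EulerFields

variable {m n : ℕ} {M : Type*} [TopologicalSpace M] [ChartedSpace (EuclideanSpace ℝ (Fin m)) M]
  [IsManifold (𝓡 m) ∞ M]

omit [IsManifold (𝓡 m) ∞ M] in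
theorem coordField_pullField (κ : Chart m M)
    (v : EuclideanSpace ℝ (Fin m) → EuclideanSpace ℝ (Fin m))
    {y : EuclideanSpace ℝ (Fin m)} (hy : y ∈ κ.1.target) :
    coordField κ (pullField (chartDiffeo κ) v) y = v y := by
  have he : κ.1.MDifferentiable (𝓡 m) (𝓡 m) :=
    ⟨(chartDiffeo κ).contMDiffOn.mdifferentiableOn (by simp),
      (chartDiffeo κ).symm.contMDiffOn.mdifferentiableOn (by simp)⟩
  have h1 := mfderiv_symm_coordField κ (pullField (chartDiffeo κ) v) hy
  have h2 := mfderiv_pullField (chartDiffeo κ) v (κ.1.map_target hy)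
  have h3 := congrArg (fun A => A (coordField κ (pullField (chartDiffeo κ) v) y))
    (he.comp_symm_deriv hy)
  change mfderiv (𝓡 m) (𝓡 m) κ.1 (κ.1.symm y) (mfderiv (𝓡 m) (𝓡 m) κ.1.symm y
    (coordField κ (pullField (chartDiffeo κ) v) y)) = coordField κ (pullField (chartDiffeo κ) v) y
    at h3
  rw [h1] at h3
  rw [← h3]
  refine h2.trans ?_
  change v (κ.1 (κ.1.symm y)) = v y
  rw [κ.1.right_inv hy]

/-- The chart `κ` maps `I` to the linear subspace of `ℝ^m` on which the last `m - n` coordinates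
vanish. -/
def IsAdapted {m : ℕ} {M : Type*} [TopologicalSpace M] (n : ℕ) (I : Set M)
    (κ : OpenPartialHomeomorph M (EuclideanSpace ℝ (Fin m))) : Prop :=
  ∀ q ∈ κ.source, q ∈ I ↔ normalProj m n (κ q) = 0

omit [ChartedSpace (EuclideanSpace ℝ (Fin m)) M] [IsManifold (𝓡 m) ∞ M] in
theorem IsAdapted.symm_mem_iff {I : Set M} {κ : OpenPartialHomeomorph M (EuclideanSpace ℝ (Fin m))}
    (h : IsAdapted n I κ) {y : EuclideanSpace ℝ (Fin m)} (hy : y ∈ κ.target) :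
    κ.symm y ∈ I ↔ normalProj m n y = 0 := by
  rw [h _ (κ.map_target hy), κ.right_inv hy]

/-- The linear Euler vector field in an adapted chart onto a ball. -/
theorem isEuler_pullField_normalProj {I : Set M} (κ : Chart m M) (hI : IsAdapted n I κ.1)
    {y₀ : EuclideanSpace ℝ (Fin m)} {r : ℝ} (hκ : κ.1.target = Metric.ball y₀ r)
    (hy₀ : normalProj m n y₀ = 0) :
    IsEuler I ⟨κ.1.source, κ.1.open_source⟩
      (pullField (chartDiffeo κ) fun y => normalProj m n y) := by
  set P := normalProj m n with hPdef
  have hsm : ContMDiffOn (𝓡 m) (𝓡 m) ∞ κ.1 κ.1.source := contMDiffOn_of_mem_maximalAtlas κ.2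
  have hmaps : MapsTo κ.1 κ.1.source (Metric.ball y₀ r) := hκ ▸ κ.1.mapsTo
  refine ⟨?_, fun f hf => ?_⟩
  · have h := contMDiffOn_pullField (chartDiffeo κ) (ρ := fun y => P y) isOpen_univ
      (contMDiffOn_vectorSpace_iff_contDiffOn.2 P.contDiff.contDiffOn)
    exact h.mono fun x hx => ⟨hx, mem_univ _⟩
  have hF : ContDiffOn ℝ ∞ (f ∘ κ.1.symm) (Metric.ball y₀ r) := by
    refine (contDiffOn_comp_symm κ hf.1).mono fun y hy => ?_
    rw [← hκ] at hy
    exact ⟨hy, κ.1.map_target hy⟩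
  obtain ⟨g, hg, hFg⟩ := exists_hadamard_quotient hy₀
    (fun l hl y => norm_scaling_normalProj_le hl y) hF
  have hFg' : ∀ y ∈ Metric.ball y₀ r, (f ∘ κ.1.symm) y = g y (P y) := by
    intro y hy
    have h0 : scaling P 0 y ∈ κ.1.target := by
      rw [hκ]
      exact scaling_mem_ball hy₀ (fun l hl y => norm_scaling_normalProj_le hl y)
        ⟨le_rfl, zero_le_one⟩ hy
    have h1 : P (scaling P 0 y) = 0 := by
      rw [apply_scaling normalProj_normalProj, zero_smul]
    have h2 : f (κ.1.symm (scaling P 0 y)) = 0 :=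
      hf.2 _ ⟨(hI.symm_mem_iff h0).2 h1, κ.1.map_target h0⟩
    rw [hFg y hy, Function.comp_apply, h2, zero_add]
  let e : Fin m → EuclideanSpace ℝ (Fin m) := fun j => EuclideanSpace.single j 1
  have hsum : ∀ (A : EuclideanSpace ℝ (Fin m) →L[ℝ] ℝ) (w : EuclideanSpace ℝ (Fin m)),
      A w = ∑ j, w j * A (e j) := by
    intro A w
    have hw : w = ∑ j, w j • e j := by
      ext i
      simp [e, Finset.sum_apply, Pi.single_apply]
    conv_lhs => rw [hw]
    simp
  have hdg : ContDiffOn ℝ ∞ (fun y => fderiv ℝ g y (P y)) (Metric.ball y₀ r) :=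
    (hg.fderiv_of_isOpen Metric.isOpen_ball (m := ∞) le_rfl).clm_apply P.contDiff.contDiffOn
  -- With f = g(y)(P y) in the chart, the derivative along P y is Dg(y)(P y)(P y) + f. The first
  -- term, expanded in the standard basis, is a sum of products whose factors both vanish where P y
  -- = 0.
  refine ⟨m, fun j q => P (κ.1 q) j, fun j q => fderiv ℝ g (κ.1 q) (P (κ.1 q)) (e j),
    fun j => ⟨⟨?_, ?_⟩, ⟨?_, ?_⟩⟩, fun q hq => ?_⟩
  · have h1 : ContDiff ℝ ∞ fun y => P y j := (EuclideanSpace.proj j).contDiff.comp P.contDiff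
    exact h1.contMDiff.comp_contMDiffOn hsm
  · rintro q ⟨hqI, hq⟩
    have hqP : P (κ.1 q) = 0 := (hI q hq).1 hqI
    simp only
    rw [hqP]; rfl
  · have h1 : ContDiffOn ℝ ∞ (fun y => fderiv ℝ g y (P y) (e j)) (Metric.ball y₀ r) :=
      hdg.clm_apply contDiffOn_const
    exact h1.contMDiffOn.comp hsm hmaps
  · rintro q ⟨hqI, hq⟩
    have hqP : P (κ.1 q) = 0 := (hI q hq).1 hqI
    simp only
    rw [hqP, map_zero]; rfl
  · have hy : κ.1 q ∈ κ.1.target := κ.1.map_source hq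
    have hyb : κ.1 q ∈ Metric.ball y₀ r := hmaps hq
    have hfq : MDifferentiableAt (𝓡 m) 𝓘(ℝ, ℝ) f (κ.1.symm (κ.1 q)) := by
      rw [κ.1.left_inv hq]
      exact (hf.1.contMDiffAt (κ.1.open_source.mem_nhds hq)).mdifferentiableAt (by simp)
    have h1 := lieDeriv_symm_apply κ (pullField (chartDiffeo κ) fun y => P y) hy hfq
    rw [coordField_pullField κ _ hy, κ.1.left_inv hq] at h1
    have hgd : HasFDerivAt g (fderiv ℝ g (κ.1 q)) (κ.1 q) :=
      ((hg.contDiffAt (Metric.isOpen_ball.mem_nhds hyb)).differentiableAt (by simp)).hasFDerivAt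
    have h2 : HasFDerivAt (f ∘ κ.1.symm) _ (κ.1 q) :=
      (hgd.clm_apply P.hasFDerivAt).congr_of_eventuallyEq
        (by filter_upwards [Metric.isOpen_ball.mem_nhds hyb] with z hz using hFg' z hz)
    have h3 : f q = g (κ.1 q) (P (κ.1 q)) := by
      rw [← hFg' _ hyb, Function.comp_apply, κ.1.left_inv hq]
    simp only
    rw [h1, h2.fderiv, h3, ← hsum]
    simp [hPdef, normalProj_normalProj]

end EulerFields

/-! ### The first-order conditions on an Euler field in coordinates. -/

section EulerCoordinates

variable {m n : ℕ} {M : Type*} [TopologicalSpace M] [ChartedSpace (EuclideanSpace ℝ (Fin m)) M]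

/-- A bump in the chart, extended by zero. The image of the closed ball is compact, hence closed as
M is Hausdorff, which makes the extension smooth. Functions on all of Ω are needed because those are
what the Euler condition tests. -/
theorem exists_contMDiff_extension [T2Space M] (κ : Chart m M) {y : EuclideanSpace ℝ (Fin m)}
    (hy : y ∈ κ.1.target) {g : EuclideanSpace ℝ (Fin m) → ℝ} (hg : ContDiff ℝ ∞ g) :
    ∃ f : M → ℝ, ContMDiff (𝓡 m) 𝓘(ℝ, ℝ) ∞ f ∧ f ∘ κ.1.symm =ᶠ[𝓝 y] g ∧
      ∀ q, f q ≠ 0 → q ∈ κ.1.source ∧ g (κ.1 q) ≠ 0 := by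
  classical
  obtain ⟨r, hr, hrκ⟩ := Metric.isOpen_iff.1 κ.1.open_target y hy
  let b : ContDiffBump y := ⟨r / 3, r / 2, by positivity, by linarith⟩
  have hbκ : Metric.closedBall y (r / 2) ⊆ κ.1.target :=
    (Metric.closedBall_subset_ball (by linarith)).trans hrκ
  have hK : IsCompact (κ.1.symm '' Metric.closedBall y (r / 2)) :=
    (isCompact_closedBall y _).image_of_continuousOn (κ.1.continuousOn_symm.mono hbκ)
  refine ⟨fun q => if q ∈ κ.1.source then b (κ.1 q) * g (κ.1 q) else 0, fun q => ?_, ?_, ?_⟩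
  · by_cases hq : q ∈ κ.1.source
    · have h1 : ContDiff ℝ ∞ fun z => b z * g z := b.contDiff.mul hg
      refine (h1.contMDiff.contMDiffAt.comp q
        (contMDiffAt_of_mem_maximalAtlas κ.2 hq)).congr_of_eventuallyEq ?_
      filter_upwards [κ.1.open_source.mem_nhds hq] with z hz
      simp [hz]
    · have hqK : q ∉ κ.1.symm '' Metric.closedBall y (r / 2) := by
        rintro ⟨z, hz, rfl⟩
        exact hq (κ.1.map_target (hbκ hz))
      refine (contMDiffAt_const (c := (0 : ℝ))).congr_of_eventuallyEq ?_
      filter_upwards [hK.isClosed.isOpen_compl.mem_nhds hqK] with z hz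
      by_cases hzs : z ∈ κ.1.source
      · have hz' : ¬ dist (κ.1 z) y ≤ r / 2 := fun h => hz ⟨κ.1 z, h, κ.1.left_inv hzs⟩
        have : b (κ.1 z) = 0 := b.zero_of_le_dist (not_le.1 hz').le
        simp [this]
      · simp [hzs]
  · filter_upwards [κ.1.open_target.mem_nhds hy,
      Metric.ball_mem_nhds y (show 0 < r / 3 by positivity)] with z hz hzb
    have : b z = 1 := b.one_of_mem_closedBall (Metric.ball_subset_closedBall hzb)
    simp [κ.1.map_target hz, κ.1.right_inv hz, this]
  · intro q hq
    by_cases hqs : q ∈ κ.1.source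
    · simp only [hqs, if_true] at hq
      exact ⟨hqs, right_ne_zero_of_mul hq⟩
    · simp [hqs] at hq

/-- By the product rule, a product of two functions vanishing at a point vanishes there together
with its derivative. -/
theorem hasFDerivAt_of_mem_vanishingIdealSq {I : Set M} {Ω : Opens M} {h : M → ℝ}
    (hh : h ∈ vanishingIdealSq (m := m) I Ω) (κ : Chart m M) {y : EuclideanSpace ℝ (Fin m)}
    (hy : y ∈ chartImage κ.1 Ω) (hyI : κ.1.symm y ∈ I) :
    h (κ.1.symm y) = 0 ∧
      HasFDerivAt (h ∘ κ.1.symm) (0 : EuclideanSpace ℝ (Fin m) →L[ℝ] ℝ) y := by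
  obtain ⟨k, a, b, hab, hsum⟩ := hh
  have hyn : ((chartImage κ.1 Ω : Opens _) : Set (EuclideanSpace ℝ (Fin m))) ∈ 𝓝 y :=
    (chartImage κ.1 Ω).isOpen.mem_nhds hy
  have hd : ∀ f ∈ vanishingIdeal (m := m) I Ω, f (κ.1.symm y) = 0 ∧
      HasFDerivAt (f ∘ κ.1.symm) (fderiv ℝ (f ∘ κ.1.symm) y) y := fun f hf =>
    ⟨hf.2 _ ⟨hyI, hy.2⟩, (((contDiffOn_comp_symm κ hf.1).contDiffAt hyn).differentiableAt
      (by simp)).hasFDerivAt⟩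
  refine ⟨?_, ?_⟩
  · rw [hsum _ hy.2]
    exact Finset.sum_eq_zero fun i _ => by rw [(hd _ (hab i).1).1, zero_mul]
  · have h1 : HasFDerivAt (fun z => ∑ i, (a i ∘ κ.1.symm) z * (b i ∘ κ.1.symm) z)
        (∑ i : Fin k, (0 : EuclideanSpace ℝ (Fin m) →L[ℝ] ℝ)) y := by
      refine HasFDerivAt.fun_sum fun i _ => ?_
      have h2 := (hd _ (hab i).1).2.mul (hd _ (hab i).2).2
      simp only [Function.comp_apply, (hd _ (hab i).1).1, (hd _ (hab i).2).1, zero_smul,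
        add_zero] at h2
      exact h2
    rw [Finset.sum_const_zero] at h1
    refine h1.congr_of_eventuallyEq ?_
    filter_upwards [hyn] with z hz
    exact hsum _ hz.2

variable [IsManifold (𝓡 m) ∞ M]

/-- Cut g off to a global function f in the ideal of I and use that ρ f - f lies in its square. This
translates the ideal condition into equations for the coordinate field. -/
theorem IsEuler.coordField_test [T2Space M] {I : Set M} {Ω : Opens M}
    {ρ : (x : M) → TangentSpace (𝓡 m) x} (hρ : IsEuler I Ω ρ) (κ : Chart m M)
    (hI : IsAdapted n I κ.1) {y : EuclideanSpace ℝ (Fin m)} (hy : y ∈ chartImage κ.1 Ω)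
    (hy0 : normalProj m n y = 0) {g : EuclideanSpace ℝ (Fin m) → ℝ} (hg : ContDiff ℝ ∞ g)
    (hg0 : ∀ z, normalProj m n z = 0 → g z = 0) :
    fderiv ℝ g y (coordField κ ρ y) = 0 ∧
      HasFDerivAt (fun z => fderiv ℝ g z (coordField κ ρ z) - g z)
        (0 : EuclideanSpace ℝ (Fin m) →L[ℝ] ℝ) y := by
  obtain ⟨f, hf, hfg, hfs⟩ := exists_contMDiff_extension κ hy.1 hg
  have hfI : f ∈ vanishingIdeal (m := m) I Ω := by
    refine ⟨hf.contMDiffOn, fun x hx => by_contra fun h => ?_⟩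
    obtain ⟨h1, h2⟩ := hfs x h
    exact h2 (hg0 _ ((hI x h1).1 hx.1))
  have hyI : κ.1.symm y ∈ I := (hI.symm_mem_iff hy.1).2 hy0
  obtain ⟨h1, h2⟩ := hasFDerivAt_of_mem_vanishingIdealSq (hρ.euler f hfI) κ hy hyI
  have hE : (fun z => fderiv ℝ g z (coordField κ ρ z) - g z) =ᶠ[𝓝 y]
      (fun x => lieDeriv ρ f x - f x) ∘ κ.1.symm := by
    filter_upwards [hfg.eventually_nhds, κ.1.open_target.mem_nhds hy.1] with z hz hzt
    rw [Function.comp_apply, lieDeriv_symm_apply κ ρ hzt (hf.mdifferentiableAt (by simp)),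
      EventuallyEq.fderiv_eq hz, ← EventuallyEq.eq_of_nhds hz, Function.comp_apply]
  refine ⟨?_, h2.congr_of_eventuallyEq hE⟩
  have h3 := hE.self_of_nhds
  rw [Function.comp_apply, h1] at h3
  simpa [hg0 y hy0] using h3

/-- In an adapted chart an Euler vector field vanishes on `I`, and its derivative there is the
identity in the normal directions. -/
theorem IsEuler.coordField_eq_zero [T2Space M] {I : Set M} {Ω : Opens M}
    {ρ : (x : M) → TangentSpace (𝓡 m) x} (hρ : IsEuler I Ω ρ) (κ : Chart m M)
    (hI : IsAdapted n I κ.1) (hn : n < m) {y : EuclideanSpace ℝ (Fin m)}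
    (hy : y ∈ chartImage κ.1 Ω) (hy0 : normalProj m n y = 0) :
    coordField κ ρ y = 0 ∧
      ∀ w, normalProj m n (fderiv ℝ (coordField κ ρ) y w) = normalProj m n w := by
  set v := coordField κ ρ with hv
  have hproj : ∀ i : Fin m, ContDiff ℝ ∞ fun z : EuclideanSpace ℝ (Fin m) => z i := fun i =>
    (EuclideanSpace.proj (𝕜 := ℝ) i).contDiff
  have hprojd : ∀ (i : Fin m) (z : EuclideanSpace ℝ (Fin m)),
      HasFDerivAt (fun z : EuclideanSpace ℝ (Fin m) => z i)
        (EuclideanSpace.proj (𝕜 := ℝ) i : EuclideanSpace ℝ (Fin m) →L[ℝ] ℝ) z := fun i z =>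
    (EuclideanSpace.proj (𝕜 := ℝ) i).hasFDerivAt
  have hvd : HasFDerivAt v (fderiv ℝ v y) y :=
    (((contDiffOn_coordField κ hρ.smooth).contDiffAt
      ((chartImage κ.1 Ω).isOpen.mem_nhds hy)).differentiableAt (by simp)).hasFDerivAt
  have hvi : ∀ i, HasFDerivAt (fun z => v z i)
      ((EuclideanSpace.proj (𝕜 := ℝ) i : EuclideanSpace ℝ (Fin m) →L[ℝ] ℝ).comp
        (fderiv ℝ v y)) y := fun i => (hprojd i (v y)).comp y hvd
  -- The normal coordinate z_j as test function: v_j - z_j vanishes at y to second order.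
  have hlin : ∀ j : Fin m, n ≤ j.val → v y j = 0 ∧ ∀ w, fderiv ℝ v y w j = w j := by
    intro j hj
    obtain ⟨h1, h2⟩ := hρ.coordField_test κ hI hy hy0 (hproj j)
      (fun z hz => normalProj_eq_zero_iff.1 hz j hj)
    simp only [(hprojd j _).fderiv] at h1 h2
    refine ⟨h1, fun w => ?_⟩
    have h3 := congrArg (fun A : EuclideanSpace ℝ (Fin m) →L[ℝ] ℝ => A w)
      (h2.unique ((hvi j).sub (hprojd j y)))
    simp at h3
    linarith
  refine ⟨?_, fun w => ?_⟩
  -- Tangential components require one normal index j, here the first. The test function z_j z_i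
  -- gives z_j v_i + z_i v_j - z_j z_i, whose derivative at y in direction e_j is v_i(y) + y_i -
  -- y_i.
  · let j : Fin m := ⟨n, hn⟩
    obtain ⟨hvj, hDj⟩ := hlin j le_rfl
    have hyj : y j = 0 := normalProj_eq_zero_iff.1 hy0 j le_rfl
    ext i
    obtain ⟨-, h2⟩ := hρ.coordField_test κ hI hy hy0 ((hproj j).mul (hproj i))
      (fun z hz => by rw [normalProj_eq_zero_iff.1 hz j le_rfl, zero_mul])
    have hd : ∀ z, fderiv ℝ (fun z : EuclideanSpace ℝ (Fin m) => z j * z i) z (v z) - z j * z i =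
        z j * v z i + z i * v z j - z j * z i := by
      intro z
      have h3 : HasFDerivAt (fun z : EuclideanSpace ℝ (Fin m) => z j * z i) _ z :=
        (hprojd j z).mul (hprojd i z)
      rw [h3.fderiv]
      simp
    simp only [← hv, hd] at h2
    have h3 := h2.unique ((((hprojd j y).mul (hvi i)).add ((hprojd i y).mul (hvi j))).sub
      ((hprojd j y).mul (hprojd i y)))
    have h4 := congrArg (fun A : EuclideanSpace ℝ (Fin m) →L[ℝ] ℝ =>
      A (EuclideanSpace.single j 1)) h3
    simp [hyj, hvj, hDj] at h4
    simpa using h4.symm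
  · ext j
    by_cases hj : n ≤ j.val
    · simp [normalProj_apply, hj, (hlin j hj).2]
    · simp [normalProj_apply, hj]

end EulerCoordinates

/-! ### Linearizing charts and the flow of an Euler vector field -/

section Linearizing

variable {m n : ℕ} {M : Type*} [TopologicalSpace M] [ChartedSpace (EuclideanSpace ℝ (Fin m)) M]

/-- In the chart `κ` the vector field `ρ` is the linear vector field given by `normalProj m n`. -/
def IsLinearizing {m : ℕ} {M : Type*} [TopologicalSpace M]
    [ChartedSpace (EuclideanSpace ℝ (Fin m)) M] (n : ℕ)
    (ρ : (x : M) → TangentSpace (𝓡 m) x) (κ : Chart m M) : Prop :=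
  ∀ y ∈ κ.1.target, mfderiv (𝓡 m) (𝓡 m) κ.1.symm y (normalProj m n y) = ρ (κ.1.symm y)

/-- Compose κ₀ with the inverse of the linearizing diffeomorphism Ξ of the coordinate field. As Ξ
fixes the kernel of P and preserves normal components to first order there, κ agrees with κ₀ along I
to the extent needed to compare two such charts. -/
theorem exists_linearizing_chart [IsManifold (𝓡 m) ∞ M] [T2Space M] {I : Set M} (κ₀ : Chart m M)
    (hI : IsAdapted n I κ₀.1) (hn : n < m) {p : M} (hp : p ∈ I) (hpκ : p ∈ κ₀.1.source)
    {Ω : Opens M} (hpΩ : p ∈ Ω) {ρ : (x : M) → TangentSpace (𝓡 m) x} (hρ : IsEuler I Ω ρ) :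
    ∃ κ : Chart m M, p ∈ κ.1.source ∧ κ.1.source ⊆ κ₀.1.source ∧ κ.1.source ⊆ Ω ∧
      IsLinearizing n ρ κ ∧ IsAdapted n I κ.1 ∧ (∀ q ∈ κ.1.source, q ∈ I → κ.1 q = κ₀.1 q) ∧
      ∀ y ∈ κ.1.target, normalProj m n y = 0 → ∀ w,
        normalProj m n (fderiv ℝ (κ₀.1 ∘ κ.1.symm) y w) = normalProj m n w := by
  have hyO : κ₀.1 p ∈ chartImage κ₀.1 Ω :=
    ⟨κ₀.1.map_source hpκ, by rw [mem_preimage, κ₀.1.left_inv hpκ]; exact hpΩ⟩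
  obtain ⟨Ξ, h1, h2, h3, h4, h5, h6, h7, h8⟩ := exists_linearization (P := normalProj m n)
    normalProj_normalProj ((hI p hpκ).1 hp) (fun l hl y => norm_scaling_normalProj_le hl y)
    (chartImage κ₀.1 Ω).isOpen hyO (contDiffOn_coordField κ₀ hρ.smooth)
    (fun y hy hy0 => (hρ.coordField_eq_zero κ₀ hI hn hy hy0).1)
    (fun y hy hy0 => (hρ.coordField_eq_zero κ₀ hI hn hy hy0).2)
  have hκ : κ₀.1.trans Ξ.symm ∈ IsManifold.maximalAtlas (𝓡 m) ∞ M := by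
    apply OpenPartialHomeomorph.mem_maximalAtlas_of_contMDiffOn
    · exact h4.contMDiffOn.comp ((contMDiffOn_of_mem_maximalAtlas κ₀.2).mono inter_subset_left)
        inter_subset_right
    · exact (contMDiffOn_symm_of_mem_maximalAtlas κ₀.2).comp
        (h3.contMDiffOn.mono inter_subset_left) inter_subset_right
  have hp0 : normalProj m n (κ₀.1 p) = 0 := (hI p hpκ).1 hp
  have hΞp : Ξ (κ₀.1 p) = κ₀.1 p := h6 _ h1 hp0
  refine ⟨⟨κ₀.1.trans Ξ.symm, hκ⟩, ⟨hpκ, ?_⟩, fun q hq => hq.1, fun q hq => ?_, fun y hy => ?_,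
    fun q hq => ?_, fun q hq hqI => ?_, fun y hy hy0 w => ?_⟩
  · change κ₀.1 p ∈ Ξ.target
    rw [← hΞp]; exact Ξ.map_source h1
  · have := (h2 hq.2).2
    change κ₀.1.symm (κ₀.1 q) ∈ Ω at this
    rwa [κ₀.1.left_inv hq.1] at this
  · have hyΞ : Ξ y ∈ κ₀.1.target := (h2 (Ξ.map_source hy.1)).1
    have hd1 : HasMFDerivAt (𝓡 m) (𝓡 m) Ξ y (fderiv ℝ Ξ y) :=
      (((h3.contDiffAt (Ξ.open_source.mem_nhds hy.1)).differentiableAt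
        (by simp)).hasFDerivAt).hasMFDerivAt
    have hd2 : HasMFDerivAt (𝓡 m) (𝓡 m) κ₀.1.symm (Ξ y) _ :=
      ((chartDiffeo κ₀).symm.mdifferentiableAt (by simp) hyΞ).hasMFDerivAt
    have hd3 := (hd2.comp y hd1).mfderiv
    change mfderiv (𝓡 m) (𝓡 m) (κ₀.1.symm ∘ Ξ) y (normalProj m n y) = ρ (κ₀.1.symm (Ξ y))
    rw [hd3, ← mfderiv_symm_coordField κ₀ ρ hyΞ, ← h5 y hy.1]
    rfl
  · have hq2 : κ₀.1 q ∈ Ξ.target := hq.2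
    change q ∈ I ↔ normalProj m n (Ξ.symm (κ₀.1 q)) = 0
    rw [hI q hq.1]
    constructor
    · intro h
      have h9 := h7 _ (Ξ.map_target hq2) (by rw [Ξ.right_inv hq2]; exact h)
      rw [Ξ.right_inv hq2] at h9
      rw [← h9]; exact h
    · intro h
      have h9 := h6 _ (Ξ.map_target hq2) h
      rw [Ξ.right_inv hq2] at h9
      rw [h9]; exact h
  · have hq2 : κ₀.1 q ∈ Ξ.target := hq.2
    have h9 := h7 _ (Ξ.map_target hq2) (by rw [Ξ.right_inv hq2]; exact (hI q hq.1).1 hqI)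
    rw [Ξ.right_inv hq2] at h9
    exact h9.symm
  · have hE : κ₀.1 ∘ (κ₀.1.trans Ξ.symm).symm =ᶠ[𝓝 y] Ξ := by
      filter_upwards [(κ₀.1.trans Ξ.symm).open_target.mem_nhds hy] with z hz
      exact κ₀.1.right_inv (h2 (Ξ.map_source hz.1)).1
    rw [hE.fderiv_eq]
    exact h8 y hy.1 hy0 w

theorem hasDerivAt_scaling_exp (y : EuclideanSpace ℝ (Fin m)) (τ : ℝ) :
    HasDerivAt (fun τ : ℝ => scaling (normalProj m n) (Real.exp τ) y)
      (normalProj m n (scaling (normalProj m n) (Real.exp τ) y)) τ := by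
  rw [apply_scaling normalProj_normalProj]
  simp only [scaling_apply]
  exact ((Real.hasDerivAt_exp τ).smul_const _).const_add _

theorem IsLinearizing.isMIntegralCurveOn {ρ : (x : M) → TangentSpace (𝓡 m) x} {κ : Chart m M}
    (hκ : IsLinearizing n ρ κ) {y : EuclideanSpace ℝ (Fin m)}
    (hy : ∀ τ ≤ 0, scaling (normalProj m n) (Real.exp τ) y ∈ κ.1.target) :
    IsMIntegralCurveOn (fun τ => κ.1.symm (scaling (normalProj m n) (Real.exp τ) y)) ρ
      (Iic 0) := by
  intro τ hτ
  have h1 := ((chartDiffeo κ).symm.mdifferentiableAt (by simp) (hy τ hτ)).hasMFDerivAt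
  have h2 := h1.comp τ (hasDerivAt_scaling_exp (n := n) y τ).hasFDerivAt.hasMFDerivAt
  refine (HasMFDerivAt.congr_mfderiv h2 (ContinuousLinearMap.ext fun r : ℝ => ?_)).hasMFDerivWithinAt
  change mfderiv (𝓡 m) (𝓡 m) κ.1.symm _ (r • normalProj m n _) = r • ρ _
  rw [← hκ _ (hy τ hτ)]
  exact map_smul (mfderiv (𝓡 m) (𝓡 m) κ.1.symm _) r _

theorem IsLinearizing.mfderiv_apply {ρ : (x : M) → TangentSpace (𝓡 m) x} {κ : Chart m M}
    (hκ : IsLinearizing n ρ κ) {q : M} (hq : q ∈ κ.1.source) :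
    mfderiv (𝓡 m) (𝓡 m) κ.1 q (ρ q) = normalProj m n (κ.1 q) := by
  have he : κ.1.MDifferentiable (𝓡 m) (𝓡 m) :=
    ⟨(chartDiffeo κ).contMDiffOn.mdifferentiableOn (by simp),
      (chartDiffeo κ).symm.contMDiffOn.mdifferentiableOn (by simp)⟩
  have h1 := hκ _ (κ.1.map_source hq)
  have h3 := congrArg (fun A => A (normalProj m n (κ.1 q)))
    (he.comp_symm_deriv (κ.1.map_source hq))
  change mfderiv (𝓡 m) (𝓡 m) κ.1 (κ.1.symm (κ.1 q)) (mfderiv (𝓡 m) (𝓡 m) κ.1.symm (κ.1 q)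
    (normalProj m n (κ.1 q))) = normalProj m n (κ.1 q) at h3
  rw [h1, κ.1.left_inv hq] at h3
  exact h3

/-- Uniqueness of the flow of a vector field in a linearizing chart. -/
theorem IsLinearizing.eq_of_isMIntegralCurveOn [T2Space M] {ρ : (x : M) → TangentSpace (𝓡 m) x}
    {κ : Chart m M} (hκ : IsLinearizing n ρ κ) {y : EuclideanSpace ℝ (Fin m)}
    (hy : ∀ τ ≤ 0, scaling (normalProj m n) (Real.exp τ) y ∈ κ.1.target) {γ : ℝ → M}
    (hγ : IsMIntegralCurveOn γ ρ (Iic 0)) (hγ0 : γ 0 = κ.1.symm y) :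
    ∀ τ ≤ 0, γ τ = κ.1.symm (scaling (normalProj m n) (Real.exp τ) y) := by
  set P := normalProj m n with hP
  set c : ℝ → M := fun τ => κ.1.symm (scaling P (Real.exp τ) y) with hc
  have hcc : ContinuousOn c (Iic 0) := (hκ.isMIntegralCurveOn hy).continuousOn
  have hγc : ContinuousOn γ (Iic 0) := hγ.continuousOn
  have hder : ∀ τ ∈ Iic (0 : ℝ), γ τ ∈ κ.1.source →
      HasDerivWithinAt (κ.1 ∘ γ) (P (κ.1 (γ τ))) (Iic 0) τ := by
    intro τ hτ hs
    have h1 := ((chartDiffeo κ).mdifferentiableAt (by simp) hs).hasMFDerivAt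
    have h2 := h1.comp_hasMFDerivWithinAt τ (hγ τ hτ)
    have h3 : HasFDerivWithinAt (κ.1 ∘ γ)
        (ContinuousLinearMap.toSpanSingleton ℝ (P (κ.1 (γ τ)))) (Iic 0) τ := by
      refine hasMFDerivWithinAt_iff_hasFDerivWithinAt.1
        (HasMFDerivWithinAt.congr_mfderiv h2 (ContinuousLinearMap.ext fun r : ℝ => ?_))
      change mfderiv (𝓡 m) (𝓡 m) κ.1 (γ τ) (r • ρ (γ τ)) = r • P (κ.1 (γ τ))
      rw [map_smul, hκ.mfderiv_apply hs]
      rfl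
    simpa using h3.hasDerivWithinAt
  -- A priori γ may leave the chart, so agreement with the linear flow is propagated by a clopen
  -- argument on the connected half-line.
  let s : Set (Iic (0 : ℝ)) := {τ | γ τ = c τ}
  have hclosed : IsClosed s := isClosed_eq (continuousOn_iff_continuous_domRestrict.1 hγc)
    (continuousOn_iff_continuous_domRestrict.1 hcc)
  have hopen : IsOpen s := by
    rw [isOpen_iff_mem_nhds]
    rintro ⟨τ, hτ⟩ (hτs : γ τ = c τ)
    have hcs : c τ ∈ κ.1.source := κ.1.map_target (hy τ hτ)
    have h1 : ∀ᶠ σ in 𝓝[Iic 0] τ, γ σ ∈ κ.1.source :=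
      hγc τ hτ (κ.1.open_source.mem_nhds (by rw [hτs]; exact hcs))
    obtain ⟨ε, hε, hball⟩ := Metric.mem_nhdsWithin_iff.1 h1
    have hconv : Convex ℝ (Metric.ball τ ε ∩ Iic 0) := (convex_ball τ ε).inter (convex_Iic 0)
    -- Undoing the linear flow turns an integral curve in the chart into a constant.
    let w : ℝ → EuclideanSpace ℝ (Fin m) := fun σ => scaling P (Real.exp (-σ)) (κ.1 (γ σ))
    have hw : ∀ σ ∈ Metric.ball τ ε ∩ Iic 0,
        HasDerivWithinAt w 0 (Metric.ball τ ε ∩ Iic 0) σ := by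
      intro σ hσ
      have h2 := (hder σ hσ.2 (hball hσ)).mono (inter_subset_right (s := Metric.ball τ ε))
      have h3 : HasDerivWithinAt (fun σ : ℝ => Real.exp (-σ)) (-Real.exp (-σ))
          (Metric.ball τ ε ∩ Iic 0) σ := by
        have := ((hasDerivAt_neg σ).exp).hasDerivWithinAt (s := Metric.ball τ ε ∩ Iic 0)
        simpa using this
      have h4 := (h2.sub (P.hasFDerivAt.comp_hasDerivWithinAt σ h2)).add
        (h3.smul (P.hasFDerivAt.comp_hasDerivWithinAt σ h2))
      have h5 : P (P (κ.1 (γ σ))) = P (κ.1 (γ σ)) := normalProj_normalProj _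
      simp only [Function.comp_apply, h5, sub_self, zero_add] at h4
      rw [show Real.exp (-σ) • P (κ.1 (γ σ)) + -Real.exp (-σ) • P (κ.1 (γ σ)) = 0 by
        rw [neg_smul, add_neg_cancel]] at h4
      exact h4
    rw [mem_nhds_subtype_iff_nhdsWithin]
    refine mem_of_superset (inter_mem_nhdsWithin (Iic 0) (Metric.ball_mem_nhds τ hε)) ?_
    rintro σ ⟨hσ, hσb⟩
    refine ⟨⟨σ, hσ⟩, ?_, rfl⟩
    have hconst : w σ = w τ := by
      have := hconv.norm_image_sub_le_of_norm_hasDerivWithin_le (C := 0) hw (by simp)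
        ⟨Metric.mem_ball_self hε, hτ⟩ ⟨hσb, hσ⟩
      rw [zero_mul, norm_le_zero_iff, sub_eq_zero] at this
      exact this
    have hwτ : w τ = y := by
      change scaling P (Real.exp (-τ)) (κ.1 (γ τ)) = y
      rw [hτs, hc]
      simp only
      rw [κ.1.right_inv (hy τ hτ), Real.exp_neg, scaling_inv_scaling normalProj_normalProj
        (Real.exp_pos τ).ne']
    have hwσ : κ.1 (γ σ) = scaling P (Real.exp σ) y := by
      rw [← hwτ, ← hconst]
      change _ = scaling P (Real.exp σ) (scaling P (Real.exp (-σ)) (κ.1 (γ σ)))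
      rw [Real.exp_neg, scaling_scaling_inv normalProj_normalProj (Real.exp_pos σ).ne']
    change γ σ = κ.1.symm (scaling P (Real.exp σ) y)
    rw [← hwσ, κ.1.left_inv (hball ⟨hσb, hσ⟩)]
  have hpre : PreconnectedSpace (Iic (0 : ℝ)) :=
    isPreconnected_iff_preconnectedSpace.1 isPreconnected_Iic
  have huniv : s = univ := IsClopen.eq_univ ⟨hclosed, hopen⟩
    ⟨⟨0, self_mem_Iic⟩, by simp [s, hc, hγ0]⟩
  intro τ hτ
  have : (⟨τ, hτ⟩ : Iic (0 : ℝ)) ∈ s := huniv ▸ mem_univ _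
  exact this

end Linearizing

/-! ### Comparison of scaled distributions -/

section Comparison

variable {m n : ℕ} {M M' : Type*} [TopologicalSpace M] [ChartedSpace (EuclideanSpace ℝ (Fin m)) M]
  [TopologicalSpace M'] [ChartedSpace (EuclideanSpace ℝ (Fin m)) M']

omit [ChartedSpace (EuclideanSpace ℝ (Fin m)) M] in
/-- A criterion for two densities to be the same, in terms of a map `T` that agrees with the
transition map on an open set containing the support. -/
theorem sameDensity_of_eqOn {α β : OpenPartialHomeomorph M (EuclideanSpace ℝ (Fin m))}
    {f₁ f₂ : EuclideanSpace ℝ (Fin m) → ℝ} {T : EuclideanSpace ℝ (Fin m) → EuclideanSpace ℝ (Fin m)}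
    {N : Set (EuclideanSpace ℝ (Fin m))} (hN : IsOpen N) (hNα : N ⊆ α.target)
    (hfN : tsupport f₁ ⊆ N) (hT : ∀ y ∈ N, α.symm y ∈ β.source → β (α.symm y) = T y)
    (hf₁ : ∀ y ∈ tsupport f₁, α.symm y ∈ β.source)
    (hf₂ : ∀ z ∈ tsupport f₂, z ∈ β.target ∧ ∃ y ∈ N, α.symm y = β.symm z)
    (h : ∀ y ∈ N, f₁ y = |(fderiv ℝ T y).det| * f₂ (T y)) : SameDensity α β f₁ f₂ := by
  refine ⟨fun y hy => ⟨hNα (hfN hy), hf₁ y hy⟩, fun z hz => ?_, fun y hy => ?_⟩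
  · obtain ⟨h1, y, hy, hyz⟩ := hf₂ z hz
    refine ⟨h1, ?_⟩
    rw [mem_preimage, ← hyz]
    exact α.map_target (hNα hy)
  · by_cases hyN : y ∈ N
    · have hE : β ∘ α.symm =ᶠ[𝓝 y] T := by
        filter_upwards [hN.mem_nhds hyN,
          (α.isOpen_inter_preimage_symm β.open_source).mem_nhds hy] with z hz hz'
        exact hT z hz hz'.2
      rw [hE.fderiv_eq, hT y hyN hy.2]
      exact h y hyN
    · have h0 : f₁ y = 0 := tsupport_eq_zero fun h' => hyN (hfN h')
      have h1 : f₂ (β (α.symm y)) = 0 := by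
        refine tsupport_eq_zero fun h' => hyN ?_
        obtain ⟨-, y', hy', hyz⟩ := hf₂ _ h'
        rw [β.left_inv hy.2] at hyz
        rwa [← α.symm.injOn (hNα hy') hy.1 hyz]
      rw [h0, h1, mul_zero]

/-- A local homeomorphism maps a set whose closure is a neighbourhood of a point to a set with the
same property. -/
theorem closure_mem_nhds_of_mapsTo {X Y : Type*} [TopologicalSpace X] [TopologicalSpace Y]
    (e : OpenPartialHomeomorph X Y) {p : X} (hp : p ∈ e.source) {V : Set X} {W : Set Y}
    (hV : closure V ∈ 𝓝 p) (hVW : ∀ q ∈ V, q ∈ e.source → e q ∈ W) : closure W ∈ 𝓝 (e p) := by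
  have h1 : ∀ᶠ x in 𝓝 (e p), e.symm x ∈ closure V := by
    have := e.continuousAt_symm (e.map_source hp)
    rw [ContinuousAt, e.left_inv hp] at this
    exact this hV
  filter_upwards [h1, e.open_target.mem_nhds (e.map_source hp)] with x hx hxt
  have hxs : e.symm x ∈ e.source := e.map_target hxt
  have h2 : e.symm x ∈ closure (e.source ∩ V) :=
    e.open_source.inter_closure ⟨hxs, hx⟩
  have h3 := (e.continuousAt hxs).continuousWithinAt.mem_closure_image h2
  rw [e.right_inv hxt] at h3
  refine closure_mono ?_ h3
  rintro _ ⟨q, hq, rfl⟩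
  exact hVW q hq.2 hq.1

variable [IsManifold (𝓡 m) ∞ M] [IsManifold (𝓡 m) ∞ M']

/-- Both sides are values of the single distribution t in two transported charts, so its
compatibility decides. The open sets V and V' may differ, as they do when two Euler fields are
compared. -/
theorem pullback_restrict_inChart_eq {U V V' : Opens M} {W W' : Opens M'} (hV : V ≤ U)
    (hV' : V' ≤ U) (t : ManifoldDistribution m M U)
    {Φ Φ' : PartialDiffeomorph (𝓡 m) (𝓡 m) M' M ∞} (hΦ : ∀ x ∈ W, x ∈ Φ.source ∧ Φ x ∈ V)
    (hΦ' : ∀ x ∈ W', x ∈ Φ'.source ∧ Φ' x ∈ V') {κ κ' : Chart m M'}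
    (f : 𝓓(chartImage κ.1 W, ℝ)) (f' : 𝓓(chartImage κ'.1 W', ℝ))
    (h : SameDensity (transportChart Φ κ).1 (transportChart Φ' κ').1 f f') :
    ((t.restrict hV).pullback Φ hΦ).inChart κ f =
      ((t.restrict hV').pullback Φ' hΦ').inChart κ' f' := by
  refine t.compat _ _ _ _ ?_
  have h1 : chartImage κ.1 W ≤ chartImage (transportChart Φ κ).1 V :=
    fun y hy => ⟨⟨hy.1, (hΦ _ hy.2).1⟩, (hΦ _ hy.2).2⟩
  have h2 : chartImage κ'.1 W' ≤ chartImage (transportChart Φ' κ').1 V' :=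
    fun y hy => ⟨⟨hy.1, (hΦ' _ hy.2).1⟩, (hΦ' _ hy.2).2⟩
  have h3 : ∀ κ : Chart m M, chartImage κ.1 V ≤ chartImage κ.1 U :=
    fun κ y hy => ⟨hy.1, hV hy.2⟩
  have h4 : ∀ κ : Chart m M, chartImage κ.1 V' ≤ chartImage κ.1 U :=
    fun κ y hy => ⟨hy.1, hV' hy.2⟩
  simpa [h1, h2, h3, h4] using h

theorem pullback_inChart_eq {V : Opens M} {W : Opens M'}
    (t : ManifoldDistribution m M V)
    {Φ : PartialDiffeomorph (𝓡 m) (𝓡 m) M' M ∞} (hΦ : ∀ x ∈ W, x ∈ Φ.source ∧ Φ x ∈ V)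
    {κ : Chart m M'} {κ' : Chart m M}
    (f : 𝓓(chartImage κ.1 W, ℝ)) (f' : 𝓓(chartImage κ'.1 V, ℝ))
    (h : SameDensity (transportChart Φ κ).1 κ'.1 f f') :
    (t.pullback Φ hΦ).inChart κ f = t.inChart κ' f' := by
  refine t.compat _ _ _ _ ?_
  have h1 : chartImage κ.1 W ≤ chartImage (transportChart Φ κ).1 V :=
    fun y hy => ⟨⟨hy.1, (hΦ _ hy.2).1⟩, (hΦ _ hy.2).2⟩
  simpa [h1] using h

/-- If `V` lies in the domain of a chart, then membership in `E_s^ρ(V)` can be tested in it. -/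
theorem mem_scaleSpace_of_chart {ρ : (x : M) → TangentSpace (𝓡 m) x} {s : ℝ} {V : Opens M}
    {t : ManifoldDistribution m M V} (κ : Chart m M) (hV : ∀ q ∈ V, q ∈ κ.1.source)
    {S : ℝ → PartialDiffeomorph (𝓡 m) (𝓡 m) M M ∞} (hS : IsScalingFlow ρ V S)
    (h : ∀ φ : 𝓓(chartImage κ.1 V, ℝ), ∃ C : ℝ, ∀ (l : ℝ) (hl : l ∈ Ioc (0 : ℝ) 1),
      ‖((l ^ (-s) : ℝ) : ℂ) * (t.pullback (S l) (hS.maps hl)).inChart κ φ‖ ≤ C) :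
    t ∈ scaleSpace ρ s V := by
  refine ⟨S, hS, fun κ' φ => ?_⟩
  obtain ⟨g, hg⟩ := exists_sameDensity κ' κ φ fun y hy => hV _ (φ.tsupport_subset hy).2
  obtain ⟨C, hC⟩ := h g
  refine ⟨C, fun l hl => ?_⟩
  rw [(t.pullback (S l) (hS.maps hl)).compat κ' κ φ g hg]
  exact hC l hl

/-- In a linearizing chart the flow at time log l is S_l, so every open set of coordinates stable
under scaling yields a convex open set. -/
theorem IsLinearizing.exists_isScalingFlow {ρ : (x : M) → TangentSpace (𝓡 m) x} {κ : Chart m M}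
    (hκ : IsLinearizing n ρ κ) {B : Set (EuclideanSpace ℝ (Fin m))} (hBo : IsOpen B)
    (hBκ : B ⊆ κ.1.target)
    (hB : ∀ l ∈ Ioc (0 : ℝ) 1, ∀ y ∈ B, scaling (normalProj m n) l y ∈ B) {V : Opens M}
    (hV : ∀ q, q ∈ V ↔ q ∈ κ.1.source ∧ κ.1 q ∈ B) :
    ∃ S : ℝ → PartialDiffeomorph (𝓡 m) (𝓡 m) M M ∞, IsScalingFlow ρ V S ∧
      ∀ l ∈ Ioc (0 : ℝ) 1, ∀ q ∈ V, S l q = κ.1.symm (scaling (normalProj m n) l (κ.1 q)) := by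
  set P := normalProj m n with hP
  have hκs : ContMDiffOn (𝓡 m) (𝓡 m) ∞ κ.1 κ.1.source := contMDiffOn_of_mem_maximalAtlas κ.2
  have hκt : ContMDiffOn (𝓡 m) (𝓡 m) ∞ κ.1.symm κ.1.target :=
    contMDiffOn_symm_of_mem_maximalAtlas κ.2
  have hex : ∀ l ∈ Ioc (0 : ℝ) 1, ∃ S : PartialDiffeomorph (𝓡 m) (𝓡 m) M M ∞,
      S.source = V ∧ ∀ q, S q = κ.1.symm (scaling P l (κ.1 q)) := by
    intro l hl
    have hl0 : l ≠ 0 := hl.1.ne'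
    refine ⟨⟨⟨fun q => κ.1.symm (scaling P l (κ.1 q)), fun q => κ.1.symm (scaling P l⁻¹ (κ.1 q)),
      V, κ.1.source ∩ κ.1 ⁻¹' (scaling P l⁻¹ ⁻¹' B), fun q hq => ?_, fun q hq => ?_,
      fun q hq => ?_, fun q hq => ?_⟩, V.isOpen, ?_, ?_, ?_⟩, rfl, fun q => rfl⟩
    · obtain ⟨h1, h2⟩ := (hV q).1 hq
      have h3 := hBκ (hB l hl _ h2)
      refine ⟨κ.1.map_target h3, ?_⟩
      simp only [mem_preimage]
      rw [κ.1.right_inv h3, scaling_inv_scaling normalProj_normalProj hl0]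
      exact h2
    · obtain ⟨h1, h2⟩ := hq
      refine (hV _).2 ⟨κ.1.map_target (hBκ h2), ?_⟩
      rw [κ.1.right_inv (hBκ h2)]
      exact h2
    · obtain ⟨h1, h2⟩ := (hV q).1 hq
      rw [κ.1.right_inv (hBκ (hB l hl _ h2)), scaling_inv_scaling normalProj_normalProj hl0,
        κ.1.left_inv h1]
    · obtain ⟨h1, h2⟩ := hq
      rw [κ.1.right_inv (hBκ h2), scaling_scaling_inv normalProj_normalProj hl0, κ.1.left_inv h1]
    · exact κ.1.isOpen_inter_preimage (hBo.preimage (scaling P l⁻¹).continuous)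
    · refine hκt.comp ((scaling P l).contDiff.contMDiff.comp_contMDiffOn
        (hκs.mono fun q hq => ((hV q).1 hq).1)) fun q hq => hBκ (hB l hl _ ((hV q).1 hq).2)
    · refine hκt.comp ((scaling P l⁻¹).contDiff.contMDiff.comp_contMDiffOn
        (hκs.mono inter_subset_left)) fun q hq => hBκ hq.2
  -- Outside (0, 1] nothing is required of the flow; the map for l = 1 serves as default value.
  have hex' : ∀ l : ℝ, ∃ S : PartialDiffeomorph (𝓡 m) (𝓡 m) M M ∞, l ∈ Ioc (0 : ℝ) 1 →
      S.source = V ∧ ∀ q, S q = κ.1.symm (scaling P l (κ.1 q)) := by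
    intro l
    by_cases hl : l ∈ Ioc (0 : ℝ) 1
    · exact (hex l hl).imp fun S h _ => h
    · exact (hex 1 ⟨one_pos, le_rfl⟩).imp fun S _ h => absurd h hl
  choose S hS using hex'
  refine ⟨S, ⟨fun l hl => (hS l hl).1, fun l hl q hq => ?_, fun q hq => ?_⟩,
    fun l hl q _ => (hS l hl).2 q⟩
  · have h2 := hB l hl _ ((hV q).1 hq).2
    rw [(hS l hl).2]
    refine (hV _).2 ⟨κ.1.map_target (hBκ h2), ?_⟩
    rw [κ.1.right_inv (hBκ h2)]
    exact h2
  · obtain ⟨h1, h2⟩ := (hV q).1 hq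
    refine ⟨fun τ => κ.1.symm (scaling P (Real.exp τ) (κ.1 q)), ?_,
      hκ.isMIntegralCurveOn fun τ hτ => hBκ (hB _ ⟨Real.exp_pos τ, Real.exp_le_one_iff.2 hτ⟩ _ h2),
      fun l hl => ?_⟩
    · simp only
      rw [Real.exp_zero, scaling_one, κ.1.left_inv h1]
    · simp only
      rw [(hS l hl).2, Real.exp_log hl.1]

end Comparison

/-! ### Independence of the Euler vector field -/

section Independence

theorem det_scaling_inv_mul {E : Type*} [NormedAddCommGroup E] [NormedSpace ℝ E] {P : E →L[ℝ] E}
    (hP : ∀ y, P (P y) = P y) {l : ℝ} (hl : l ≠ 0) :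
    (scaling P l⁻¹).det * (scaling P l).det = 1 := by
  have h1 : (scaling P l⁻¹).comp (scaling P l) = ContinuousLinearMap.id ℝ E := by
    ext y
    exact scaling_inv_scaling hP hl y
  have h5 : ((scaling P l⁻¹).comp (scaling P l)).det = (scaling P l⁻¹).det * (scaling P l).det :=
    LinearMap.det_comp _ _
  have h6 : (ContinuousLinearMap.id ℝ E).det = 1 := LinearMap.det_id
  rw [← h5, h1, h6]

/-- The Jacobians of S_l and of its inverse cancel, so the density factor of the conjugated map
carries no power of l. -/
theorem det_fderiv_scaling_conj {E : Type*} [NormedAddCommGroup E] [NormedSpace ℝ E]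
    {P : E →L[ℝ] E} (hP : ∀ y, P (P y) = P y) {l : ℝ} (hl : l ≠ 0) {f : E → E} {y : E}
    (hf : DifferentiableAt ℝ f (scaling P l y)) :
    (fderiv ℝ (fun y => scaling P l⁻¹ (f (scaling P l y))) y).det =
      (fderiv ℝ f (scaling P l y)).det := by
  have h1 : HasFDerivAt (fun y => scaling P l⁻¹ (f (scaling P l y)))
      ((scaling P l⁻¹).comp ((fderiv ℝ f (scaling P l y)).comp (scaling P l))) y :=
    (scaling P l⁻¹).hasFDerivAt.comp y (hf.hasFDerivAt.comp y (scaling P l).hasFDerivAt)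
  have h2 : ∀ A B : E →L[ℝ] E, (A.comp B).det = A.det * B.det := fun A B => LinearMap.det_comp _ _
  rw [h1.fderiv, h2, h2, mul_left_comm, det_scaling_inv_mul hP hl, mul_one]

variable {m n : ℕ} {M : Type*} [TopologicalSpace M] [ChartedSpace (EuclideanSpace ℝ (Fin m)) M]

/-- In a linearizing chart a scaling flow is given by the scalings. -/
theorem IsLinearizing.scalingFlow_apply [IsManifold (𝓡 m) ∞ M] [T2Space M]
    {ρ : (x : M) → TangentSpace (𝓡 m) x} {κ : Chart m M}
    (hκ : IsLinearizing n ρ κ) {V : Opens M} {S : ℝ → PartialDiffeomorph (𝓡 m) (𝓡 m) M M ∞}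
    (hS : IsScalingFlow ρ V S) {y₀ : EuclideanSpace ℝ (Fin m)} (hy₀ : normalProj m n y₀ = 0)
    {r : ℝ} (hr : Metric.ball y₀ r ⊆ κ.1.target) {y : EuclideanSpace ℝ (Fin m)}
    (hy : y ∈ Metric.ball y₀ r) (hyV : κ.1.symm y ∈ V) {l : ℝ} (hl : l ∈ Ioc (0 : ℝ) 1) :
    S l (κ.1.symm y) = κ.1.symm (scaling (normalProj m n) l y) := by
  obtain ⟨γ, hγ0, hγ, hSγ⟩ := hS.flow _ hyV
  rw [hSγ l hl, hκ.eq_of_isMIntegralCurveOn (fun τ hτ => hr (scaling_mem_ball hy₀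
    (fun l hl y => norm_scaling_normalProj_le hl y)
    ⟨(Real.exp_pos τ).le, Real.exp_le_one_iff.2 hτ⟩ hy)) hγ hγ0 _
    (Real.log_nonpos hl.1.le hl.2), Real.exp_log hl.1]

/-- The bound for scaling parameters in a compact subset of `(0, 1]`. -/
theorem exists_bound_of_le [IsManifold (𝓡 m) ∞ M] {κ : Chart m M}
    {B : Set (EuclideanSpace ℝ (Fin m))} (hBo : IsOpen B)
    (hBκ : B ⊆ κ.1.target)
    (hB : ∀ l ∈ Ioc (0 : ℝ) 1, ∀ y ∈ B, scaling (normalProj m n) l y ∈ B) {V : Opens M}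
    (hV : ∀ q, q ∈ V ↔ q ∈ κ.1.source ∧ κ.1 q ∈ B)
    {ρ : (x : M) → TangentSpace (𝓡 m) x} {S : ℝ → PartialDiffeomorph (𝓡 m) (𝓡 m) M M ∞}
    (hS : IsScalingFlow ρ V S) (hSκ : ∀ l ∈ Ioc (0 : ℝ) 1, ∀ q ∈ V,
      S l q = κ.1.symm (scaling (normalProj m n) l (κ.1 q))) (s : ℝ)
    (t : ManifoldDistribution m M V) (φ : 𝓓(chartImage κ.1 V, ℝ)) {l₀ : ℝ} (hl₀ : 0 < l₀) :
    ∃ C : ℝ, ∀ (l : ℝ) (hl : l ∈ Ioc (0 : ℝ) 1), l₀ ≤ l →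
      ‖((l ^ (-s) : ℝ) : ℂ) * (t.pullback (S l) (hS.maps hl)).inChart κ φ‖ ≤ C := by
  set P := normalProj m n with hP
  have hPP : ∀ y, P (P y) = P y := normalProj_normalProj
  have hBV : ∀ y ∈ B, y ∈ κ.1.target ∧ κ.1.symm y ∈ V := fun y hy =>
    ⟨hBκ hy, (hV _).2 ⟨κ.1.map_target (hBκ hy), by rw [κ.1.right_inv (hBκ hy)]; exact hy⟩⟩
  have hφB : tsupport φ ⊆ B := fun y hy => by
    have h1 := φ.tsupport_subset hy
    have h2 := ((hV _).1 h1.2).2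
    rwa [κ.1.right_inv h1.1] at h2
  let A : Set ℝ := Icc l₀ 1
  have hA : ∀ l ∈ A, l ∈ Ioc (0 : ℝ) 1 := fun l hl => ⟨hl₀.trans_le hl.1, hl.2⟩
  have hc : Continuous fun z : ℝ × EuclideanSpace ℝ (Fin m) => scaling P z.1 z.2 :=
    (contDiff_scaling P (n := ∞)).continuous
  let K : Set (EuclideanSpace ℝ (Fin m)) := (fun z => scaling P z.1 z.2) '' (A ×ˢ tsupport φ)
  have hK : IsCompact K := (isCompact_Icc.prod φ.hasCompactSupport).image hc
  have hKB : K ⊆ B := by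
    rintro _ ⟨⟨l, y⟩, ⟨hl, hy⟩, rfl⟩
    exact hB l (hA l hl) y (hφB hy)
  have hsupp : ∀ l ∈ A, tsupport (fun w => φ (scaling P l⁻¹ w)) ⊆
      (fun y => scaling P l y) '' tsupport φ := by
    intro l hl
    have hcl : IsClosed ((fun y => scaling P l y) '' tsupport φ) :=
      (φ.hasCompactSupport.image (scaling P l).continuous).isClosed
    refine closure_minimal (fun w hw => ⟨scaling P l⁻¹ w, subset_tsupport φ hw, ?_⟩) hcl
    exact scaling_scaling_inv hPP (hA l hl).1.ne' w
  have hsuppK : ∀ l ∈ A, tsupport (fun w => φ (scaling P l⁻¹ w)) ⊆ K := fun l hl w hw => by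
    obtain ⟨y, hy, rfl⟩ := hsupp l hl hw
    exact ⟨(l, y), ⟨hl, hy⟩, rfl⟩
  have hcd : ∀ l, ContDiff ℝ ∞ fun w => φ (scaling P l w) := fun l =>
    φ.contDiff.comp (scaling P l).contDiff
  let D : A → 𝓓(chartImage κ.1 V, ℝ) := fun l => ⟨fun w => φ (scaling P (l : ℝ)⁻¹ w), hcd _,
    hK.of_isClosed_subset (isClosed_tsupport _) (hsuppK l l.2),
    (hsuppK l l.2).trans fun y hy => hBV y (hKB hy)⟩
  have hder : ∀ k : ℕ, ∃ C : ℝ, ∀ (l : A) x, ‖iteratedFDeriv ℝ k (D l) x‖ ≤ C := by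
    intro k
    obtain ⟨C₁, hC₁⟩ : ∃ C : ℝ, ∀ μ ∈ Icc l₀ 1, ‖scaling P μ⁻¹‖ ≤ C := by
      have : ContinuousOn (fun μ : ℝ => scaling P μ⁻¹) (Icc l₀ 1) := by
        have h1 : Continuous fun μ : ℝ => scaling P μ := by unfold scaling; fun_prop
        exact h1.comp_continuousOn (continuousOn_inv₀.mono fun μ hμ => (hA μ hμ).1.ne')
      exact isCompact_Icc.exists_bound_of_continuousOn this
    obtain ⟨C₂, hC₂⟩ := (φ.contDiff.continuous_iteratedFDeriv (m := k)
      (by exact_mod_cast le_top)).bounded_above_of_compact_support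
        (φ.hasCompactSupport.iteratedFDeriv k)
    refine ⟨C₂ * C₁ ^ k, fun l x => ?_⟩
    have h1 : (D l : EuclideanSpace ℝ (Fin m) → ℝ) = φ ∘ scaling P (l : ℝ)⁻¹ := rfl
    rw [h1, (scaling P (l : ℝ)⁻¹).iteratedFDeriv_comp_right φ.contDiff x
      (by exact_mod_cast le_top)]
    refine (ContinuousMultilinearMap.norm_compContinuousLinearMap_le _ _).trans ?_
    rw [Finset.prod_const, Finset.card_univ, Fintype.card_fin]
    exact mul_le_mul (hC₂ _) (pow_le_pow_left₀ (norm_nonneg _) (hC₁ l l.2) k) (by positivity)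
      ((norm_nonneg _).trans (hC₂ 0))
  obtain ⟨C₀, hC₀⟩ : ∃ C : ℝ, ∀ l ∈ A, ‖l ^ (-s) * |(scaling P l⁻¹).det|‖ ≤ C := by
    refine isCompact_Icc.exists_bound_of_continuousOn (ContinuousOn.mul ?_ ?_)
    · exact continuousOn_id.rpow_const fun l hl => Or.inl (hA l hl).1.ne'
    · have h1 : Continuous fun μ : ℝ => |(scaling P μ).det| := by
        refine continuous_abs.comp ((contDiff_det (n := 0)).continuous.comp ?_)
        unfold scaling; fun_prop
      exact h1.comp_continuousOn (continuousOn_inv₀.mono fun μ hμ => (hA μ hμ).1.ne')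
  -- One fixed distribution is tested on the bounded family φ ∘ S_l⁻¹; the power of l and the
  -- Jacobian of S_l⁻¹ enter as coefficients bounded on [l₀, 1].
  obtain ⟨C, hC⟩ := bounded_apply_of_pointwise_bounded (fun _ : A => t.inChart κ)
    (fun l => ((l.1 ^ (-s) * |(scaling P l.1⁻¹).det| : ℝ) : ℂ)) (fun f => by
      refine ⟨C₀ * ‖t.inChart κ f‖, fun l => ?_⟩
      rw [norm_mul, Complex.norm_real]
      exact mul_le_mul_of_nonneg_right (hC₀ l l.2) (norm_nonneg _))
    hK (fun y hy => hBV y (hKB hy)) D (fun l => hsuppK l l.2) hder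
  refine ⟨C, fun l hl hl₀l => ?_⟩
  have hl0 : l ≠ 0 := hl.1.ne'
  have hlA : l ∈ A := ⟨hl₀l, hl.2⟩
  have hdet := det_scaling_inv_mul hPP hl0
  have key : (t.pullback (S l) (hS.maps hl)).inChart κ φ =
      t.inChart κ (|(scaling P l⁻¹).det| • D ⟨l, hlA⟩) := by
    refine pullback_inChart_eq t (hS.maps hl) _ _ ?_
    have hα : ∀ y ∈ B, (transportChart (S l) κ).1.symm y = κ.1.symm (scaling P l y) := by
      intro y hy
      change S l (κ.1.symm y) = _
      rw [hSκ l hl _ (hBV y hy).2, κ.1.right_inv (hBκ hy)]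
    refine sameDensity_of_eqOn (T := scaling P l) hBo (fun y hy => ⟨hBκ hy, ?_⟩) hφB
      (fun y hy _ => ?_) (fun y hy => ?_) (fun z hz => ?_) (fun y hy => ?_)
    · change κ.1.symm y ∈ (S l).source
      rw [hS.source_eq l hl]
      exact (hBV y hy).2
    · rw [hα y hy, κ.1.right_inv (hBκ (hB l hl y hy))]
    · rw [hα y (hφB hy)]
      exact κ.1.map_target (hBκ (hB l hl y (hφB hy)))
    · have hz' : z ∈ tsupport (fun w => φ (scaling P l⁻¹ w)) :=
        closure_mono (Function.support_const_smul_subset _ _) hz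
      obtain ⟨y, hy, rfl⟩ := hsupp l hlA hz'
      exact ⟨hBκ (hB l hl y (hφB hy)), y, hφB hy, hα y (hφB hy)⟩
    · rw [(scaling P l).fderiv]
      change φ y = |(scaling P l).det| * (|(scaling P l⁻¹).det| * φ (scaling P l⁻¹ (scaling P l y)))
      rw [scaling_inv_scaling hPP hl0, ← mul_assoc, ← abs_mul, mul_comm (scaling P l).det, hdet,
        abs_one, one_mul]
  have h1 := hC ⟨l, hlA⟩
  rw [key, map_smul]
  simp only [Complex.ofReal_mul] at h1
  rw [Complex.real_smul, ← mul_assoc]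
  exact h1

end Independence

section Independence

variable {m n : ℕ} {M : Type*} [TopologicalSpace M] [ChartedSpace (EuclideanSpace ℝ (Fin m)) M]
  [IsManifold (𝓡 m) ∞ M]

/-- The scaled densities in two linearizing charts correspond to each other. -/
theorem sameDensity_transportChart {κ₁ κ₂ : Chart m M} {B O : Set (EuclideanSpace ℝ (Fin m))}
    (hBo : IsOpen B) (hBO : B ⊆ O) (hO : IsOpen O)
    (hO₁ : ∀ y ∈ O, y ∈ κ₁.1.target ∧ κ₁.1.symm y ∈ κ₂.1.source)
    (hO₂ : ∀ y ∈ O, y ∈ κ₂.1.target ∧ κ₂.1.symm y ∈ κ₁.1.source)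
    (hB : ∀ l ∈ Ioc (0 : ℝ) 1, ∀ y ∈ B, scaling (normalProj m n) l y ∈ B) {V₁ V₂ : Opens M}
    (hV₁ : ∀ y ∈ B, κ₁.1.symm y ∈ V₁)
    (hV₂ : ∀ q, q ∈ V₂ ↔ q ∈ κ₂.1.source ∧ κ₂.1 q ∈ B)
    {S₁ S₂ : PartialDiffeomorph (𝓡 m) (𝓡 m) M M ∞} (hS₁V : S₁.source = V₁) (hS₂V : S₂.source = V₂)
    {l : ℝ} (hl : l ∈ Ioc (0 : ℝ) 1)
    (hS₁ : ∀ y ∈ B, S₁ (κ₁.1.symm y) = κ₁.1.symm (scaling (normalProj m n) l y))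
    (hS₂ : ∀ q ∈ V₂, S₂ q = κ₂.1.symm (scaling (normalProj m n) l (κ₂.1 q)))
    {F φ : EuclideanSpace ℝ (Fin m) → ℝ} (hφB : tsupport φ ⊆ B) (hFB : tsupport F ⊆ B)
    (hF : ∀ w ∈ B, F w = |(fderiv ℝ (κ₂.1 ∘ κ₁.1.symm) (scaling (normalProj m n) l w)).det| *
      φ (scaling (normalProj m n) l⁻¹ (κ₂.1 (κ₁.1.symm (scaling (normalProj m n) l w)))))
    (hg : ∀ z ∈ tsupport φ, scaling (normalProj m n) l⁻¹
      (κ₁.1 (κ₂.1.symm (scaling (normalProj m n) l z))) ∈ B) :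
    SameDensity (transportChart S₁ κ₁).1 (transportChart S₂ κ₂).1 F φ := by
  set P := normalProj m n with hP
  have hPP : ∀ y, P (P y) = P y := normalProj_normalProj
  have hl0 : l ≠ 0 := hl.1.ne'
  have hf : ContDiffOn ℝ ∞ (κ₂.1 ∘ κ₁.1.symm) O :=
    (contDiffOn_transition κ₁ κ₂).mono fun y hy => hO₁ y hy
  have hBV₂ : ∀ z ∈ B, κ₂.1.symm z ∈ V₂ := fun z hz =>
    (hV₂ _).2 ⟨(hO₂ z (hBO hz)).1 |> κ₂.1.map_target, by
      rw [κ₂.1.right_inv (hO₂ z (hBO hz)).1]; exact hz⟩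
  have hS₂' : ∀ z ∈ B, S₂ (κ₂.1.symm z) = κ₂.1.symm (scaling P l z) := fun z hz => by
    rw [hS₂ _ (hBV₂ z hz), κ₂.1.right_inv (hO₂ z (hBO hz)).1]
  -- T is the transition map of the transported charts, since both flows act as S_l in their own
  -- coordinates.
  set T : EuclideanSpace ℝ (Fin m) → EuclideanSpace ℝ (Fin m) := fun y =>
    scaling P l⁻¹ ((κ₂.1 ∘ κ₁.1.symm) (scaling P l y)) with hT
  have hTc : ContinuousOn T B := (scaling P l⁻¹).continuous.comp_continuousOn
    (hf.continuousOn.comp (scaling P l).continuous.continuousOn fun y hy => hBO (hB l hl y hy))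
  -- Where F is nonzero so is φ ∘ T; continuity of T passes to the closures.
  have hFT : ∀ y ∈ tsupport F, T y ∈ tsupport φ := by
    intro y hy
    have hyB := hFB hy
    have h1 : y ∈ closure (B ∩ Function.support F) := hBo.inter_closure ⟨hyB, hy⟩
    have h2 := (hTc.continuousAt (hBo.mem_nhds hyB)).continuousWithinAt.mem_closure_image h1
    refine closure_mono ?_ h2
    rintro _ ⟨w, ⟨hw, hwF⟩, rfl⟩
    rw [Function.mem_support, hF w hw] at hwF
    exact right_ne_zero_of_mul hwF
  have hα : ∀ y ∈ B, (transportChart S₁ κ₁).1.symm y = κ₁.1.symm (scaling P l y) := hS₁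
  have hβ : ∀ z ∈ B, (transportChart S₂ κ₂).1.symm z = κ₂.1.symm (scaling P l z) := hS₂'
  have hβt : ∀ z ∈ B, z ∈ (transportChart S₂ κ₂).1.target := fun z hz =>
    ⟨(hO₂ z (hBO hz)).1, by
      change κ₂.1.symm z ∈ S₂.source
      rw [hS₂V]; exact hBV₂ z hz⟩
  refine sameDensity_of_eqOn (T := T) hBo (fun y hy => ⟨(hO₁ y (hBO hy)).1, ?_⟩) hFB
      (fun y hy hyβ => ?_) (fun y hy => ?_) (fun z hz => ?_) (fun y hy => ?_)
  · change κ₁.1.symm y ∈ S₁.source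
    rw [hS₁V]
    exact hV₁ y hy
  · have hx := (transportChart S₂ κ₂).1.map_source hyβ
    set z := (transportChart S₂ κ₂).1 ((transportChart S₁ κ₁).1.symm y) with hz
    have h1 : (transportChart S₂ κ₂).1.symm z = (transportChart S₁ κ₁).1.symm y :=
      (transportChart S₂ κ₂).1.left_inv hyβ
    have hzV : κ₂.1.symm z ∈ V₂ := by
      have : κ₂.1.symm z ∈ S₂.source := hx.2
      rwa [hS₂V] at this
    have hzB : z ∈ B := by
      have := ((hV₂ _).1 hzV).2
      rwa [κ₂.1.right_inv hx.1] at this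
    rw [hβ z hzB, hα y hy] at h1
    have h2 := congrArg κ₂.1 h1
    rw [κ₂.1.right_inv (hO₂ _ (hBO (hB l hl z hzB))).1] at h2
    change z = scaling P l⁻¹ (κ₂.1 (κ₁.1.symm (scaling P l y)))
    rw [← h2, scaling_inv_scaling hPP hl0]
  · have hyB := hFB hy
    have hTB : T y ∈ B := hφB (hFT y hy)
    have h1 : (transportChart S₁ κ₁).1.symm y = (transportChart S₂ κ₂).1.symm (T y) := by
      rw [hα y hyB, hβ _ hTB, hT]
      change κ₁.1.symm (scaling P l y) = κ₂.1.symm (scaling P l (scaling P l⁻¹ _))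
      rw [scaling_scaling_inv hPP hl0]
      exact (κ₂.1.left_inv (hO₁ _ (hBO (hB l hl y hyB))).2).symm
    rw [h1]
    exact (transportChart S₂ κ₂).1.map_target (hβt _ hTB)
  · refine ⟨hβt z (hφB hz), _, hg z hz, ?_⟩
    rw [hα _ (hg z hz), hβ z (hφB hz), scaling_scaling_inv hPP hl0]
    exact κ₁.1.left_inv (hO₂ _ (hBO (hB l hl z (hφB hz)))).2
  · rw [hT, det_fderiv_scaling_conj hPP hl0, hF y hy]
    · rfl
    · exact (hf.contDiffAt (hO.mem_nhds (hBO (hB l hl y hy)))).differentiableAt (by simp)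

omit [IsManifold (𝓡 m) ∞ M] in
/-- The transition map between two linearizing charts, on the submanifold. -/
theorem transition_of_isAdapted {I : Set M} {κ₀ κ₁ κ₂ : Chart m M}
    (hκ₂ : κ₂.1.source ⊆ κ₀.1.source) (hA₁ : IsAdapted n I κ₁.1)
    (hI₁ : ∀ q ∈ κ₁.1.source, q ∈ I → κ₁.1 q = κ₀.1 q)
    (hI₂ : ∀ q ∈ κ₂.1.source, q ∈ I → κ₂.1 q = κ₀.1 q)
    (hd₁ : ∀ y ∈ κ₁.1.target, normalProj m n y = 0 → ∀ w,
      normalProj m n (fderiv ℝ (κ₀.1 ∘ κ₁.1.symm) y w) = normalProj m n w)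
    (hd₂ : ∀ y ∈ κ₂.1.target, normalProj m n y = 0 → ∀ w,
      normalProj m n (fderiv ℝ (κ₀.1 ∘ κ₂.1.symm) y w) = normalProj m n w)
    {y : EuclideanSpace ℝ (Fin m)} (hy : y ∈ κ₁.1.target) (hyκ₂ : κ₁.1.symm y ∈ κ₂.1.source)
    (hy0 : normalProj m n y = 0) :
    (κ₂.1 ∘ κ₁.1.symm) y = y ∧ ∀ w,
      normalProj m n (fderiv ℝ (κ₂.1 ∘ κ₁.1.symm) y w) = normalProj m n w := by
  have hqI : κ₁.1.symm y ∈ I := (hA₁.symm_mem_iff hy).2 hy0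
  have hfy : κ₂.1 (κ₁.1.symm y) = y := by
    rw [hI₂ _ hyκ₂ hqI, ← hI₁ _ (κ₁.1.map_target hy) hqI, κ₁.1.right_inv hy]
  refine ⟨hfy, fun w => ?_⟩
  have hyt : y ∈ κ₂.1.target := hfy ▸ κ₂.1.map_source hyκ₂
  have hys : κ₂.1.symm y = κ₁.1.symm y := by
    conv_lhs => rw [← hfy]
    exact κ₂.1.left_inv hyκ₂
  have hd : ∀ κ κ' : Chart m M, y ∈ κ.1.target → κ.1.symm y ∈ κ'.1.source →
      HasFDerivAt (κ'.1 ∘ κ.1.symm) (fderiv ℝ (κ'.1 ∘ κ.1.symm) y) y := fun κ κ' h h' =>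
    (((contDiffOn_transition κ κ').contDiffAt
      ((κ.1.symm.trans κ'.1).open_source.mem_nhds ⟨h, h'⟩)).differentiableAt (by simp)).hasFDerivAt
  have h1 := hd κ₁ κ₂ hy hyκ₂
  have h2 : HasFDerivAt (κ₀.1 ∘ κ₂.1.symm) (fderiv ℝ (κ₀.1 ∘ κ₂.1.symm) y)
      ((κ₂.1 ∘ κ₁.1.symm) y) := by
    rw [Function.comp_apply, hfy]
    exact hd κ₂ κ₀ hyt (hys ▸ hκ₂ hyκ₂)
  have hE : κ₀.1 ∘ κ₁.1.symm =ᶠ[𝓝 y] (κ₀.1 ∘ κ₂.1.symm) ∘ (κ₂.1 ∘ κ₁.1.symm) := by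
    filter_upwards [(κ₁.1.isOpen_inter_preimage_symm κ₂.1.open_source).mem_nhds ⟨hy, hyκ₂⟩]
      with z hz
    simp only [Function.comp_apply]
    rw [κ₂.1.left_inv hz.2]
  have h3 := (h2.comp y h1).congr_of_eventuallyEq hE
  have h4 := hd₁ y hy hy0 w
  rw [h3.fderiv, ContinuousLinearMap.comp_apply, hd₂ y hyt hy0] at h4
  exact h4

variable [T2Space M]

/-- The linearizing charts of both fields are built from the same adapted chart, so their transition
map becomes trivial under rescaling. Pairing with the second flow then equals pairing with the first
flow against a bounded family of densities. -/
theorem localScaleSpace_subset {I : Set M} (hI : IsEmbeddedSubmanifold (m := m) n I) (hn : n < m)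
    {U : Opens M} {p : M} (hp : p ∈ I) (hU : (U : Set M) ∪ I ∈ 𝓝 p)
    (ρ₁ ρ₂ : EulerFieldNear m I p) (s : ℝ) :
    localScaleSpace ρ₁ s U ⊆ localScaleSpace ρ₂ s U := by
  rintro t ⟨V₁, hV₁U, -, hV₁p, S₁, hS₁, hbd⟩
  obtain ⟨κ, hκ, hpκ, hIκ⟩ := hI.2 p hp
  set κ₀ : Chart m M := ⟨κ, hκ⟩ with hκ₀
  have hA : IsAdapted n I κ₀.1 := fun q hq => (hIκ q hq).trans normalProj_eq_zero_iff.symm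
  obtain ⟨κ₁, hpκ₁, hκ₁₀, -, hL₁, hA₁, hI₁, hd₁⟩ :=
    exists_linearizing_chart κ₀ hA hn hp hpκ ρ₁.mem_domain ρ₁.isEuler
  obtain ⟨κ₂, hpκ₂, hκ₂₀, hκ₂ρ, hL₂, hA₂, hI₂, hd₂⟩ :=
    exists_linearizing_chart κ₀ hA hn hp hpκ ρ₂.mem_domain ρ₂.isEuler
  set P := normalProj m n with hP
  have hPP : ∀ y, P (P y) = P y := normalProj_normalProj
  have hPS : ∀ l ∈ Icc (0 : ℝ) 1, ∀ y, ‖scaling P l y‖ ≤ ‖y‖ := fun l hl y =>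
    norm_scaling_normalProj_le hl y
  set y₀ := κ₁.1 p with hy₀
  have hy₀0 : P y₀ = 0 := (hA₁ p hpκ₁).1 hp
  have hy₀₂ : κ₂.1 p = y₀ := by rw [hI₂ p hpκ₂ hp, hy₀, hI₁ p hpκ₁ hp]
  -- Coordinates usable in both charts; the interior of U ∪ I is included so that the new convex set
  -- lies in U.
  set O : Set (EuclideanSpace ℝ (Fin m)) := (κ₁.1.target ∩ κ₁.1.symm ⁻¹' κ₂.1.source) ∩
    (κ₂.1.target ∩ κ₂.1.symm ⁻¹' (κ₁.1.source ∩ interior ((U : Set M) ∪ I))) with hOdef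
  have hO : IsOpen O := (κ₁.1.isOpen_inter_preimage_symm κ₂.1.open_source).inter
    (κ₂.1.isOpen_inter_preimage_symm (κ₁.1.open_source.inter isOpen_interior))
  have hyO : y₀ ∈ O := by
    refine ⟨⟨κ₁.1.map_source hpκ₁, ?_⟩, hy₀₂ ▸ κ₂.1.map_source hpκ₂, ?_⟩
    · rw [mem_preimage, hy₀, κ₁.1.left_inv hpκ₁]
      exact hpκ₂
    · rw [mem_preimage, ← hy₀₂, κ₂.1.left_inv hpκ₂]
      exact ⟨hpκ₁, mem_interior_iff_mem_nhds.2 hU⟩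
  have hO₁ : ∀ y ∈ O, y ∈ κ₁.1.target ∧ κ₁.1.symm y ∈ κ₂.1.source := fun y hy => hy.1
  have hO₂ : ∀ y ∈ O, y ∈ κ₂.1.target ∧ κ₂.1.symm y ∈ κ₁.1.source := fun y hy =>
    ⟨hy.2.1, hy.2.2.1⟩
  have htr₁ := fun y (hy : y ∈ O) => transition_of_isAdapted hκ₂₀ hA₁ hI₁ hI₂ hd₁ hd₂
    (hO₁ y hy).1 (hO₁ y hy).2
  have htr₂ := fun y (hy : y ∈ O) => transition_of_isAdapted hκ₁₀ hA₂ hI₂ hI₁ hd₂ hd₁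
    (hO₂ y hy).1 (hO₂ y hy).2
  obtain ⟨r, hr, hrO, hfam⟩ := exists_density_family hPP hy₀0 hPS hO hyO
    ((contDiffOn_transition κ₁ κ₂).mono hO₁) ((contDiffOn_transition κ₂ κ₁).mono hO₂)
    (fun y hy h0 => (htr₁ y hy h0).1) (fun y hy h0 => (htr₂ y hy h0).1)
    (fun y hy h0 => (htr₁ y hy h0).2) (fun y hy h0 => (htr₂ y hy h0).2)
    (fun y hy => by
      change κ₁.1 (κ₂.1.symm (κ₂.1 (κ₁.1.symm y))) = y
      rw [κ₂.1.left_inv (hO₁ y hy).2, κ₁.1.right_inv (hO₁ y hy).1])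
  set B : Set (EuclideanSpace ℝ (Fin m)) := Metric.ball y₀ r ∩ chartImage κ₁.1 V₁ with hBdef
  have hBo : IsOpen B := Metric.isOpen_ball.inter (chartImage κ₁.1 V₁).isOpen
  have hBr : B ⊆ Metric.ball y₀ r := inter_subset_left
  have hBO : B ⊆ O := hBr.trans hrO
  have hBV₁ : ∀ y ∈ B, κ₁.1.symm y ∈ V₁ := fun y hy => hy.2.2
  have hS₁κ : ∀ l ∈ Ioc (0 : ℝ) 1, ∀ y ∈ B, S₁ l (κ₁.1.symm y) = κ₁.1.symm (scaling P l y) :=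
    fun l hl y hy => hL₁.scalingFlow_apply hS₁ hy₀0 (fun z hz => (hO₁ z (hrO hz)).1) hy.1
      (hBV₁ y hy) hl
  have hBs : ∀ l ∈ Ioc (0 : ℝ) 1, ∀ y ∈ B, scaling P l y ∈ B := by
    intro l hl y hy
    have h1 := scaling_mem_ball hy₀0 hPS ⟨hl.1.le, hl.2⟩ hy.1
    refine ⟨h1, (hO₁ _ (hrO h1)).1, ?_⟩
    rw [mem_preimage, ← hS₁κ l hl y hy]
    exact hS₁.stable l hl _ (hBV₁ y hy)
  have hBκ₂ : B ⊆ κ₂.1.target := fun y hy => (hO₂ y (hBO hy)).1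
  -- The same coordinate set B is read in the second chart, so V₂ is in general not contained in V₁.
  let V₂ : Opens M := ⟨κ₂.1.source ∩ κ₂.1 ⁻¹' B, κ₂.1.isOpen_inter_preimage hBo⟩
  have hV₂ : ∀ q, q ∈ V₂ ↔ q ∈ κ₂.1.source ∧ κ₂.1 q ∈ B := fun q => Iff.rfl
  obtain ⟨S₂, hS₂, hS₂κ⟩ := hL₂.exists_isScalingFlow hBo hBκ₂ hBs hV₂
  have hV₂U : V₂ ≤ U := by
    rintro q ⟨hq, hqB⟩
    -- On I the charts agree, so q lies in V₁ ⊆ U. Off I, membership in U comes from U ∪ I being a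
    -- neighbourhood of p.
    by_cases hqI : q ∈ I
    · have h0 : P (κ₂.1 q) = 0 := (hA₂ q hq).1 hqI
      have h1 := hBV₁ _ hqB
      have h2 := (htr₂ _ (hBO hqB) h0).1
      rw [Function.comp_apply, κ₂.1.left_inv hq] at h2
      have h3 : q ∈ κ₁.1.source := by
        have := (hO₂ _ (hBO hqB)).2
        rwa [κ₂.1.left_inv hq] at this
      rw [← h2, κ₁.1.left_inv h3] at h1
      exact hV₁U h1
    · have h1 := interior_subset (hBO hqB).2.2.2
      rw [κ₂.1.left_inv hq] at h1
      exact h1.resolve_right hqI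
  refine ⟨V₂, hV₂U, fun q hq => hκ₂ρ hq.1, ?_, ?_⟩
  · have h1 := closure_mem_nhds_of_mapsTo ((κ₁.1.restrOpen _
      (κ₁.1.isOpen_inter_preimage (Metric.isOpen_ball (x := y₀) (ε := r)))).trans κ₂.1.symm)
      (p := p) (V := V₁) (W := V₂) ?_ hV₁p ?_
    · change closure _ ∈ 𝓝 (κ₂.1.symm (κ₁.1 p)) at h1
      rwa [← hy₀, ← hy₀₂, κ₂.1.left_inv hpκ₂] at h1
    · exact ⟨⟨hpκ₁, hpκ₁, Metric.mem_ball_self hr⟩, (hO₂ _ hyO).1⟩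
    · rintro q hq ⟨⟨-, hqκ, hqr⟩, -⟩
      have hqB : κ₁.1 q ∈ B :=
        ⟨hqr, κ₁.1.map_source hqκ, by rw [mem_preimage, κ₁.1.left_inv hqκ]; exact hq⟩
      refine (hV₂ _).2 ⟨κ₂.1.map_target (hBκ₂ hqB), ?_⟩
      change κ₂.1 (κ₂.1.symm (κ₁.1 q)) ∈ B
      rw [κ₂.1.right_inv (hBκ₂ hqB)]
      exact hqB
  refine mem_scaleSpace_of_chart κ₂ (fun q hq => hq.1) hS₂ fun φ => ?_
  have hφB : tsupport φ ⊆ B := fun y hy => by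
    have h1 := φ.tsupport_subset hy
    have h2 := ((hV₂ _).1 h1.2).2
    rwa [κ₂.1.right_inv h1.1] at h2
  obtain ⟨l₀, hl₀, K, hK, hKB, F, hF, hFK, hFφ, hφg⟩ :=
    hfam B hBo hBr φ φ.contDiff φ.hasCompactSupport hφB
  -- The comparison family F is only available for l ≤ l₀; the compact range [l₀, 1] needs no
  -- comparison of flows.
  obtain ⟨C₁, hC₁⟩ := exists_bound_of_le hBo hBκ₂ hBs hV₂ hS₂ hS₂κ s (t.restrict hV₂U) φ hl₀.1
  have hKV₁ : K ⊆ chartImage κ₁.1 V₁ := hKB.trans inter_subset_right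
  let Fl : ℝ → 𝓓(chartImage κ₁.1 V₁, ℝ) := fun l => ⟨fun w => F (l, w),
    hF.comp (contDiff_const.prodMk contDiff_id),
    hK.of_isClosed_subset (isClosed_tsupport _) (hFK l), (hFK l).trans hKV₁⟩
  have hIoc : ∀ l : Ioc (0 : ℝ) l₀, (l : ℝ) ∈ Ioc (0 : ℝ) 1 := fun l =>
    ⟨l.2.1, l.2.2.trans hl₀.2⟩
  obtain ⟨C₂, hC₂⟩ := bounded_apply_of_pointwise_bounded
    (fun l : Ioc (0 : ℝ) l₀ => ((t.restrict hV₁U).pullback (S₁ l) (hS₁.maps (hIoc l))).inChart κ₁)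
    (fun l => ((l.1 ^ (-s) : ℝ) : ℂ))
    (fun f => (hbd κ₁ f).imp fun C hC l => hC l (hIoc l)) hK hKV₁ (fun l => Fl l)
    (fun l => hFK l) (fun k => by
      obtain ⟨C, hC⟩ := bounded_iteratedFDeriv_of_contDiff hF hK hFK (isCompact_Icc (a := 0)
        (b := l₀)) k
      exact ⟨C, fun l x => hC l ⟨l.2.1.le, l.2.2⟩ x⟩)
  refine ⟨max C₁ C₂, fun l hl => ?_⟩
  rcases le_or_gt l₀ l with h | h
  · exact (hC₁ l hl h).trans (le_max_left _ _)
  · have hl' : l ∈ Ioc 0 l₀ := ⟨hl.1, h.le⟩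
    refine le_trans (le_of_eq ?_) ((hC₂ ⟨l, hl'⟩).trans (le_max_right _ _))
    congr 2
    refine (pullback_restrict_inChart_eq hV₁U hV₂U t (hS₁.maps hl) (hS₂.maps hl) (Fl l) φ ?_).symm
    exact sameDensity_transportChart hBo hBO hO hO₁ hO₂ hBs hBV₁ hV₂ (hS₁.source_eq l hl)
      (hS₂.source_eq l hl) hl (hS₁κ l hl) (hS₂κ l hl) hφB ((hFK l).trans hKB) (hFφ l hl')
      (hφg l hl')

end Independence

/-! ### Invariance under diffeomorphisms -/

section Invariance

variable {m n : ℕ} {M M' : Type*} [TopologicalSpace M] [ChartedSpace (EuclideanSpace ℝ (Fin m)) M]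
  [IsManifold (𝓡 m) ∞ M]
  [TopologicalSpace M'] [ChartedSpace (EuclideanSpace ℝ (Fin m)) M'] [IsManifold (𝓡 m) ∞ M']

theorem exists_chart_restrict (κ : Chart m M) {O : Set (EuclideanSpace ℝ (Fin m))}
    (hO : IsOpen O) (hOκ : O ⊆ κ.1.target) :
    ∃ κ' : Chart m M, κ'.1.source = κ.1.source ∩ κ.1 ⁻¹' O ∧ κ'.1.target = O ∧
      (∀ q, κ'.1 q = κ.1 q) ∧ ∀ y, κ'.1.symm y = κ.1.symm y := by
  refine ⟨⟨κ.1.trans (OpenPartialHomeomorph.ofSet O hO), ?_⟩, rfl, ?_, fun q => rfl, fun y => rfl⟩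
  · apply OpenPartialHomeomorph.mem_maximalAtlas_of_contMDiffOn
    · exact (contMDiffOn_of_mem_maximalAtlas κ.2).mono inter_subset_left
    · exact (contMDiffOn_symm_of_mem_maximalAtlas κ.2).mono fun y hy => hOκ hy.1
  · exact inter_eq_left.2 hOκ

/-- Weak homogeneity is preserved if `Φ` intertwines two scaling flows. -/
theorem pullback_mem_localScaleSpace {I : Set M} {p : M} {s : ℝ}
    (Φ : PartialDiffeomorph (𝓡 m) (𝓡 m) M M' ∞) {U V : Opens M} {U' V' : Opens M'}
    (hΦU : ∀ x ∈ U, x ∈ Φ.source ∧ Φ x ∈ U') (t : ManifoldDistribution m M' U')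
    (ρ : EulerFieldNear m I p) (hVU : V ≤ U) (hVρ : V ≤ ρ.domain)
    (hVp : closure (V : Set M) ∈ 𝓝 p) {S : ℝ → PartialDiffeomorph (𝓡 m) (𝓡 m) M M ∞}
    (hS : IsScalingFlow ρ.field V S) {ρ' : (x : M') → TangentSpace (𝓡 m) x}
    {S' : ℝ → PartialDiffeomorph (𝓡 m) (𝓡 m) M' M' ∞} (hS' : IsScalingFlow ρ' V' S')
    (hVU' : V' ≤ U') (hVV' : ∀ q ∈ V, Φ q ∈ V')
    (hSS' : ∀ l ∈ Ioc (0 : ℝ) 1, ∀ q ∈ V, Φ (S l q) = S' l (Φ q))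
    (hbd : ∀ (κ : Chart m M') (φ : 𝓓(chartImage κ.1 V', ℝ)), ∃ C : ℝ,
      ∀ (l : ℝ) (hl : l ∈ Ioc (0 : ℝ) 1),
        ‖((l ^ (-s) : ℝ) : ℂ) *
          ((t.restrict hVU').pullback (S' l) (hS'.maps hl)).inChart κ φ‖ ≤ C) :
    t.pullback Φ hΦU ∈ localScaleSpace ρ s U := by
  refine ⟨V, hVU, hVρ, hVp, S, hS, fun κ φ => ?_⟩
  have hle : chartImage κ.1 V ≤ chartImage (transportChart Φ κ).1 V' := fun y hy =>
    ⟨⟨hy.1, (hΦU _ (hVU hy.2)).1⟩, hVV' _ hy.2⟩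
  let ψ : 𝓓(chartImage (transportChart Φ κ).1 V', ℝ) :=
    ⟨φ, φ.contDiff, φ.hasCompactSupport, φ.tsupport_subset.trans hle⟩
  obtain ⟨C, hC⟩ := hbd (transportChart Φ κ) ψ
  refine ⟨C, fun l hl => le_trans (le_of_eq ?_) (hC l hl)⟩
  congr 2
  refine t.compat _ _ _ _ ?_
  have h1 : chartImage κ.1 V ≤ chartImage (transportChart (S l) κ).1 V := fun y hy =>
    ⟨⟨hy.1, (hS.maps hl _ hy.2).1⟩, (hS.maps hl _ hy.2).2⟩
  have h2 : chartImage (transportChart (S l) κ).1 V ≤ chartImage (transportChart (S l) κ).1 U :=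
    fun y hy => ⟨hy.1, hVU hy.2⟩
  have h3 : chartImage (transportChart (S l) κ).1 U ≤
      chartImage (transportChart Φ (transportChart (S l) κ)).1 U' := fun y hy =>
    ⟨⟨hy.1, (hΦU _ hy.2).1⟩, (hΦU _ hy.2).2⟩
  have h4 : chartImage (transportChart Φ κ).1 V' ≤
      chartImage (transportChart (S' l) (transportChart Φ κ)).1 V' := fun y hy =>
    ⟨⟨hy.1, (hS'.maps hl _ hy.2).1⟩, (hS'.maps hl _ hy.2).2⟩
  have h5 : chartImage (transportChart (S' l) (transportChart Φ κ)).1 V' ≤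
      chartImage (transportChart (S' l) (transportChart Φ κ)).1 U' :=
    fun y hy => ⟨hy.1, hVU' hy.2⟩
  -- The intertwining relation says exactly that the two composed charts have equal inverses on the
  -- support of φ.
  have key : SameDensity (transportChart Φ (transportChart (S l) κ)).1
      (transportChart (S' l) (transportChart Φ κ)).1 φ φ := by
    refine sameDensity_self_of_eqOn (chartImage κ.1 V).isOpen φ.tsupport_subset
      (fun y hy => (h3 (h2 (h1 hy))).1) (fun y hy => (h5 (h4 (hle hy))).1) fun y hy => ?_
    exact hSS' l hl _ hy.2
  have hψ : (ψ : EuclideanSpace ℝ (Fin m) → ℝ) = φ := rfl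
  simpa [h1, h2, h3, h4, h5, hψ] using key

/-- Transporting κ by Φ and back changes its domain but not its inverse over U. -/
theorem pullback_pullback_symm (Φ : PartialDiffeomorph (𝓡 m) (𝓡 m) M M' ∞) {U : Opens M}
    {U' : Opens M'} (hΦ : ∀ x ∈ U, x ∈ Φ.source ∧ Φ x ∈ U')
    (hΦ' : ∀ x ∈ U', x ∈ Φ.symm.source ∧ Φ.symm x ∈ U) (t : ManifoldDistribution m M U) :
    (t.pullback Φ.symm hΦ').pullback Φ hΦ = t := by
  ext1
  funext κ
  ext φ
  refine t.compat _ _ _ _ ?_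
  have h1 : chartImage κ.1 U ≤ chartImage (transportChart Φ κ).1 U' :=
    fun y hy => ⟨⟨hy.1, (hΦ _ hy.2).1⟩, (hΦ _ hy.2).2⟩
  have h2 : chartImage (transportChart Φ κ).1 U' ≤
      chartImage (transportChart Φ.symm (transportChart Φ κ)).1 U :=
    fun y hy => ⟨⟨hy.1, (hΦ' _ hy.2).1⟩, (hΦ' _ hy.2).2⟩
  have key : SameDensity (transportChart Φ.symm (transportChart Φ κ)).1 κ.1 φ φ := by
    refine sameDensity_self_of_eqOn (chartImage κ.1 U).isOpen φ.tsupport_subset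
      (fun y hy => (h2 (h1 hy)).1) (fun y hy => hy.1) fun y hy => ?_
    exact Φ.left_inv' (hΦ _ hy.2).1
  simpa [h1, h2] using key

omit [IsManifold (𝓡 m) ∞ M] [IsManifold (𝓡 m) ∞ M'] in
theorem mfderiv_symm_apply_pullField (Φ : PartialDiffeomorph (𝓡 m) (𝓡 m) M M' ∞)
    (ρ : (x : M') → TangentSpace (𝓡 m) x) {x : M'} (hx : x ∈ Φ.target) :
    mfderiv (𝓡 m) (𝓡 m) Φ.symm x (ρ x) = pullField Φ ρ (Φ.symm x) := by
  have he : Φ.toOpenPartialHomeomorph.MDifferentiable (𝓡 m) (𝓡 m) :=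
    ⟨Φ.contMDiffOn.mdifferentiableOn (by simp), Φ.symm.contMDiffOn.mdifferentiableOn (by simp)⟩
  have hxs : Φ.symm x ∈ Φ.source := Φ.map_target' hx
  refine he.mfderiv_injective hxs ?_
  have h1 := congrArg (fun A => A (ρ x)) (he.comp_symm_deriv hx)
  have h2 : Φ (Φ.symm x) = x := Φ.right_inv' hx
  refine Eq.trans (h1 : _ = ρ x) ?_
  have h3 := mfderiv_pullField Φ ρ hxs
  rw [h2] at h3
  exact h3.symm

end Invariance

section Invariance

variable {m n : ℕ} {M M' : Type*} [TopologicalSpace M] [ChartedSpace (EuclideanSpace ℝ (Fin m)) M]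
  [IsManifold (𝓡 m) ∞ M]
  [TopologicalSpace M'] [ChartedSpace (EuclideanSpace ℝ (Fin m)) M'] [IsManifold (𝓡 m) ∞ M']

/-- If `I` is open and closed in `Ω`, then every smooth vector field on `Ω` is Euler. -/
theorem isEuler_of_isOpen {I : Set M} {Ω : Opens M} (hI : IsOpen (I ∩ (Ω : Set M)))
    (hI' : IsOpen ((Ω : Set M) \ I)) {ρ : (x : M) → TangentSpace (𝓡 m) x}
    (hρ : ContMDiffOn (𝓡 m) (𝓡 m).tangent ∞
      (fun x => (⟨x, ρ x⟩ : TangentBundle (𝓡 m) M)) Ω) : IsEuler I Ω ρ := by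
  classical
  refine ⟨hρ, fun f hf => ?_⟩
  have h0 : ∀ x ∈ I ∩ (Ω : Set M), lieDeriv ρ f x - f x = 0 := by
    intro x hx
    have hE : f =ᶠ[𝓝 x] fun _ => 0 := by
      filter_upwards [hI.mem_nhds hx] with z hz using hf.2 z hz
    have hd : lieDeriv ρ f x = 0 := by
      unfold lieDeriv
      rw [hE.mfderiv_eq, mfderiv_const]
      rfl
    rw [hd, hf.2 x hx, sub_zero]
  -- One product suffices: ρ f - f already vanishes on I, and the indicator of the complement is
  -- smooth on Ω because I is open and closed there.
  refine ⟨1, fun _ x => lieDeriv ρ f x - f x, fun _ => indicator Iᶜ 1, fun _ => ⟨⟨?_, ?_⟩, ?_, ?_⟩,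
    fun x hx => ?_⟩
  · exact (contMDiffOn_lieDeriv hρ hf.1).sub hf.1
  · exact h0
  · intro x hx
    refine ContMDiffAt.contMDiffWithinAt ?_
    by_cases hxI : x ∈ I
    · refine (contMDiffAt_const (c := (0 : ℝ))).congr_of_eventuallyEq ?_
      filter_upwards [hI.mem_nhds ⟨hxI, hx⟩] with z hz
      simp [hz.1]
    · refine (contMDiffAt_const (c := (1 : ℝ))).congr_of_eventuallyEq ?_
      filter_upwards [hI'.mem_nhds ⟨hx, hxI⟩] with z hz
      simp [hz.2]
  · intro x hx
    simp [hx.1]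
  · by_cases hxI : x ∈ I
    · simp [h0 x ⟨hxI, hx⟩, hxI]
    · simp [hxI]

/-- The invariance of weak homogeneity in positive codimension. -/
theorem exists_mem_localScaleSpace_of_lt [T2Space M'] {I : Set M} {I' : Set M'} {s : ℝ}
    (hI' : IsEmbeddedSubmanifold (m := m) n I') (hn : n < m)
    (Φ : PartialDiffeomorph (𝓡 m) (𝓡 m) M M' ∞)
    (hΦI : ∀ q ∈ Φ.source, q ∈ I ↔ Φ q ∈ I') {U : Opens M} {U' : Opens M'}
    (hΦU : ∀ x ∈ U, x ∈ Φ.source ∧ Φ x ∈ U') (hUU' : ∀ x ∈ Φ.source, Φ x ∈ U' → x ∈ U)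
    {p : M} (hp : p ∈ I) (hpΦ : p ∈ Φ.source) {t : ManifoldDistribution m M' U'}
    {ρ' : EulerFieldNear m I' (Φ p)} (ht : t ∈ localScaleSpace ρ' s U') :
    ∃ ρ : EulerFieldNear m I p, t.pullback Φ hΦU ∈ localScaleSpace ρ s U := by
  obtain ⟨V', hV'U', -, hV'p, S', hS', hbd⟩ := ht
  have hp' : Φ p ∈ I' := (hΦI p hpΦ).1 hp
  obtain ⟨κ, hκ, hpκ, hIκ⟩ := hI'.2 _ hp'
  obtain ⟨κ', hpκ', -, -, hL', hA', -, -⟩ := exists_linearizing_chart ⟨κ, hκ⟩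
    (fun q hq => (hIκ q hq).trans normalProj_eq_zero_iff.symm) hn hp' hpκ
    ρ'.mem_domain ρ'.isEuler
  set P := normalProj m n with hP
  have hPS : ∀ l ∈ Icc (0 : ℝ) 1, ∀ y, ‖scaling P l y‖ ≤ ‖y‖ := fun l hl y =>
    norm_scaling_normalProj_le hl y
  set y₀ := κ'.1 (Φ p) with hy₀
  have hy₀0 : P y₀ = 0 := (hA' _ hpκ').1 hp'
  obtain ⟨r, hr, hball⟩ := Metric.isOpen_iff.1
    (κ'.1.isOpen_inter_preimage_symm Φ.open_target) y₀
    ⟨κ'.1.map_source hpκ', by rw [mem_preimage, hy₀, κ'.1.left_inv hpκ']; exact Φ.map_source' hpΦ⟩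
  obtain ⟨κ₁, hsrc, htgt, hfun, hsymm⟩ := exists_chart_restrict (transportChart Φ.symm κ')
    (Metric.isOpen_ball (x := y₀) (ε := r)) hball
  have hfun' : ∀ q, κ₁.1 q = κ'.1 (Φ q) := hfun
  have hsymm' : ∀ y, κ₁.1.symm y = Φ.symm (κ'.1.symm y) := hsymm
  have hsrc' : ∀ q, q ∈ κ₁.1.source ↔ q ∈ Φ.source ∧ Φ q ∈ κ'.1.source ∧
      κ'.1 (Φ q) ∈ Metric.ball y₀ r := by
    intro q
    rw [hsrc]
    exact ⟨fun h => ⟨h.1.1, h.1.2, h.2⟩, fun h => ⟨⟨h.1, h.2.1⟩, h.2.2⟩⟩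
  have hpκ₁ : p ∈ κ₁.1.source := (hsrc' p).2 ⟨hpΦ, hpκ', Metric.mem_ball_self hr⟩
  have hA₁ : IsAdapted n I κ₁.1 := by
    intro q hq
    obtain ⟨h1, h2, -⟩ := (hsrc' q).1 hq
    rw [hfun', hΦI q h1]
    exact hA' _ h2
  -- The Euler condition tests functions on the whole domain and does not restrict directly to
  -- smaller open sets. Instead of pulling ρ' back, one takes the linear field in the transported
  -- chart, Euler by Hadamard's lemma on the ball; in coordinates its flow is that of ρ'.
  let ρ : EulerFieldNear m I p := ⟨⟨κ₁.1.source, κ₁.1.open_source⟩, hpκ₁,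
    pullField (chartDiffeo κ₁) fun y => normalProj m n y,
    isEuler_pullField_normalProj κ₁ hA₁ htgt hy₀0⟩
  have hL₁ : IsLinearizing n ρ.field κ₁ := by
    intro y hy
    have h := mfderiv_symm_coordField κ₁ ρ.field hy
    rwa [coordField_pullField κ₁ _ hy] at h
  have hball' : Metric.ball y₀ r ⊆ κ'.1.target := fun y hy => (hball hy).1
  set B : Set (EuclideanSpace ℝ (Fin m)) := Metric.ball y₀ r ∩ chartImage κ'.1 V' with hBdef
  have hBo : IsOpen B := Metric.isOpen_ball.inter (chartImage κ'.1 V').isOpen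
  have hS'κ : ∀ l ∈ Ioc (0 : ℝ) 1, ∀ y ∈ B, S' l (κ'.1.symm y) = κ'.1.symm (scaling P l y) :=
    fun l hl y hy => hL'.scalingFlow_apply hS' hy₀0 hball' hy.1 hy.2.2 hl
  have hBs : ∀ l ∈ Ioc (0 : ℝ) 1, ∀ y ∈ B, scaling P l y ∈ B := by
    intro l hl y hy
    have h1 := scaling_mem_ball hy₀0 hPS ⟨hl.1.le, hl.2⟩ hy.1
    refine ⟨h1, hball' h1, ?_⟩
    rw [mem_preimage, ← hS'κ l hl y hy]
    exact hS'.stable l hl _ hy.2.2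
  let V : Opens M := ⟨κ₁.1.source ∩ κ₁.1 ⁻¹' B, κ₁.1.isOpen_inter_preimage hBo⟩
  obtain ⟨S, hS, hSκ⟩ := hL₁.exists_isScalingFlow hBo (fun y hy => htgt ▸ hy.1) hBs
    (V := V) (fun q => Iff.rfl)
  have hVV' : ∀ q ∈ V, Φ q ∈ V' := by
    rintro q ⟨hq, hqB⟩
    have h1 := hqB.2.2
    rw [mem_preimage, hfun', κ'.1.left_inv ((hsrc' q).1 hq).2.1] at h1
    exact h1
  refine ⟨ρ, pullback_mem_localScaleSpace Φ hΦU t ρ (V := V)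
    (fun q hq => hUU' q ((hsrc' q).1 hq.1).1 (hV'U' (hVV' q hq))) (fun q hq => hq.1) ?_ hS hS'
    hV'U' hVV' (fun l hl q hq => ?_) hbd⟩
  · have h1 := closure_mem_nhds_of_mapsTo (Φ.symm.toOpenPartialHomeomorph.restrOpen _
      (κ'.1.isOpen_inter_preimage (Metric.isOpen_ball (x := y₀) (ε := r))))
      (p := Φ p) (V := V') (W := V)
      ⟨Φ.map_source' hpΦ, hpκ', Metric.mem_ball_self hr⟩ hV'p ?_
    · change closure _ ∈ 𝓝 (Φ.symm (Φ p)) at h1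
      have h2 : Φ.symm (Φ p) = p := Φ.left_inv' hpΦ
      rwa [h2] at h1
    · rintro q hq ⟨hqΦ, hqκ, hqr⟩
      have h2 : Φ (Φ.symm q) = q := Φ.right_inv' hqΦ
      have h3 : Φ.symm q ∈ Φ.source := Φ.map_target' hqΦ
      change Φ.symm q ∈ κ₁.1.source ∧ κ₁.1 (Φ.symm q) ∈ B
      rw [hsrc', hfun', h2]
      exact ⟨⟨h3, hqκ, hqr⟩, hqr, κ'.1.map_source hqκ, by
        rw [mem_preimage, κ'.1.left_inv hqκ]; exact hq⟩
  · obtain ⟨hq1, hq2, hq3⟩ := (hsrc' q).1 hq.1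
    have hqB : κ'.1 (Φ q) ∈ B := hfun' q ▸ hq.2
    have h1 := hS'κ l hl _ hqB
    rw [κ'.1.left_inv hq2] at h1
    rw [hSκ l hl q hq, hsymm', hfun', h1]
    exact Φ.right_inv' (hball (hBs l hl _ hqB).1).2

/-- The invariance of weak homogeneity for submanifolds that are open and closed. -/
theorem exists_mem_localScaleSpace_of_isOpen {I : Set M} {I' : Set M'} {s : ℝ}
    (hIo : IsOpen I') (hIc : IsClosed I')
    (Φ : PartialDiffeomorph (𝓡 m) (𝓡 m) M M' ∞)
    (hΦI : ∀ q ∈ Φ.source, q ∈ I ↔ Φ q ∈ I') {U : Opens M} {U' : Opens M'}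
    (hΦU : ∀ x ∈ U, x ∈ Φ.source ∧ Φ x ∈ U') (hUU' : ∀ x ∈ Φ.source, Φ x ∈ U' → x ∈ U)
    (hU'Φ : ∀ x ∈ U', x ∈ Φ.target)
    {p : M} (hpΦ : p ∈ Φ.source) {t : ManifoldDistribution m M' U'}
    {ρ' : EulerFieldNear m I' (Φ p)} (ht : t ∈ localScaleSpace ρ' s U') :
    ∃ ρ : EulerFieldNear m I p, t.pullback Φ hΦU ∈ localScaleSpace ρ s U := by
  obtain ⟨V', hV'U', hV'ρ, hV'p, S', hS', hbd⟩ := ht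
  have hpre : ∀ O : Set M', IsOpen O → IsOpen (Φ.source ∩ Φ ⁻¹' O) := fun O hO =>
    Φ.toOpenPartialHomeomorph.isOpen_inter_preimage hO
  let Ω : Opens M := ⟨Φ.source ∩ Φ ⁻¹' ρ'.domain, hpre _ ρ'.domain.isOpen⟩
  have hΩ1 : I ∩ (Ω : Set M) = Φ.source ∩ Φ ⁻¹' (ρ'.domain ∩ I') := by
    ext q
    constructor
    · rintro ⟨h1, h2, h3⟩
      exact ⟨h2, h3, (hΦI q h2).1 h1⟩
    · rintro ⟨h1, h2, h3⟩
      exact ⟨(hΦI q h1).2 h3, h1, h2⟩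
  have hΩ2 : (Ω : Set M) \ I = Φ.source ∩ Φ ⁻¹' (ρ'.domain ∩ I'ᶜ) := by
    ext q
    constructor
    · rintro ⟨⟨h1, h2⟩, h3⟩
      exact ⟨h1, h2, fun h => h3 ((hΦI q h1).2 h)⟩
    · rintro ⟨h1, h2, h3⟩
      exact ⟨⟨h1, h2⟩, fun h => h3 ((hΦI q h1).1 h)⟩
  let ρ : EulerFieldNear m I p := ⟨Ω, ⟨hpΦ, ρ'.mem_domain⟩, pullField Φ ρ'.field,
    isEuler_of_isOpen (hΩ1 ▸ hpre _ (ρ'.domain.isOpen.inter hIo))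
      (hΩ2 ▸ hpre _ (ρ'.domain.isOpen.inter hIc.isOpen_compl))
      (contMDiffOn_pullField Φ ρ'.domain.isOpen ρ'.isEuler.smooth)⟩
  let V : Opens M := ⟨Φ.source ∩ Φ ⁻¹' V', hpre _ V'.isOpen⟩
  let S : ℝ → PartialDiffeomorph (𝓡 m) (𝓡 m) M M ∞ := fun l => (Φ.trans (S' l)).trans Φ.symm
  have hSdef : ∀ l q, S l q = Φ.symm (S' l (Φ q)) := fun l q => rfl
  have hΦS : ∀ l ∈ Ioc (0 : ℝ) 1, ∀ q ∈ V, Φ (S l q) = S' l (Φ q) := fun l hl q hq =>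
    Φ.right_inv' (hU'Φ _ (hV'U' (hS'.stable l hl _ hq.2)))
  have hS : IsScalingFlow ρ.field V S := by
    refine ⟨fun l hl => ?_, fun l hl q hq => ?_, fun q hq => ?_⟩
    · ext q
      constructor
      · rintro ⟨⟨h1, h2⟩, h3⟩
        refine ⟨h1, ?_⟩
        have h4 : Φ q ∈ (S' l).source := h2
        rwa [hS'.source_eq l hl] at h4
      · rintro ⟨h1, h2⟩
        refine ⟨⟨h1, ?_⟩, ?_⟩
        · change Φ q ∈ (S' l).source
          rw [hS'.source_eq l hl]; exact h2
        · exact hU'Φ _ (hV'U' (hS'.stable l hl _ h2))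
    · have h1 := hS'.stable l hl _ hq.2
      refine ⟨Φ.map_target' (hU'Φ _ (hV'U' h1)), ?_⟩
      rw [mem_preimage, hΦS l hl q hq]
      exact h1
    · obtain ⟨γ, hγ0, hγ, hSγ⟩ := hS'.flow _ hq.2
      -- Each point of the curve is the image of its start under the flow, hence stays in V' and so
      -- in the target of Φ, where it can be transported back.
      have hγV : ∀ τ ≤ 0, γ τ ∈ V' := by
        intro τ hτ
        have hl : Real.exp τ ∈ Ioc (0 : ℝ) 1 := ⟨Real.exp_pos τ, Real.exp_le_one_iff.2 hτ⟩
        have h1 := hSγ _ hl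
        rw [Real.log_exp] at h1
        rw [← h1]
        exact hS'.stable _ hl _ hq.2
      refine ⟨Φ.symm ∘ γ, ?_, fun τ hτ => ?_, fun l hl => ?_⟩
      · rw [Function.comp_apply, hγ0]
        exact Φ.left_inv' hq.1
      · have hτΦ : γ τ ∈ Φ.target := hU'Φ _ (hV'U' (hγV τ hτ))
        have h1 := (Φ.symm.mdifferentiableAt (by simp) hτΦ).hasMFDerivAt.comp_hasMFDerivWithinAt τ
          (hγ τ hτ)
        refine HasMFDerivWithinAt.congr_mfderiv h1 (ContinuousLinearMap.ext fun a : ℝ => ?_)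
        change mfderiv (𝓡 m) (𝓡 m) Φ.symm (γ τ) (a • ρ'.field (γ τ)) =
          a • pullField Φ ρ'.field (Φ.symm (γ τ))
        rw [map_smul, mfderiv_symm_apply_pullField Φ ρ'.field hτΦ]
      · rw [hSdef, hSγ l hl]; rfl
  refine ⟨ρ, pullback_mem_localScaleSpace Φ hΦU t ρ (V := V)
    (fun q hq => hUU' q hq.1 (hV'U' hq.2)) (fun q hq => ⟨hq.1, hV'ρ hq.2⟩) ?_ hS hS'
    hV'U' (fun q hq => hq.2) hΦS hbd⟩
  have h1 := closure_mem_nhds_of_mapsTo Φ.symm.toOpenPartialHomeomorph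
    (p := Φ p) (V := V') (W := V) (Φ.map_source' hpΦ) hV'p ?_
  · change closure _ ∈ 𝓝 (Φ.symm (Φ p)) at h1
    have h2 : Φ.symm (Φ p) = p := Φ.left_inv' hpΦ
    rwa [h2] at h1
  · intro q hq hqΦ
    have h2 : Φ (Φ.symm q) = q := Φ.right_inv' hqΦ
    refine ⟨Φ.map_target' hqΦ, ?_⟩
    change Φ (Φ.symm q) ∈ V'
    rw [h2]; exact hq

omit [IsManifold (𝓡 m) ∞ M] in
theorem IsEmbeddedSubmanifold.isOpen_of_le {I : Set M} (hI : IsEmbeddedSubmanifold (m := m) n I)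
    (hn : m ≤ n) : IsOpen I := by
  rw [isOpen_iff_mem_nhds]
  intro p hp
  obtain ⟨κ, -, hpκ, hIκ⟩ := hI.2 p hp
  refine mem_of_superset (κ.open_source.mem_nhds hpκ) fun q hq => (hIκ q hq).2 fun j hj => ?_
  exact absurd (hn.trans hj) (not_le.2 j.2)

/-- Φ carries points of I in the interior of the closure of U to points of I' of the same kind, so
the property at Φ p can be pulled back to p. Codimension zero is treated apart: the Euler condition
is then void and gives no linearization. -/
theorem pullback_mem_weaklyHomogeneous [T2Space M'] {I : Set M} {I' : Set M'} {s : ℝ}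
    (hIc : IsClosed I') (hI' : IsEmbeddedSubmanifold (m := m) n I')
    (Φ : PartialDiffeomorph (𝓡 m) (𝓡 m) M M' ∞)
    (hΦI : ∀ q ∈ Φ.source, q ∈ I ↔ Φ q ∈ I') {U : Opens M} {U' : Opens M'}
    (hΦU : ∀ x ∈ U, x ∈ Φ.source ∧ Φ x ∈ U') (hUU' : ∀ x ∈ Φ.source, Φ x ∈ U' → x ∈ U)
    (hU'Φ : ∀ x ∈ U', x ∈ Φ.target) (hint : I ∩ interior (closure (U : Set M)) ⊆ Φ.source)
    {t : ManifoldDistribution m M' U'} (ht : t ∈ weaklyHomogeneous I' s U') :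
    t.pullback Φ hΦU ∈ weaklyHomogeneous I s U := by
  intro p hp
  have hpΦ := hint hp
  have h1 : Φ p ∈ I' ∩ interior (closure (U' : Set M')) := by
    refine ⟨(hΦI p hpΦ).1 hp.1, mem_interior_iff_mem_nhds.2 ?_⟩
    exact closure_mem_nhds_of_mapsTo Φ.toOpenPartialHomeomorph hpΦ
      (mem_interior_iff_mem_nhds.1 hp.2) fun q hq _ => (hΦU q hq).2
  obtain ⟨ρ', hρ'⟩ := ht _ h1
  rcases lt_or_ge n m with hn | hn
  · exact exists_mem_localScaleSpace_of_lt hI' hn Φ hΦI hΦU hUU' hp.1 hpΦ hρ'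
  · exact exists_mem_localScaleSpace_of_isOpen (hI'.isOpen_of_le hn) hIc Φ hΦI hΦU hUU' hU'Φ hpΦ hρ'

end Invariance

end WeakHomogeneity

end

/-! ### The theorem: invariance under diffeomorphisms and independence of the Euler fields. -/

theorem mainTheorem5 {m n n' : ℕ} {M M' : Type*}
    [TopologicalSpace M] [T2Space M]
    [ChartedSpace (EuclideanSpace ℝ (Fin m)) M] [IsManifold (𝓡 m) ∞ M]
    [TopologicalSpace M'] [T2Space M']
    [ChartedSpace (EuclideanSpace ℝ (Fin m)) M'] [IsManifold (𝓡 m) ∞ M']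
    (I : Set M) (hIc : IsClosed I) (hI : WeakHomogeneity.IsEmbeddedSubmanifold (m := m) n I)
    (I' : Set M') (hIc' : IsClosed I')
    (hI' : WeakHomogeneity.IsEmbeddedSubmanifold (m := m) n' I')
    (s : ℝ) :
    -- invariance under diffeomorphisms `Φ` between open sets that map `I` to `I'`
    (∀ Φ : PartialDiffeomorph (𝓡 m) (𝓡 m) M M' ∞,
      Φ '' (I ∩ Φ.source) = I' ∩ Φ.target →
      ∀ (U : TopologicalSpace.Opens M) (U' : TopologicalSpace.Opens M')
        (hU : (U : Set M) ⊆ Φ.source) (hUU' : Φ '' (U : Set M) = U'),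
        I ∩ interior (closure (U : Set M)) ⊆ Φ.source →
        I' ∩ interior (closure (U' : Set M')) ⊆ Φ.target →
        WeakHomogeneity.ManifoldDistribution.pullback Φ
            (fun x hx => ⟨hU hx, hUU'.subset (Set.mem_image_of_mem Φ hx)⟩) ''
          WeakHomogeneity.weaklyHomogeneous I' s U' =
            WeakHomogeneity.weaklyHomogeneous I s U) ∧
    -- independence of the choice of Euler vector fields, in positive codimension
    (n < m →
      (∀ (U : TopologicalSpace.Opens M) (p : M), p ∈ I → (U : Set M) ∪ I ∈ nhds p →
        ∀ ρ₁ ρ₂ : WeakHomogeneity.EulerFieldNear m I p,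
          WeakHomogeneity.localScaleSpace ρ₁ s U = WeakHomogeneity.localScaleSpace ρ₂ s U) ∧
      (∀ U : TopologicalSpace.Opens M,
        (∀ p ∈ I ∩ interior (closure (U : Set M)), (U : Set M) ∪ I ∈ nhds p) →
        ∀ ρ : (p : M) → p ∈ I → WeakHomogeneity.EulerFieldNear m I p,
          WeakHomogeneity.weaklyHomogeneous I s U =
            {t | ∀ (p : M) (hp : p ∈ I), p ∈ interior (closure (U : Set M)) →
              t ∈ WeakHomogeneity.localScaleSpace (ρ p hp) s U})) := by
  refine ⟨fun Φ hΦI U U' hU hUU' hint hint' => ?_, fun hn => ?_⟩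
  · have hinj : ∀ x ∈ Φ.source, Φ.symm (Φ x) = x := fun x hx => Φ.left_inv' hx
    have hinj' : ∀ x ∈ Φ.target, Φ (Φ.symm x) = x := fun x hx => Φ.right_inv' hx
    have hI1 : ∀ q ∈ Φ.source, q ∈ I ↔ Φ q ∈ I' := by
      refine fun q hq => ⟨fun h => (hΦI.subset ⟨q, ⟨h, hq⟩, rfl⟩).1, fun h => ?_⟩
      obtain ⟨q', ⟨h1, h2⟩, h3⟩ := hΦI.superset ⟨h, Φ.map_source' hq⟩
      rw [← hinj q hq, ← h3, hinj q' h2]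
      exact h1
    have hΦU : ∀ x ∈ U, x ∈ Φ.source ∧ Φ x ∈ U' :=
      fun x hx => ⟨hU hx, hUU'.subset (Set.mem_image_of_mem Φ hx)⟩
    have hUU1 : ∀ x ∈ Φ.source, Φ x ∈ U' → x ∈ U := by
      intro x hx hxU
      obtain ⟨u, hu, hux⟩ := hUU'.superset hxU
      rw [← hinj x hx, ← hux, hinj u (hU hu)]
      exact hu
    have hU'Φ : ∀ x ∈ U', x ∈ Φ.target := by
      intro x hx
      obtain ⟨u, hu, rfl⟩ := hUU'.superset hx
      exact Φ.map_source' (hU hu)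
    have hΦU' : ∀ x ∈ U', x ∈ Φ.symm.source ∧ Φ.symm x ∈ U := fun x hx =>
      ⟨hU'Φ x hx, hUU1 _ (Φ.map_target' (hU'Φ x hx)) (by rw [hinj' x (hU'Φ x hx)]; exact hx)⟩
    refine Set.Subset.antisymm ?_ fun t ht => ?_
    · rintro _ ⟨t, ht, rfl⟩
      exact WeakHomogeneity.pullback_mem_weaklyHomogeneous hIc' hI' Φ hI1 hΦU hUU1 hU'Φ hint ht
    -- The preimage of t is its pullback by Φ⁻¹; it lies in the space on M' by the same lemma with
    -- the roles exchanged, which is where the closure condition on U' enters.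
    · refine ⟨t.pullback Φ.symm hΦU', ?_, WeakHomogeneity.pullback_pullback_symm Φ hΦU hΦU' t⟩
      refine WeakHomogeneity.pullback_mem_weaklyHomogeneous hIc hI Φ.symm (fun q hq => ?_) hΦU'
        (fun x hx hxU => ?_) (fun x hx => hU hx) hint' ht
      · have h := hI1 _ (Φ.map_target' hq)
        change Φ.symm q ∈ I ↔ Φ (Φ.symm q) ∈ I' at h
        rw [hinj' q hq] at h
        exact h.symm
      · rw [← hinj' x hx]
        exact (hΦU _ hxU).2
  · have key : ∀ (U : TopologicalSpace.Opens M) (p : M), p ∈ I → (U : Set M) ∪ I ∈ nhds p →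
        ∀ ρ₁ ρ₂ : WeakHomogeneity.EulerFieldNear m I p,
          WeakHomogeneity.localScaleSpace ρ₁ s U = WeakHomogeneity.localScaleSpace ρ₂ s U :=
      fun U p hp hU ρ₁ ρ₂ => Set.Subset.antisymm
        (WeakHomogeneity.localScaleSpace_subset hI hn hp hU ρ₁ ρ₂ s)
        (WeakHomogeneity.localScaleSpace_subset hI hn hp hU ρ₂ ρ₁ s)
    refine ⟨key, fun U hU ρ => Set.ext fun t => ⟨fun ht p hp hpU => ?_, fun ht p hp => ?_⟩⟩
    · obtain ⟨ρ', hρ'⟩ := ht p ⟨hp, hpU⟩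
      rwa [key U p hp (hU p ⟨hp, hpU⟩) (ρ p hp) ρ']
    · exact ⟨ρ p hp.1, ht p hp.1 hp.2⟩
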